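/- \textbf{Notation.} For real $s$ and $b>0$ let $H^s=H^s(\mathbf R)$ be the real-valued $L^2$-based Sobolev space and $H^s_b:=\{f\in H^s:\cosh(\cdot)^b f\in H^s\}$, with norm $\|f\|_{s,b}:=\|\cosh(\cdot)^bf\|_{H^s}$. Let $E^s_b$ and $O^s_b$ be its subspaces of even and of odd functions, and $E^s_{b,0}:=\{f\in E^s_b:\int_{\mathbf R}f\,dx=0\}$. Put $\delta f(x):=f(x+\tfrac12)-f(x-\tfrac12)$. A number $c\in\mathbf R$ is called a \emph{$V$-admissible wave speed}, with decay rate $\beta>0$ and solitary wave $\sigma$, if $\sigma\in E^2_\beta$ is nonzero, $c^2\sigma''-\delta^2V'(\sigma)=0$, and the operator $\mathcal Hf:=c^2f''-\delta^2\bigl(V''(\sigma)f\bigr)$ is a homeomorphism from $E^2_\beta$ onto $E^0_{\beta,0}$. \textbf{Theorem.} Let $V:\mathbf R\to\mathbf R$ be $C^5$ with $V'(0)=0$, let $c\neq0$ be a $V$-admissible wave speed with decay rate $\beta$ and solitary wave $\sigma$, and fix $\kappa>0$. For $n\in\mathbf N$ let $$\mu_n:=\frac{\kappa}{4\pi^2c^2n^2-\kappa}.$$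 Then there exist $C>0$ and $N\in\mathbf N$ such that for every $n\ge N$ one has $\mu_n>0$ and $\sqrt{\kappa(1+\mu_n)/(c^2\mu_n)}=2n\pi$ (the antiresonance condition), and there is a unique pair of functions $\rho_1,\rho_2\in H^2_\beta$ with the following properties: (i) with $\mu=\mu_n$, the functions $\rho_1,\rho_2$ solve the mass-in-mass traveling wave system $$c^2\rho_1''-\delta^2V'(\rho_1)-\kappa\,\delta\rho_2=0,\qquad c^2\mu\rho_2''+\kappa(1+\mu)\rho_2+\mu\,\delta V'(\rho_1)=0;$$ (ii) $\rho_1$ is even and $\rho_2$ is odd; (iii) $\|\sigma-\rho_1\|_{2,\beta}\le C/n^2$ and $\|\rho_2\|_{2,\beta}\le C/n$. Moreover, if $V$ is smooth ($C^\infty$), then for every $n\ge N$ these $\rho_1$ and $\rho_2$ are smooth, and for every real $s\ge0$ there is a constant $C_s>0$, independent of $n$, such that for all $n\ge N$ the functions $\sigma,\rho_1,\rho_2$ lie in $H^s_\beta$ and $\|\sigma-\rho_1\|_{s,\beta}+\|\rho_2\|_{s,\beta}\le C_s/n^2$. -/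

import Mathlib

open MeasureTheory
open scoped ContDiff SchwartzMap

noncomputable section

/-- `f ∈ L²(ℝ)` lies in the (Bessel potential) Sobolev space `H^s(ℝ)`. -/
def MemHs (s : ℝ) (f : ℝ → ℝ) : Prop :=
  ∃ hf : MemLp (fun x => (f x : ℂ)) 2 (volume : Measure ℝ),
    TemperedDistribution.MemSobolev s 2 ((hf.toLp _ : Lp ℂ 2 (volume : Measure ℝ)) : 𝓢'(ℝ, ℂ))

/-- `g = ⟨D⟩^s f`, where `⟨D⟩^s` is the Bessel potential operator of order `s`; the norm of `f`
in `H^s` is the `L²` norm of `g` (the symbol is `(1 + ξ²)^(s/2)` for the Fourier transform with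
kernel `e^{-2πixξ}`, which gives an equivalent norm to the one with `(1 + (2πξ)²)^(s/2)`). -/
def IsBesselOf (s : ℝ) (f : ℝ → ℝ) (g : Lp ℂ 2 (volume : Measure ℝ)) : Prop :=
  ∃ hf : MemLp (fun x => (f x : ℂ)) 2 (volume : Measure ℝ),
    TemperedDistribution.besselPotential ℝ ℂ s
      ((hf.toLp _ : Lp ℂ 2 (volume : Measure ℝ)) : 𝓢'(ℝ, ℂ)) = (g : 𝓢'(ℝ, ℂ))

theorem memHs_iff_exists_isBesselOf (s : ℝ) (f : ℝ → ℝ) :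
    MemHs s f ↔ ∃ g, IsBesselOf s f g := by
  constructor
  · rintro ⟨hf, g, hg⟩
    exact ⟨g, hf, hg⟩
  · rintro ⟨g, hf, hg⟩
    exact ⟨hf, g, hg⟩

theorem toTempered_injective {u v : Lp ℂ 2 (volume : Measure ℝ)}
    (h : (u : 𝓢'(ℝ, ℂ)) = (v : 𝓢'(ℝ, ℂ))) : u = v := by
  have hk := Lp.ker_toTemperedDistributionCLM_eq_bot (F := ℂ) (E := ℝ)
    (μ := (volume : Measure ℝ)) (p := 2)
  exact LinearMap.ker_eq_bot.mp hk h

theorem IsBesselOf.unique {s : ℝ} {f : ℝ → ℝ} {g g' : Lp ℂ 2 (volume : Measure ℝ)}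
    (h : IsBesselOf s f g) (h' : IsBesselOf s f g') : g = g' := by
  obtain ⟨hf, h⟩ := h
  obtain ⟨hf', h'⟩ := h'
  exact toTempered_injective (h.symm.trans h')

theorem IsBesselOf.congr {s : ℝ} {f f' : ℝ → ℝ} {g : Lp ℂ 2 (volume : Measure ℝ)}
    (h : IsBesselOf s f g) (hff : f =ᵐ[volume] f') : IsBesselOf s f' g := by
  obtain ⟨hf, h⟩ := h
  have hc : (fun x => (f x : ℂ)) =ᵐ[volume] fun x => (f' x : ℂ) := by
    filter_upwards [hff] with x hx
    rw [hx]
  have hf' : MemLp (fun x => (f' x : ℂ)) 2 (volume : Measure ℝ) := hf.ae_eq hc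
  refine ⟨hf', ?_⟩
  rw [← h, MemLp.toLp_congr hf hf' hc]

theorem IsBesselOf.add {s : ℝ} {f f' : ℝ → ℝ} {g g' : Lp ℂ 2 (volume : Measure ℝ)}
    (h : IsBesselOf s f g) (h' : IsBesselOf s f' g') :
    IsBesselOf s (fun x => f x + f' x) (g + g') := by
  obtain ⟨hf, h⟩ := h
  obtain ⟨hf', h'⟩ := h'
  have hc : (fun x => (f x : ℂ)) + (fun x => (f' x : ℂ)) =
      fun x => ((f x + f' x : ℝ) : ℂ) := by
    funext x
    simp
  have hs : MemLp (fun x => ((f x + f' x : ℝ) : ℂ)) 2 (volume : Measure ℝ) := by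
    rw [← hc]; exact hf.add hf'
  refine ⟨hs, ?_⟩
  have e : hs.toLp _ = hf.toLp _ + hf'.toLp _ := by
    rw [← MemLp.toLp_add]
    exact MemLp.toLp_congr _ _ (by rw [hc])
  rw [e]
  simp only [← Lp.toTemperedDistributionCLM_apply, map_add] at h h' ⊢
  rw [h, h']

theorem IsBesselOf.smul {s : ℝ} {f : ℝ → ℝ} {g : Lp ℂ 2 (volume : Measure ℝ)} (a : ℝ)
    (h : IsBesselOf s f g) : IsBesselOf s (fun x => a * f x) (a • g) := by
  obtain ⟨hf, h⟩ := h
  have hc : (a : ℂ) • (fun x => (f x : ℂ)) = fun x => ((a * f x : ℝ) : ℂ) := by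
    funext x
    simp
  have hs : MemLp (fun x => ((a * f x : ℝ) : ℂ)) 2 (volume : Measure ℝ) := by
    rw [← hc]; exact hf.const_smul (a : ℂ)
  refine ⟨hs, ?_⟩
  have e : hs.toLp _ = (a : ℂ) • hf.toLp _ := by
    rw [← MemLp.toLp_const_smul]
    exact MemLp.toLp_congr _ _ (by rw [hc])
  have e' : a • g = (a : ℂ) • g := by
    apply Lp.ext
    filter_upwards [Lp.coeFn_smul a g, Lp.coeFn_smul (a : ℂ) g] with x h1 h2
    rw [h1, h2]
    simp
  rw [e, e']
  simp only [← Lp.toTemperedDistributionCLM_apply, map_smul] at h ⊢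
  rw [h]

theorem isBesselOf_zero (s : ℝ) : IsBesselOf s (fun _ => 0) 0 := by
  have h0 : MemLp (fun _ : ℝ => ((0 : ℝ) : ℂ)) 2 (volume : Measure ℝ) := by simp
  refine ⟨h0, ?_⟩
  have e : h0.toLp _ = 0 := by
    apply Lp.ext
    filter_upwards [h0.coeFn_toLp, Lp.coeFn_zero ℂ 2 (volume : Measure ℝ)] with x h1 h2
    rw [h1, h2]
    simp
  rw [e]
  simp only [← Lp.toTemperedDistributionCLM_apply, map_zero]

theorem IsBesselOf.ae_eq_zero {s : ℝ} {f : ℝ → ℝ} (h : IsBesselOf s f 0) :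
    f =ᵐ[volume] fun _ => 0 := by
  obtain ⟨hf, h⟩ := h
  have h1 := congrArg (TemperedDistribution.besselPotential ℝ ℂ (-s)) h
  rw [TemperedDistribution.besselPotential_besselPotential_apply] at h1
  simp only [add_neg_cancel, TemperedDistribution.besselPotential_zero,
    ContinuousLinearMap.coe_id', id_eq, ← Lp.toTemperedDistributionCLM_apply, map_zero] at h1
  have h2 : hf.toLp _ = 0 := by
    apply toTempered_injective
    simp only [← Lp.toTemperedDistributionCLM_apply, map_zero]
    exact h1
  have h3 := hf.coeFn_toLp
  rw [h2] at h3
  filter_upwards [h3, Lp.coeFn_zero ℂ 2 (volume : Measure ℝ)] with x h4 h5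
  rw [h5] at h4
  simpa using h4.symm

/-- The exponentially weighted function `cosh(·)^b f`. -/
def coshMul (b : ℝ) (f : ℝ → ℝ) : ℝ → ℝ := fun x => Real.cosh x ^ b * f x

/-- The weighted Sobolev space `H^s_b = {f ∈ H^s : cosh(·)^b f ∈ H^s}` of real-valued functions
on `ℝ` (modulo equality almost everywhere). -/
def WSob (s b : ℝ) : Submodule ℝ (ℝ →ₘ[volume] ℝ) where
  carrier := {f | MemHs s f ∧ MemHs s (coshMul b f)}
  add_mem' := by
    rintro f g ⟨hf, hf'⟩ ⟨hg, hg'⟩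
    simp only [memHs_iff_exists_isBesselOf, Set.mem_ofPred_eq] at *
    obtain ⟨u, hu⟩ := hf
    obtain ⟨u', hu'⟩ := hf'
    obtain ⟨v, hv⟩ := hg
    obtain ⟨v', hv'⟩ := hg'
    refine ⟨⟨u + v, (hu.add hv).congr ?_⟩, ⟨u' + v', (hu'.add hv').congr ?_⟩⟩
    · filter_upwards [AEEqFun.coeFn_add f g] with x hx
      rw [hx]; rfl
    · filter_upwards [AEEqFun.coeFn_add f g] with x hx
      simp only [coshMul, hx, Pi.add_apply]; ring
  zero_mem' := by
    simp only [memHs_iff_exists_isBesselOf, Set.mem_ofPred_eq]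
    refine ⟨⟨0, (isBesselOf_zero s).congr ?_⟩, ⟨0, (isBesselOf_zero s).congr ?_⟩⟩
    · filter_upwards [AEEqFun.coeFn_zero (α := ℝ) (β := ℝ) (μ := volume)] with x hx
      rw [hx]; rfl
    · filter_upwards [AEEqFun.coeFn_zero (α := ℝ) (β := ℝ) (μ := volume)] with x hx
      simp [coshMul, hx]
  smul_mem' := by
    rintro a f ⟨hf, hf'⟩
    simp only [memHs_iff_exists_isBesselOf, Set.mem_ofPred_eq] at *
    obtain ⟨u, hu⟩ := hf
    obtain ⟨u', hu'⟩ := hf'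
    refine ⟨⟨a • u, (hu.smul a).congr ?_⟩, ⟨a • u', (hu'.smul a).congr ?_⟩⟩
    · filter_upwards [AEEqFun.coeFn_smul a f] with x hx
      rw [hx]; rfl
    · filter_upwards [AEEqFun.coeFn_smul a f] with x hx
      simp only [coshMul, hx, Pi.smul_apply, smul_eq_mul]; ring

/-- The underlying class of functions of an element of `H^s_b`, as a function. -/
instance (s b : ℝ) : CoeFun (WSob s b) (fun _ => ℝ → ℝ) :=
  ⟨fun f => ((f : ℝ →ₘ[volume] ℝ) : ℝ → ℝ)⟩

theorem WSob.exists_bessel {s b : ℝ} (f : WSob s b) : ∃ g, IsBesselOf s (coshMul b f) g :=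
  (memHs_iff_exists_isBesselOf _ _).mp f.2.2

/-- The injective linear map `f ↦ ⟨D⟩^s (cosh(·)^b f)` from `H^s_b` to `L²`. -/
def WSob.toL2 (s b : ℝ) : WSob s b →ₗ[ℝ] Lp ℂ 2 (volume : Measure ℝ) where
  toFun f := (WSob.exists_bessel f).choose
  map_add' f g := by
    refine IsBesselOf.unique (WSob.exists_bessel (f + g)).choose_spec
      (((WSob.exists_bessel f).choose_spec.add (WSob.exists_bessel g).choose_spec).congr ?_)
    filter_upwards [AEEqFun.coeFn_add (f : ℝ →ₘ[volume] ℝ) (g : ℝ →ₘ[volume] ℝ)] with x hx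
    simp only [coshMul, Submodule.coe_add, hx, Pi.add_apply]; ring
  map_smul' a f := by
    refine IsBesselOf.unique (WSob.exists_bessel (a • f)).choose_spec
      (((WSob.exists_bessel f).choose_spec.smul a).congr ?_)
    filter_upwards [AEEqFun.coeFn_smul a (f : ℝ →ₘ[volume] ℝ)] with x hx
    simp only [coshMul, Submodule.coe_smul, hx, Pi.smul_apply, smul_eq_mul]; ring

theorem WSob.toL2_spec {s b : ℝ} (f : WSob s b) :
    IsBesselOf s (coshMul b f) (WSob.toL2 s b f) :=
  (WSob.exists_bessel f).choose_spec

theorem WSob.toL2_injective (s b : ℝ) : Function.Injective (WSob.toL2 s b) := by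
  rw [injective_iff_map_eq_zero]
  intro f hf
  have h := WSob.toL2_spec f
  rw [hf] at h
  apply Subtype.ext
  apply AEEqFun.ext
  filter_upwards [h.ae_eq_zero, AEEqFun.coeFn_zero (α := ℝ) (β := ℝ) (μ := volume)] with x hx h0
  have hc : Real.cosh x ^ b ≠ 0 := (Real.rpow_pos_of_pos (Real.cosh_pos x) b).ne'
  have hz := (mul_eq_zero.mp hx).resolve_left hc
  rw [hz]
  exact h0.symm

/-- The norm `‖f‖_{s,b} = ‖cosh(·)^b f‖_{H^s}`. -/
instance (s b : ℝ) : NormedAddCommGroup (WSob s b) :=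
  NormedAddCommGroup.induced (WSob s b) (Lp ℂ 2 (volume : Measure ℝ)) (WSob.toL2 s b)
    (WSob.toL2_injective s b)

instance (s b : ℝ) : NormedSpace ℝ (WSob s b) :=
  NormedSpace.induced ℝ (WSob s b) (Lp ℂ 2 (volume : Measure ℝ)) (WSob.toL2 s b)

theorem WSob.norm_def {s b : ℝ} (f : WSob s b) : ‖f‖ = ‖WSob.toL2 s b f‖ := rfl

/-- The subspace `E^s_b` of even functions in `H^s_b`. -/
def EvenSob (s b : ℝ) : Set (WSob s b) := {f | ∀ᵐ x : ℝ, f (-x) = f x}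

/-- The subspace `E^s_{b,0}` of even functions in `H^s_b` with vanishing integral. -/
def EvenSobZero (s b : ℝ) : Set (WSob s b) :=
  {f | f ∈ EvenSob s b ∧ Integrable (fun x => f x) ∧ ∫ x, f x = 0}

/-- The subspace `O^s_b` of odd functions in `H^s_b`. -/
def OddSob (s b : ℝ) : Set (WSob s b) := {f | ∀ᵐ x : ℝ, f (-x) = -f x}

/-- `g` is the second weak derivative `f''` of `f`. -/
def IsWeakDeriv2 (f g : ℝ → ℝ) : Prop :=
  LocallyIntegrable f ∧ LocallyIntegrable g ∧
    ∀ φ : ℝ → ℝ, ContDiff ℝ ∞ φ → HasCompactSupport φ →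
      ∫ x, f x * iteratedDeriv 2 φ x = ∫ x, g x * φ x

/-- The difference operator `δf(x) = f(x + 1/2) - f(x - 1/2)`. -/
def delta (f : ℝ → ℝ) : ℝ → ℝ := fun x => f (x + 1 / 2) - f (x - 1 / 2)

/-- `g = Hf`, where `Hf = c² f'' - δ²(V''(σ) f)`. -/
def IsLinearization (V : ℝ → ℝ) (c : ℝ) (σ f g : ℝ → ℝ) : Prop :=
  ∃ f₂ : ℝ → ℝ, IsWeakDeriv2 f f₂ ∧
    ∀ᵐ x : ℝ, g x = c ^ 2 * f₂ x - delta (delta fun y => deriv (deriv V) (σ y) * f y) x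

/-- `c` is a `V`-admissible wave speed, with decay rate `β > 0` and solitary wave `σ`: the nonzero
function `σ ∈ E^2_β` solves `c² σ'' - δ² V'(σ) = 0`, and the operator
`Hf = c² f'' - δ²(V''(σ) f)` is a homeomorphism from `E^2_β` onto `E^0_{β,0}`. -/
structure IsAdmissible (V : ℝ → ℝ) (c β : ℝ) (σ : WSob 2 β) : Prop where
  rate_pos : 0 < β
  even : σ ∈ EvenSob 2 β
  ne_zero : σ ≠ 0
  wave : ∃ σ₂ : ℝ → ℝ, IsWeakDeriv2 σ σ₂ ∧
    ∀ᵐ x : ℝ, c ^ 2 * σ₂ x - delta (delta fun y => deriv V (σ y)) x = 0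
  homeo : ∃ T : EvenSob 2 β ≃ₜ EvenSobZero 0 β,
    ∀ f : EvenSob 2 β, IsLinearization V c σ (f : WSob 2 β) (T f : WSob 0 β)

/-- The mass-in-mass traveling wave system
`c² ρ₁'' - δ² V'(ρ₁) - κ δρ₂ = 0`, `c² μ ρ₂'' + κ(1 + μ) ρ₂ + μ δ V'(ρ₁) = 0`. -/
def IsTravelingWave (V : ℝ → ℝ) (c μ κ : ℝ) (ρ₁ ρ₂ : ℝ → ℝ) : Prop :=
  ∃ d₁ d₂ : ℝ → ℝ, IsWeakDeriv2 ρ₁ d₁ ∧ IsWeakDeriv2 ρ₂ d₂ ∧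
    (∀ᵐ x : ℝ, c ^ 2 * d₁ x - delta (delta fun y => deriv V (ρ₁ y)) x
      - κ * delta ρ₂ x = 0) ∧
    ∀ᵐ x : ℝ, c ^ 2 * μ * d₂ x + κ * (1 + μ) * ρ₂ x
      + μ * delta (fun y => deriv V (ρ₁ y)) x = 0

/-- The resonator mass `μ_n = κ / (4π²c²n² - κ)`. -/
def resonatorMass (c κ : ℝ) (n : ℕ) : ℝ :=
  κ / (4 * Real.pi ^ 2 * c ^ 2 * (n : ℝ) ^ 2 - κ)

/-- The natural frequency `ω_{c,μ,κ} = √(κ(1 + μ) / (c² μ))` of the resonator equation. -/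
def naturalFrequency (c μ κ : ℝ) : ℝ := Real.sqrt (κ * (1 + μ) / (c ^ 2 * μ))

/-- The pair `(ρ₁, ρ₂)` in `H^2_β` solves the traveling wave system with `μ = μ_n`, `ρ₁` is even,
`ρ₂` is odd, `‖σ - ρ₁‖_{2,β} ≤ C/n²` and `‖ρ₂‖_{2,β} ≤ C/n`. -/
structure IsMassSolution (V : ℝ → ℝ) (c κ β : ℝ) (σ : WSob 2 β) (C : ℝ) (n : ℕ)
    (ρ : WSob 2 β × WSob 2 β) : Prop where
  solves : IsTravelingWave V c (resonatorMass c κ n) κ ρ.1 ρ.2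
  even : ρ.1 ∈ EvenSob 2 β
  odd : ρ.2 ∈ OddSob 2 β
  close : ‖σ - ρ.1‖ ≤ C / (n : ℝ) ^ 2
  small : ‖ρ.2‖ ≤ C / (n : ℝ)

/-- `f` is (almost everywhere equal to) a smooth function. -/
def IsSmoothClass (f : ℝ → ℝ) : Prop := ∃ g : ℝ → ℝ, ContDiff ℝ ∞ g ∧ f =ᵐ[volume] g

end

/-! Put `w = 2πn` and let `G = V'`, so that `sin w = 0` and `cos w = 1`. For `μ = μ_n` the second
equation of the system reads `c² ρ₂'' + c² w² ρ₂ + δ G(ρ₁) = 0`. This is an oscillator whose forcing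
is a difference over an interval containing exactly `n` periods, so its only solution in `L²` is
`ρ₂ = R G(ρ₁)`, where `R` is convolution with a multiple of a sine restricted to a unit interval
(`resonator`, `eq_resonator`; two solutions in `L²` differ by a function of period one). In
particular `R` preserves the exponential weight and exchanges parity. It has norm `O(1/w)`, and
`O(1/w²)` if one derivative of the argument is given up (`HBound.resonator`, `HBound.resonator_sq`).

Substituting, one is left with `c² ρ₁'' = (δ² + κ δ R) G(ρ₁)`, a perturbation of the equation of the
solitary wave `σ`. With `ρ₁ = σ + f` it takes the form `H f = remainder f`
(`isLinearization_remainder_iff`), where `remainder 0 = O(1/w²)` because `σ` is smooth enough for the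
better bound, and where `remainder` is Lipschitz on the ball of radius `a` with constant
`O(a + 1/w)`. Its values are even with vanishing integral. Since `H` is linear, the continuity of
`H⁻¹` at zero is a bound for `H⁻¹` (`IsAdmissible.exists_inverse_bound`), and the contraction
principle gives a solution with `‖f‖ = O(1/w²)`, which is unique in that ball.

All of this requires passing between `H²_β` and classical functions. The predicate `HBound m b M f`
expresses that `f` is `C^m` with derivatives bounded by `M` in weighted `L²`. Elements of `H²_β` have
bounded continuous representatives (`WSob.exists_continuous`), a continuous second weak derivative is
a classical one (`IsWeakDeriv2.exists_hasDerivAt`), and conversely `HBound (2k) b M f` bounds the norm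
of `f` in `H^s_b` for `s ≤ 2k` (`HBound.exists_mem_wsob`), because `⟨D⟩² = 1 - (4π²)⁻¹ d²/dx²`.

The last part of the theorem is a bootstrap in the profile equation. It bounds all derivatives of
`ρ₁` uniformly in `n`, and then those of `ρ₁ - σ` by `‖ρ₁ - σ‖ + O(1/w²)`
(`IsProfile.exists_hbound`, `IsProfile.hbound_sub`). -/

/-! ### Bessel potentials of functions on the line -/

section Bessel

open TemperedDistribution FourierTransform ENNReal
open scoped LineDeriv Laplacian BoundedContinuousFunction

/-- Bessel potentials of nonpositive order are Fourier multipliers with symbol bounded by one. -/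
theorem exists_besselPotential_eq_of_nonpos {r : ℝ} (hr : r ≤ 0)
    (g : Lp ℂ 2 (volume : Measure ℝ)) :
    ∃ g' : Lp ℂ 2 (volume : Measure ℝ),
      besselPotential ℝ ℂ r (g : 𝓢'(ℝ, ℂ)) = (g' : 𝓢'(ℝ, ℂ)) ∧ ‖g'‖ ≤ ‖g‖ := by
  have hm : (fun x : ℝ => (((1 + ‖x‖ ^ 2) ^ (r / 2) : ℝ) : ℂ)).HasTemperateGrowth := by fun_prop
  have hb : ∀ x : ℝ, ‖(((1 + ‖x‖ ^ 2) ^ (r / 2) : ℝ) : ℂ)‖ ≤ 1 := by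
    intro x
    rw [Complex.norm_real, Real.norm_eq_abs, abs_eq_self.mpr (by positivity)]
    exact Real.rpow_le_one_of_one_le_of_nonpos (by nlinarith [norm_nonneg x]) (by linarith)
  set m : ℝ →ᵇ ℂ := BoundedContinuousFunction.ofNormedAddCommGroup _ hm.1.continuous 1 hb
  have hmem : MemLp (fun x : ℝ => (((1 + ‖x‖ ^ 2) ^ (r / 2) : ℝ) : ℂ)) ⊤ volume :=
    m.memLp_top
  have hn : ‖hmem.toLp _‖ ≤ 1 := by
    rw [Lp.norm_toLp]
    refine ENNReal.toReal_le_of_le_ofReal zero_le_one ?_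
    exact eLpNorm_le_of_ae_bound (p := ⊤) (Filter.Eventually.of_forall hb) |>.trans (by simp)
  refine ⟨𝓕⁻ ((hmem.toLp _) • (𝓕 g) : Lp ℂ 2 (volume : Measure ℝ)), ?_, ?_⟩
  · rw [besselPotential, TemperedDistribution.fourierMultiplierCLM_apply,
      ← Lp.fourierInv_toTemperedDistribution_eq, Lp.toTemperedDistribution_smul_eq hm,
      Lp.fourier_toTemperedDistribution_eq]
  · have h1 : ‖𝓕⁻ ((hmem.toLp _) • (𝓕 g) : Lp ℂ 2 (volume : Measure ℝ))‖
        = ‖((hmem.toLp _) • (𝓕 g) : Lp ℂ 2 (volume : Measure ℝ))‖ :=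
      (Lp.fourierTransformₗᵢ ℝ ℂ).symm.norm_map _
    rw [h1]
    calc _ ≤ ‖hmem.toLp _‖ * ‖𝓕 g‖ := Lp.norm_smul_le _ _
      _ ≤ 1 * ‖g‖ := by rw [Lp.norm_fourier_eq]; gcongr
      _ = ‖g‖ := one_mul _

/-- The scale of Sobolev spaces is decreasing, with norm-one inclusions. -/
theorem IsBesselOf.exists_of_le {s t : ℝ} (hst : s ≤ t) {f : ℝ → ℝ}
    {g : Lp ℂ 2 (volume : Measure ℝ)} (h : IsBesselOf t f g) :
    ∃ g', IsBesselOf s f g' ∧ ‖g'‖ ≤ ‖g‖ := by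
  obtain ⟨hf, h⟩ := h
  obtain ⟨g', h1, h2⟩ := exists_besselPotential_eq_of_nonpos (r := s - t) (by linarith) g
  refine ⟨g', ⟨hf, ?_⟩, h2⟩
  rw [← h1, ← h, besselPotential_besselPotential_apply]
  congr 2; ring

theorem isBesselOf_zero_order_iff {f : ℝ → ℝ} {g : Lp ℂ 2 (volume : Measure ℝ)} :
    IsBesselOf 0 f g ↔ ∃ hf : MemLp (fun x => (f x : ℂ)) 2 (volume : Measure ℝ), hf.toLp _ = g := by
  constructor
  · rintro ⟨hf, h⟩
    refine ⟨hf, toTempered_injective ?_⟩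
    simpa using h
  · rintro ⟨hf, rfl⟩
    exact ⟨hf, by simp⟩

/-- Sobolev embedding: the Fourier transform of `f ∈ H²` is integrable, so `f` has a bounded
continuous representative. -/
theorem exists_continuous_of_isBesselOf_two :
    ∃ C : ℝ, 0 ≤ C ∧ ∀ (f : ℝ → ℝ) (g : Lp ℂ 2 (volume : Measure ℝ)), IsBesselOf 2 f g →
      ∃ F : ℝ → ℝ, Continuous F ∧ f =ᵐ[volume] F ∧ ∀ x, |F x| ≤ C * ‖g‖ := by
  have hmem : MemLp (fun x : ℝ => (((1 + ‖x‖ ^ 2) ^ (-1 : ℝ) : ℝ) : ℂ)) 2 volume := by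
    have h2 : MemLp (fun x : ℝ => (1 + x ^ 2)⁻¹) 2 volume := by
      refine (memLp_two_iff_integrable_sq (by fun_prop)).2 ?_
      refine integrable_inv_one_add_sq.mono' (by fun_prop) (Filter.Eventually.of_forall fun x => ?_)
      have : (1 + x ^ 2)⁻¹ ≤ 1 := inv_le_one_of_one_le₀ (by nlinarith [sq_nonneg x])
      have h0 : 0 ≤ (1 + x ^ 2)⁻¹ := by positivity
      rw [Real.norm_eq_abs, abs_of_nonneg (by positivity)]
      nlinarith
    have := h2.ofReal (K := ℂ)
    convert this using 2 with x
    simp [Real.rpow_neg_one]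
  refine ⟨‖hmem.toLp _‖, norm_nonneg _, ?_⟩
  rintro f g ⟨hf, h⟩
  have hm : (fun x : ℝ => (((1 + ‖x‖ ^ 2) ^ (-1 : ℝ) : ℝ) : ℂ)).HasTemperateGrowth := by fun_prop
  have hm' : (fun x : ℝ => (((1 + ‖x‖ ^ 2) ^ ((2 : ℝ) / 2) : ℝ) : ℂ)).HasTemperateGrowth := by
    fun_prop
  set v : Lp ℂ 1 (volume : Measure ℝ) := (hmem.toLp _) • (𝓕 g)
  have hv : ‖v‖ ≤ ‖hmem.toLp _‖ * ‖g‖ := by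
    calc _ ≤ ‖hmem.toLp _‖ * ‖𝓕 g‖ := Lp.norm_smul_le _ _
      _ = _ := by rw [Lp.norm_fourier_eq]
  have hF : 𝓕 ((hf.toLp _ : Lp ℂ 2 (volume : Measure ℝ)) : 𝓢'(ℝ, ℂ)) = (v : 𝓢'(ℝ, ℂ)) := by
    rw [Lp.toTemperedDistribution_smul_eq hm, ← Lp.fourier_toTemperedDistribution_eq, ← h,
      fourier_besselPotential_eq_smulLeftCLM_fourier_apply,
      smulLeftCLM_smulLeftCLM_apply (by exact_mod_cast hm') hm]
    have he : ((fun x : ℝ => (((1 + ‖x‖ ^ 2) ^ ((2 : ℝ) / 2) : ℝ) : ℂ)) *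
        fun x : ℝ => (((1 + ‖x‖ ^ 2) ^ (-1 : ℝ) : ℝ) : ℂ)) = fun _ => 1 := by
      ext x
      have : (0 : ℝ) < 1 + ‖x‖ ^ 2 := by positivity
      rw [Pi.mul_apply, ← Complex.ofReal_mul, ← Real.rpow_add this]
      norm_num
    rw [he, smulLeftCLM_const, one_smul]
  set G := Real.Lp.fourierTransformInv v with hG
  have hGn : ∀ x, ‖G x‖ ≤ ‖v‖ := by
    intro x
    have h1 : G x = Real.Lp.fourierTransform v (-x) := rfl
    rw [h1]
    have := (Real.Lp.fourierTransform v).norm_coe_le_norm (-x)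
    refine this.trans ?_
    exact BoundedContinuousFunction.norm_ofNormedAddCommGroup_le _ (norm_nonneg _) _
  have hfG : (fun x => (f x : ℂ)) =ᵐ[volume] G := by
    have hl : LocallyIntegrable (fun x => (f x : ℂ)) volume := hf.locallyIntegrable (by norm_num)
    refine ae_eq_of_integral_contDiff_smul_eq hl G.continuous.locallyIntegrable ?_
    intro φ hφ hφc
    have hg₁ : HasCompactSupport (Complex.ofRealCLM ∘ φ) := hφc.comp_left rfl
    have hg₂ : ContDiff ℝ ∞ (Complex.ofRealCLM ∘ φ) := by fun_prop
    set ψ : 𝓢(ℝ, ℂ) := hg₁.toSchwartzMap hg₂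
    have hψ : ∀ x, ψ x = φ x := fun x => rfl
    have e1 : ∫ x, φ x • (f x : ℂ) = ((hf.toLp _ : Lp ℂ 2 (volume : Measure ℝ)) : 𝓢'(ℝ, ℂ)) ψ := by
      rw [Lp.toTemperedDistribution_apply]
      refine integral_congr_ae ?_
      filter_upwards [hf.coeFn_toLp] with x hx
      rw [hx, hψ]; simp
    have e2 : ((hf.toLp _ : Lp ℂ 2 (volume : Measure ℝ)) : 𝓢'(ℝ, ℂ)) ψ
        = (v : 𝓢'(ℝ, ℂ)) (𝓕⁻ ψ) := by
      rw [← hF, TemperedDistribution.fourier_apply, FourierTransform.fourier_fourierInv_eq]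
    have e3 := VectorFourier.integral_fourierIntegral_smul_eq_flip (L := -innerₗ ℝ)
      (e := Real.fourierChar) (μ := volume) (ν := volume)
      (f := (ψ : ℝ → ℂ)) (g := (v : ℝ → ℂ)) Real.continuous_fourierChar (by
        have := (continuous_inner (𝕜 := ℝ) (E := ℝ)).neg
        exact this) ψ.integrable (L1.integrable_coeFn v)
    rw [e1, e2, Lp.toTemperedDistribution_apply]
    refine Eq.trans (Eq.trans ?_ e3) ?_
    · refine integral_congr_ae (Filter.Eventually.of_forall fun x => ?_)
      simp only [SchwartzMap.fourierInv_coe]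
      rfl
    · refine integral_congr_ae (Filter.Eventually.of_forall fun x => ?_)
      simp only [hψ, hG, Real.Lp.fourierTransformInv_apply]
      rw [Complex.coe_smul]
      congr 1
      simp only [Real.fourierInv_eq, VectorFourier.fourierIntegral]
      refine integral_congr_ae (Filter.Eventually.of_forall fun y => ?_)
      simp [mul_comm]
  refine ⟨fun x => (G x).re, Complex.continuous_re.comp G.continuous, ?_, ?_⟩
  · filter_upwards [hfG] with x hx
    rw [← hx]; simp
  · intro x
    exact (Complex.abs_re_le_norm _).trans ((hGn x).trans hv)

/-- For a function `f` with two classical derivatives in `L²`, the Bessel potential of order two is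
`f - f'' / (4π²)`. -/
theorem IsBesselOf.add_two {s : ℝ} {f f' f'' : ℝ → ℝ} {g : Lp ℂ 2 (volume : Measure ℝ)}
    (h1 : ∀ x, HasDerivAt f (f' x) x) (h2 : ∀ x, HasDerivAt f' (f'' x) x)
    (m0 : MemLp f 2 volume) (m1 : MemLp f' 2 volume) (m2 : MemLp f'' 2 volume)
    (h : IsBesselOf s (fun x => f x - (4 * Real.pi ^ 2)⁻¹ * f'' x) g) :
    IsBesselOf (s + 2) f g := by
  obtain ⟨hf, h⟩ := h
  have c0 : MemLp (fun x => (f x : ℂ)) 2 volume := m0.ofReal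
  have c1 : MemLp (fun x => (f' x : ℂ)) 2 volume := m1.ofReal
  have c2 : MemLp (fun x => (f'' x : ℂ)) 2 volume := m2.ofReal
  refine ⟨c0, ?_⟩
  have hΔ : Δ ((c0.toLp _ : Lp ℂ 2 (volume : Measure ℝ)) : 𝓢'(ℝ, ℂ)) =
      ((c2.toLp _ : Lp ℂ 2 (volume : Measure ℝ)) : 𝓢'(ℝ, ℂ)) := by
    ext φ
    rw [TemperedDistribution.laplacian_apply_apply, Lp.toTemperedDistribution_apply,
      Lp.toTemperedDistribution_apply]
    set φ1 : 𝓢(ℝ, ℂ) := SchwartzMap.derivCLM ℂ ℂ φ with hφ1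
    set φ2 : 𝓢(ℝ, ℂ) := SchwartzMap.derivCLM ℂ ℂ φ1 with hφ2
    have d1 : ∀ x, HasDerivAt φ (φ1 x) x := fun x => by
      have := φ.differentiableAt.hasDerivAt (x := x)
      simpa [hφ1, SchwartzMap.derivCLM_apply] using this
    have d2 : ∀ x, HasDerivAt φ1 (φ2 x) x := fun x => by
      have := φ1.differentiableAt.hasDerivAt (x := x)
      simpa [hφ2, SchwartzMap.derivCLM_apply] using this
    have eΔ : ∀ x, (Δ φ) x = φ2 x := by
      intro x
      rw [SchwartzMap.laplacian_apply, InnerProductSpace.laplacian_eq_iteratedDeriv_real,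
        iteratedDeriv_succ, iteratedDeriv_one]
      have : deriv φ = φ1 := funext fun y => (d1 y).deriv
      rw [this, (d2 x).deriv]
    have D1 : ∀ x, HasDerivAt (fun x => (f x : ℂ)) (f' x : ℂ) x := fun x => (h1 x).ofReal_comp
    have D2 : ∀ x, HasDerivAt (fun x => (f' x : ℂ)) (f'' x : ℂ) x := fun x => (h2 x).ofReal_comp
    have I : ∀ (a : ℝ → ℂ) (ψ : 𝓢(ℝ, ℂ)), MemLp a 2 volume →
        Integrable (a * (ψ : ℝ → ℂ)) volume := fun a ψ ha =>
      ha.integrable_mul (ψ.memLp 2 volume)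
    have p1 := integral_mul_deriv_eq_deriv_mul_of_integrable (u := fun x => (f x : ℂ))
      (v := φ1) (u' := fun x => (f' x : ℂ)) (v' := φ2) (fun x _ => D1 x) (fun x _ => d2 x)
      (I _ _ c0) (I _ _ c1) (I _ _ c0)
    have p2 := integral_mul_deriv_eq_deriv_mul_of_integrable (u := fun x => (f' x : ℂ))
      (v := φ) (u' := fun x => (f'' x : ℂ)) (v' := φ1) (fun x _ => D2 x) (fun x _ => d1 x)
      (I _ _ c1) (I _ _ c2) (I _ _ c1)
    calc ∫ x, (Δ φ) x • (c0.toLp _ : Lp ℂ 2 (volume : Measure ℝ)) x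
        = ∫ x, (f x : ℂ) * φ2 x := by
          refine integral_congr_ae ?_
          filter_upwards [c0.coeFn_toLp] with x hx
          rw [hx, eΔ, smul_eq_mul, mul_comm]
      _ = ∫ x, (f'' x : ℂ) * φ x := by rw [p1, p2, neg_neg]
      _ = _ := by
          refine integral_congr_ae ?_
          filter_upwards [c2.coeFn_toLp] with x hx
          rw [hx, smul_eq_mul, mul_comm]
  have hB : besselPotential ℝ ℂ 2 ((c0.toLp _ : Lp ℂ 2 (volume : Measure ℝ)) : 𝓢'(ℝ, ℂ)) =
      ((hf.toLp _ : Lp ℂ 2 (volume : Measure ℝ)) : 𝓢'(ℝ, ℂ)) := by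
    set u := ((c0.toLp _ : Lp ℂ 2 (volume : Measure ℝ)) : 𝓢'(ℝ, ℂ)) with hu
    have e1 : besselPotential ℝ ℂ 2 u = u - ((4 * Real.pi ^ 2)⁻¹ : ℝ) • Δ u := by
      rw [TemperedDistribution.laplacian_eq_fourierMultiplierCLM, besselPotential]
      have : (fun x : ℝ => (((1 + ‖x‖ ^ 2) ^ ((2:ℝ) / 2) : ℝ) : ℂ)) =
          (fun _ => (1 : ℂ)) + fun x : ℝ => ((‖x‖ ^ 2 : ℝ) : ℂ) := by
        ext x; simp
      have hmul : fourierMultiplierCLM ℂ (fun x : ℝ => (((1 + ‖x‖ ^ 2) ^ ((2:ℝ) / 2) : ℝ) : ℂ)) u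
          = fourierMultiplierCLM ℂ (fun _ : ℝ => (1 : ℂ)) u +
            fourierMultiplierCLM ℂ (fun x : ℝ => ((‖x‖ ^ 2 : ℝ) : ℂ)) u := by
        rw [this]
        simp only [TemperedDistribution.fourierMultiplierCLM_apply]
        rw [smulLeftCLM_add (by fun_prop) (by fun_prop), add_apply,
          FourierTransform.fourierInv_add]
      rw [hmul, TemperedDistribution.fourierMultiplierCLM_const, smul_smul, sub_eq_add_neg,
        ← neg_smul]
      congr 1
      · simp
      · have : -((4 * Real.pi ^ 2)⁻¹ * -(2 * Real.pi) ^ 2) = (1 : ℝ) := by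
          field_simp; norm_num
        rw [this, one_smul]
    have e2 : hf.toLp _ = c0.toLp _ - (((4 * Real.pi ^ 2)⁻¹ : ℝ) : ℂ) • c2.toLp _ := by
      rw [← MemLp.toLp_const_smul, ← MemLp.toLp_sub]
      refine MemLp.toLp_congr _ _ (Filter.Eventually.of_forall fun x => ?_)
      simp
    rw [e1, hΔ, e2]
    simp only [hu, ← Lp.toTemperedDistributionCLM_apply, map_sub, map_smul]
    congr 1
  rw [add_comm, ← besselPotential_besselPotential_apply, hB, h]

end Bessel

/-! ### Quantitative membership in weighted `L²` -/

/-- `WBound b M f` says that `cosh(·)^b f` lies in `L²(ℝ)` with norm at most `M`. -/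
def WBound (b M : ℝ) (f : ℝ → ℝ) : Prop :=
  0 ≤ M ∧ AEStronglyMeasurable f volume ∧ eLpNorm (coshMul b f) 2 volume ≤ ENNReal.ofReal M

theorem continuous_cosh_rpow (b : ℝ) : Continuous fun x : ℝ => Real.cosh x ^ b :=
  Real.continuous_cosh.rpow_const fun x => Or.inl (Real.cosh_pos x).ne'

theorem cosh_rpow_pos (b x : ℝ) : 0 < Real.cosh x ^ b := Real.rpow_pos_of_pos (Real.cosh_pos x) b

theorem one_le_cosh_rpow {b : ℝ} (hb : 0 ≤ b) (x : ℝ) : 1 ≤ Real.cosh x ^ b :=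
  Real.one_le_rpow (Real.one_le_cosh x) hb

theorem cosh_le_exp_mul_cosh_add (x t : ℝ) :
    Real.cosh x ≤ Real.exp |t| * Real.cosh (x + t) := by
  have h1 : Real.exp x ≤ Real.exp |t| * Real.exp (x + t) := by
    rw [← Real.exp_add]; gcongr; linarith [neg_abs_le t]
  have h2 : Real.exp (-x) ≤ Real.exp |t| * Real.exp (-(x + t)) := by
    rw [← Real.exp_add]; gcongr; linarith [le_abs_self t]
  rw [Real.cosh_eq, Real.cosh_eq]
  linarith

theorem cosh_rpow_le_of_abs_le {b : ℝ} (hb : 0 ≤ b) (x : ℝ) {t : ℝ} (ht : |t| ≤ 1) :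
    Real.cosh x ^ b ≤ Real.exp b * Real.cosh (x + t) ^ b := by
  have h1 : Real.cosh x ≤ Real.exp 1 * Real.cosh (x + t) :=
    (cosh_le_exp_mul_cosh_add x t).trans (by gcongr)
  calc Real.cosh x ^ b ≤ (Real.exp 1 * Real.cosh (x + t)) ^ b := by
        gcongr
    _ = Real.exp b * Real.cosh (x + t) ^ b := by
        rw [Real.mul_rpow (Real.exp_pos _).le (Real.cosh_pos _).le, ← Real.exp_mul, one_mul]

theorem coshMul_zero (f : ℝ → ℝ) : coshMul 0 f = f := by
  funext x; simp [coshMul]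

theorem AEStronglyMeasurable.coshMul {f : ℝ → ℝ} (hf : AEStronglyMeasurable f volume) (b : ℝ) :
    AEStronglyMeasurable (coshMul b f) volume :=
  (continuous_cosh_rpow b).aestronglyMeasurable.mul hf

namespace WBound

variable {b M M' : ℝ} {f g : ℝ → ℝ}

theorem nonneg (h : WBound b M f) : 0 ≤ M := h.1

theorem aesm (h : WBound b M f) : AEStronglyMeasurable f volume := h.2.1

theorem le (h : WBound b M f) : eLpNorm (coshMul b f) 2 volume ≤ ENNReal.ofReal M := h.2.2

theorem memLp (h : WBound b M f) : MemLp (coshMul b f) 2 volume :=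
  ⟨AEStronglyMeasurable.coshMul h.aesm b, h.le.trans_lt ENNReal.ofReal_lt_top⟩

theorem mono (h : WBound b M f) (hM : M ≤ M') : WBound b M' f :=
  ⟨h.1.trans hM, h.2.1, h.2.2.trans (ENNReal.ofReal_le_ofReal hM)⟩

theorem congr (h : WBound b M f) (hfg : f =ᵐ[volume] g) : WBound b M g := by
  refine ⟨h.1, h.2.1.congr hfg, ?_⟩
  rw [← eLpNorm_congr_ae (f := _root_.coshMul b f)]
  · exact h.2.2
  · filter_upwards [hfg] with x hx
    simp [_root_.coshMul, hx]

theorem add (h : WBound b M f) (h' : WBound b M' g) : WBound b (M + M') fun x => f x + g x := by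
  refine ⟨add_nonneg h.1 h'.1, h.2.1.add h'.2.1, ?_⟩
  have : _root_.coshMul b (fun x => f x + g x) = _root_.coshMul b f + _root_.coshMul b g := by
    funext x; simp [_root_.coshMul, mul_add]
  rw [this, ENNReal.ofReal_add h.1 h'.1]
  exact (eLpNorm_add_le h.memLp.1 h'.memLp.1 (by norm_num)).trans (add_le_add h.2.2 h'.2.2)

theorem of_abs_le (h : WBound b M f) {a : ℝ} (ha : 0 ≤ a) (hg : AEStronglyMeasurable g volume)
    (hfg : ∀ᵐ x, |g x| ≤ a * |f x|) : WBound b (a * M) g := by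
  refine ⟨mul_nonneg ha h.1, hg, ?_⟩
  calc eLpNorm (_root_.coshMul b g) 2 volume
      ≤ ENNReal.ofReal a * eLpNorm (_root_.coshMul b f) 2 volume := by
        refine eLpNorm_le_mul_eLpNorm_of_ae_le_mul ?_ 2
        filter_upwards [hfg] with x hx
        simp only [_root_.coshMul, norm_mul, Real.norm_eq_abs]
        nlinarith [abs_nonneg (Real.cosh x ^ b)]
    _ ≤ ENNReal.ofReal a * ENNReal.ofReal M := by gcongr; exact h.2.2
    _ = ENNReal.ofReal (a * M) := (ENNReal.ofReal_mul ha).symm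

theorem const_mul (h : WBound b M f) (a : ℝ) : WBound b (|a| * M) fun x => a * f x :=
  h.of_abs_le (abs_nonneg a) (h.2.1.const_mul a) (Filter.Eventually.of_forall fun x => by
    rw [abs_mul])

theorem sub (h : WBound b M f) (h' : WBound b M' g) : WBound b (M + M') fun x => f x - g x := by
  have := h.add (h'.const_mul (-1))
  simp only [abs_neg, abs_one, one_mul, neg_one_mul, ← sub_eq_add_neg] at this
  exact this

theorem weight_zero (h : WBound b M f) (hb : 0 ≤ b) : WBound 0 M f := by
  refine ⟨h.1, h.2.1, le_trans ?_ h.2.2⟩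
  rw [coshMul_zero]
  refine eLpNorm_mono fun x => ?_
  simp only [_root_.coshMul, norm_mul, Real.norm_eq_abs, abs_of_pos (cosh_rpow_pos b x)]
  exact le_mul_of_one_le_left (abs_nonneg _) (one_le_cosh_rpow hb x)

theorem translate (h : WBound b M f) (hb : 0 ≤ b) {t : ℝ} (ht : |t| ≤ 1) :
    WBound b (Real.exp b * M) fun x => f (x + t) := by
  have mp := measurePreserving_add_right (volume : Measure ℝ) t
  refine ⟨mul_nonneg (Real.exp_pos b).le h.1, h.2.1.comp_measurePreserving mp, ?_⟩
  calc eLpNorm (_root_.coshMul b fun x => f (x + t)) 2 volume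
      ≤ ENNReal.ofReal (Real.exp b) * eLpNorm (_root_.coshMul b f ∘ fun x => x + t) 2 volume := by
        refine eLpNorm_le_mul_eLpNorm_of_ae_le_mul (Filter.Eventually.of_forall fun x => ?_) 2
        simp only [_root_.coshMul, Function.comp, norm_mul, Real.norm_eq_abs,
          abs_of_pos (cosh_rpow_pos b _)]
        rw [← mul_assoc]
        exact mul_le_mul_of_nonneg_right (cosh_rpow_le_of_abs_le hb x ht) (abs_nonneg _)
    _ = ENNReal.ofReal (Real.exp b) * eLpNorm (_root_.coshMul b f) 2 volume := by
        rw [eLpNorm_comp_measurePreserving h.memLp.1 mp]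
    _ ≤ ENNReal.ofReal (Real.exp b) * ENNReal.ofReal M := by gcongr; exact h.2.2
    _ = _ := (ENNReal.ofReal_mul (Real.exp_pos b).le).symm

theorem delta (h : WBound b M f) (hb : 0 ≤ b) : WBound b (2 * Real.exp b * M) (delta f) := by
  have h1 := h.translate hb (t := 1 / 2) (by rw [abs_of_pos] <;> norm_num)
  have h2 := h.translate hb (t := -(1 / 2)) (by rw [abs_neg, abs_of_pos] <;> norm_num)
  have := (h1.sub h2).mono (M' := 2 * Real.exp b * M) (by linarith)
  exact this.congr (Filter.Eventually.of_forall fun x => by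
    simp only [_root_.delta, sub_eq_add_neg])

end WBound

theorem memLp_cosh_rpow_neg {b : ℝ} (hb : 0 < b) :
    MemLp (fun x : ℝ => Real.cosh x ^ (-b)) 2 volume := by
  refine (memLp_two_iff_integrable_sq (continuous_cosh_rpow _).aestronglyMeasurable).2 ?_
  have key : ∀ x y : ℝ, Real.exp y ≤ 2 * Real.cosh x →
      (Real.cosh x ^ (-b)) ^ 2 ≤ 2 ^ (2 * b) * Real.exp (-(2 * b) * y) := by
    intro x y h
    have hc := Real.cosh_pos x
    have h1 : (Real.cosh x ^ (-b)) ^ 2 = Real.cosh x ^ (-(2 * b)) := by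
      rw [← Real.rpow_natCast, ← Real.rpow_mul hc.le]; congr 1; push_cast; ring
    have h2 : Real.exp y / 2 ≤ Real.cosh x := by linarith
    calc _ = Real.cosh x ^ (-(2 * b)) := h1
      _ ≤ (Real.exp y / 2) ^ (-(2 * b)) :=
          Real.rpow_le_rpow_of_nonpos (by positivity) h2 (by linarith)
      _ = 2 ^ (2 * b) * Real.exp (-(2 * b) * y) := by
          rw [Real.div_rpow (Real.exp_pos _).le (by norm_num), ← Real.exp_mul,
            Real.rpow_neg (by norm_num : (0 : ℝ) ≤ 2), div_inv_eq_mul, mul_comm]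
          congr 2; ring
  have hm : Continuous fun x : ℝ => (Real.cosh x ^ (-b)) ^ 2 := (continuous_cosh_rpow _).pow 2
  rw [← integrableOn_univ, ← Set.Iic_union_Ioi (a := (0 : ℝ))]
  refine IntegrableOn.union ?_ ?_
  · refine Integrable.mono' ((integrableOn_exp_mul_Iic (a := 2 * b) (by linarith) 0).const_mul
      (2 ^ (2 * b))) hm.aestronglyMeasurable (Filter.Eventually.of_forall fun x => ?_)
    rw [Real.norm_eq_abs, abs_of_nonneg (sq_nonneg _)]
    refine (key x (-x) ?_).trans (le_of_eq (by congr 2; ring))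
    rw [Real.cosh_eq]; linarith [Real.exp_pos x]
  · refine Integrable.mono' ((integrableOn_exp_mul_Ioi (a := -(2 * b)) (by linarith) 0).const_mul
      (2 ^ (2 * b))) hm.aestronglyMeasurable (Filter.Eventually.of_forall fun x => ?_)
    rw [Real.norm_eq_abs, abs_of_nonneg (sq_nonneg _)]
    refine key x x ?_
    rw [Real.cosh_eq]; linarith [Real.exp_pos (-x)]

theorem WBound.integrable {b M : ℝ} {f : ℝ → ℝ} (h : WBound b M f) (hb : 0 < b) :
    Integrable f volume := by
  have := (memLp_cosh_rpow_neg hb).integrable_mul h.memLp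
  refine this.congr (Filter.Eventually.of_forall fun x => ?_)
  simp only [Pi.mul_apply, coshMul]
  rw [← mul_assoc, ← Real.rpow_add (Real.cosh_pos x)]
  simp

theorem integral_delta {f : ℝ → ℝ} (hf : Integrable f volume) : ∫ x, delta f x = 0 := by
  have h1 : Integrable (fun x => f (x + 1 / 2)) volume := hf.comp_add_right _
  have h2 : Integrable (fun x => f (x - 1 / 2)) volume := hf.comp_sub_right _
  simp only [delta]
  rw [integral_sub h1 h2, integral_add_right_eq_self (μ := volume) f,
    integral_sub_right_eq_self f, sub_self]

theorem delta_congr_ae {f g : ℝ → ℝ} (h : f =ᵐ[volume] g) : delta f =ᵐ[volume] delta g := by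
  have h1 := (measurePreserving_add_right (volume : Measure ℝ) (1 / 2)).quasiMeasurePreserving.ae_eq h
  have h2 := (measurePreserving_sub_right (volume : Measure ℝ) (1 / 2)).quasiMeasurePreserving.ae_eq h
  filter_upwards [h1, h2] with x h1 h2
  simp only [Function.comp] at h1 h2
  simp only [delta, h1, h2]

theorem Continuous.delta {f : ℝ → ℝ} (hf : Continuous f) : Continuous (delta f) := by
  unfold _root_.delta; fun_prop

/-! ### Averages over unit intervals -/

/-- The average `∫₀¹ k(t) f(x + t) dt` of `f` over `[x, x + 1]` with kernel `k`. -/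
noncomputable def avg (k f : ℝ → ℝ) (x : ℝ) : ℝ := ∫ t in (0 : ℝ)..1, k t * f (x + t)

section Avg

variable {k f f' : ℝ → ℝ} {A b M : ℝ}

/-- Jensen's inequality on the unit interval. -/
theorem enorm_avg_sq_le (hf : Continuous f)
    (hA : ∀ t ∈ Set.Icc (0 : ℝ) 1, |k t| ≤ A) (x : ℝ) :
    ‖avg k f x‖ₑ ^ 2 ≤ ENNReal.ofReal A ^ 2 * ∫⁻ t in Set.Ioc (0 : ℝ) 1, ‖f (x + t)‖ₑ ^ 2 := by
  set ν : Measure ℝ := volume.restrict (Set.Ioc (0 : ℝ) 1)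
  have : IsProbabilityMeasure ν := ⟨by simp [ν]⟩
  have hfm : AEStronglyMeasurable (fun t => f (x + t)) ν :=
    (hf.comp (continuous_const_add x)).aestronglyMeasurable
  have h1 : ‖avg k f x‖ₑ ≤ ENNReal.ofReal A * eLpNorm (fun t => f (x + t)) 1 ν := by
    rw [avg, intervalIntegral.integral_of_le zero_le_one, eLpNorm_one_eq_lintegral_enorm,
      ← lintegral_const_mul' _ _ ENNReal.ofReal_ne_top]
    refine (enorm_integral_le_lintegral_enorm _).trans
      (setLIntegral_mono' measurableSet_Ioc fun t ht => ?_)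
    rw [enorm_mul]
    gcongr
    rw [Real.enorm_eq_ofReal_abs]
    exact ENNReal.ofReal_le_ofReal (hA t ⟨ht.1.le, ht.2⟩)
  have h2 : eLpNorm (fun t => f (x + t)) 2 ν ^ 2 = ∫⁻ t, ‖f (x + t)‖ₑ ^ 2 ∂ν := by
    have := eLpNorm_nnreal_pow_eq_lintegral (f := fun t => f (x + t)) (p := 2) (μ := ν) (by norm_num)
    simpa using this
  calc ‖avg k f x‖ₑ ^ 2 ≤ (ENNReal.ofReal A * eLpNorm (fun t => f (x + t)) 2 ν) ^ 2 := by
        gcongr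
        exact h1.trans (by gcongr; exact eLpNorm_le_eLpNorm_of_exponent_le (by norm_num) hfm)
    _ = _ := by rw [mul_pow, h2]

theorem eLpNorm_two_sq (f : ℝ → ℝ) :
    eLpNorm f 2 (volume : Measure ℝ) ^ 2 = ∫⁻ x, ‖f x‖ₑ ^ 2 := by
  have := eLpNorm_nnreal_pow_eq_lintegral (f := f) (p := 2) (μ := (volume : Measure ℝ)) (by norm_num)
  simpa using this

theorem abs_avg_le (hf : Continuous f)
    (hA : ∀ t ∈ Set.Icc (0 : ℝ) 1, |k t| ≤ A) (h : WBound 0 M f) (x : ℝ) :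
    |avg k f x| ≤ A * M := by
  have hA0 : 0 ≤ A := (abs_nonneg _).trans (hA 0 (by simp))
  have h1 := enorm_avg_sq_le hf hA x
  have h2 : ∫⁻ t in Set.Ioc (0 : ℝ) 1, ‖f (x + t)‖ₑ ^ 2 ≤ ENNReal.ofReal M ^ 2 := by
    calc _ ≤ ∫⁻ t, ‖f (x + t)‖ₑ ^ 2 := setLIntegral_le_lintegral _ _
      _ = ∫⁻ t, ‖f t‖ₑ ^ 2 := lintegral_add_left_eq_self (fun t => ‖f t‖ₑ ^ 2) x
      _ = eLpNorm f 2 volume ^ 2 := (eLpNorm_two_sq f).symm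
      _ ≤ _ := by
        have := h.le
        rw [coshMul_zero] at this
        gcongr
  have h3 : ‖avg k f x‖ₑ ^ 2 ≤ (ENNReal.ofReal (A * M)) ^ 2 := by
    rw [ENNReal.ofReal_mul hA0, mul_pow]
    exact h1.trans (by gcongr)
  have h4 : ‖avg k f x‖ₑ ≤ ENNReal.ofReal (A * M) := by
    by_contra hlt
    exact absurd h3 (not_le.2 (ENNReal.pow_lt_pow_left two_ne_zero (not_le.1 hlt)))
  rw [Real.enorm_eq_ofReal_abs] at h4
  exact (ENNReal.ofReal_le_ofReal_iff (mul_nonneg hA0 h.nonneg)).1 h4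

theorem continuous_avg (hk : Continuous k) (hf : Continuous f) : Continuous (avg k f) := by
  unfold avg
  refine intervalIntegral.continuous_parametric_intervalIntegral_of_continuous' ?_ 0 1
  fun_prop

theorem WBound.avg (hk : Continuous k) (hf : Continuous f)
    (hA : ∀ t ∈ Set.Icc (0 : ℝ) 1, |k t| ≤ A) (hb : 0 ≤ b) (h : WBound b M f) :
    WBound b (A * Real.exp b * M) (avg k f) := by
  have hA0 : 0 ≤ A := (abs_nonneg _).trans (hA 0 (by simp))
  have hM := h.nonneg
  refine ⟨by positivity, (continuous_avg hk hf).aestronglyMeasurable, ?_⟩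
  set H := coshMul b f
  have hH : Continuous H := (continuous_cosh_rpow b).mul hf
  have h1 : ∀ x, ‖coshMul b (_root_.avg k f) x‖ₑ ^ 2 ≤
      ENNReal.ofReal (A * Real.exp b) ^ 2 * ∫⁻ t in Set.Ioc (0 : ℝ) 1, ‖H (x + t)‖ₑ ^ 2 := by
    intro x
    have e : ‖coshMul b (_root_.avg k f) x‖ₑ ^ 2 =
        ‖Real.cosh x ^ b‖ₑ ^ 2 * ‖_root_.avg k f x‖ₑ ^ 2 := by
      simp only [coshMul, enorm_mul, mul_pow]
    rw [e, ENNReal.ofReal_mul hA0, mul_pow]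
    calc _ ≤ ‖Real.cosh x ^ b‖ₑ ^ 2 * (ENNReal.ofReal A ^ 2 *
            ∫⁻ t in Set.Ioc (0 : ℝ) 1, ‖f (x + t)‖ₑ ^ 2) := by
          gcongr; exact enorm_avg_sq_le hf hA x
      _ = ENNReal.ofReal A ^ 2 * ∫⁻ t in Set.Ioc (0 : ℝ) 1,
            ‖Real.cosh x ^ b‖ₑ ^ 2 * ‖f (x + t)‖ₑ ^ 2 := by
          rw [lintegral_const_mul' _ _ (by finiteness)]; ring
      _ ≤ ENNReal.ofReal A ^ 2 * ∫⁻ t in Set.Ioc (0 : ℝ) 1,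
            ENNReal.ofReal (Real.exp b) ^ 2 * ‖H (x + t)‖ₑ ^ 2 := by
          refine mul_le_mul_right ?_ _
          refine setLIntegral_mono' measurableSet_Ioc fun t ht => ?_
          have hw := cosh_rpow_le_of_abs_le hb x (t := t)
            (by rw [abs_of_pos ht.1]; exact ht.2)
          have : ‖Real.cosh x ^ b‖ₑ ≤
              ENNReal.ofReal (Real.exp b) * ‖Real.cosh (x + t) ^ b‖ₑ := by
            rw [Real.enorm_eq_ofReal (cosh_rpow_pos b _).le,
              Real.enorm_eq_ofReal (cosh_rpow_pos b _).le,
              ← ENNReal.ofReal_mul (Real.exp_pos b).le]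
            exact ENNReal.ofReal_le_ofReal hw
          have e2 : ‖H (x + t)‖ₑ = ‖Real.cosh (x + t) ^ b‖ₑ * ‖f (x + t)‖ₑ := enorm_mul _ _
          rw [e2, ← mul_pow, ← mul_pow, ← mul_assoc]
          exact pow_le_pow_left' (mul_le_mul_left this _) 2
      _ = _ := by rw [lintegral_const_mul' _ _ (by finiteness)]; ring
  have h2 : ∫⁻ x, ∫⁻ t in Set.Ioc (0 : ℝ) 1, ‖H (x + t)‖ₑ ^ 2 = eLpNorm H 2 volume ^ 2 := by
    rw [lintegral_lintegral_swap]
    · have : ∀ t, ∫⁻ x, ‖H (x + t)‖ₑ ^ 2 = eLpNorm H 2 volume ^ 2 := fun t => by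
        rw [eLpNorm_two_sq]
        exact lintegral_add_right_eq_self (fun t => ‖H t‖ₑ ^ 2) t
      simp [this]
    · have : Continuous fun p : ℝ × ℝ => ‖H (p.1 + p.2)‖ₑ ^ 2 := by fun_prop
      exact this.measurable.aemeasurable
  have h3 : eLpNorm (coshMul b (_root_.avg k f)) 2 volume ^ 2 ≤
      ENNReal.ofReal (A * Real.exp b * M) ^ 2 := by
    rw [eLpNorm_two_sq, ENNReal.ofReal_mul (by positivity), mul_pow]
    calc _ ≤ ∫⁻ x, ENNReal.ofReal (A * Real.exp b) ^ 2 *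
            ∫⁻ t in Set.Ioc (0 : ℝ) 1, ‖H (x + t)‖ₑ ^ 2 := lintegral_mono h1
      _ = ENNReal.ofReal (A * Real.exp b) ^ 2 * eLpNorm H 2 volume ^ 2 := by
          rw [lintegral_const_mul' _ _ (by finiteness), h2]
      _ ≤ _ := by gcongr; exact h.le
  by_contra hlt
  exact absurd h3 (not_le.2 (ENNReal.pow_lt_pow_left two_ne_zero (not_le.1 hlt)))

theorem hasDerivAt_avg (hk : Continuous k) (hf : ∀ x, HasDerivAt f (f' x) x)
    (hf' : Continuous f') (x : ℝ) : HasDerivAt (avg k f) (avg k f' x) x := by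
  have hfc : Continuous f := continuous_iff_continuousAt.2 fun x => (hf x).continuousAt
  obtain ⟨C, hC⟩ := ((isCompact_Icc (a := x - 1) (b := x + 1)).prod
    (isCompact_Icc (a := (0 : ℝ)) (b := 1))).exists_bound_of_continuousOn
    (f := fun p : ℝ × ℝ => k p.2 * f' (p.1 + p.2)) (by fun_prop)
  refine (intervalIntegral.hasDerivAt_integral_of_dominated_loc_of_deriv_le
    (F := fun y t => k t * f (y + t)) (F' := fun y t => k t * f' (y + t)) (bound := fun _ => C)
    (Icc_mem_nhds (by linarith) (by linarith) : Set.Icc (x - 1) (x + 1) ∈ nhds x)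
    (Filter.Eventually.of_forall fun y => Continuous.aestronglyMeasurable (by fun_prop))
    (Continuous.intervalIntegrable (by fun_prop) _ _)
    (Continuous.aestronglyMeasurable (by fun_prop)) ?_ (by simp) ?_).2
  · refine Filter.Eventually.of_forall fun t ht y hy => hC (y, t) ⟨hy, ?_⟩
    rw [Set.uIoc_of_le zero_le_one] at ht
    exact ⟨ht.1.le, ht.2⟩
  · refine Filter.Eventually.of_forall fun t _ y _ => ?_
    have := (hf (y + t)).comp_add_const y t
    exact this.const_mul (k t)

theorem intervalIntegral_add_eq_avg_add {k₁ k₂ f g : ℝ → ℝ} (hk₁ : Continuous k₁)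
    (hk₂ : Continuous k₂) (hf : Continuous f) (hg : Continuous g) (x : ℝ) :
    ∫ t in (0 : ℝ)..1, (k₁ t * f (x + t) + k₂ t * g (x + t)) = avg k₁ f x + avg k₂ g x := by
  rw [intervalIntegral.integral_add] <;>
    first | rfl | exact Continuous.intervalIntegrable (by fun_prop) _ _

theorem eq_avg_sub_avg (hf : ∀ x, HasDerivAt f (f' x) x) (hf' : Continuous f') (x : ℝ) :
    f x = avg (fun _ => 1) f x + avg (fun t => t - 1) f' x := by
  have hfc : Continuous f := continuous_iff_continuousAt.2 fun x => (hf x).continuousAt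
  rw [← intervalIntegral_add_eq_avg_add (by fun_prop) (by fun_prop) hfc hf' x]
  have hd : ∀ t, HasDerivAt (fun t => (t - 1) * f (x + t)) (1 * f (x + t) + (t - 1) * f' (x + t)) t := by
    intro t
    exact ((hasDerivAt_id t).sub_const 1).mul ((hf (x + t)).comp_const_add x t)
  rw [intervalIntegral.integral_eq_sub_of_hasDerivAt (fun t _ => hd t)
    (Continuous.intervalIntegrable (by fun_prop) _ _)]
  simp

/-- The first derivative over a unit interval is controlled by the function and its second
derivative: integrate by parts against the cubic `1 - 3t² + 2t³`. -/
theorem deriv_eq_avg_add_avg {f'' : ℝ → ℝ} (hf : ∀ x, HasDerivAt f (f' x) x)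
    (hf' : ∀ x, HasDerivAt f' (f'' x) x) (hf'' : Continuous f'') (x : ℝ) :
    f' x = avg (fun t => 12 * t - 6) f x + avg (fun t => -(1 - 3 * t ^ 2 + 2 * t ^ 3)) f'' x := by
  have hfc : Continuous f := continuous_iff_continuousAt.2 fun x => (hf x).continuousAt
  rw [← intervalIntegral_add_eq_avg_add (by fun_prop) (by fun_prop) hfc hf'' x]
  have hd : ∀ t, HasDerivAt (fun t => (6 * t ^ 2 - 6 * t) * f (x + t) -
      (1 - 3 * t ^ 2 + 2 * t ^ 3) * f' (x + t))
      ((12 * t - 6) * f (x + t) + (-(1 - 3 * t ^ 2 + 2 * t ^ 3)) * f'' (x + t)) t := by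
    intro t
    have p1 : HasDerivAt (fun t : ℝ => 6 * t ^ 2 - 6 * t) (12 * t - 6) t := by
      have := ((hasDerivAt_pow 2 t).const_mul 6).sub ((hasDerivAt_id t).const_mul 6)
      convert! this using 1
      norm_num; ring
    have p2 : HasDerivAt (fun t : ℝ => 1 - 3 * t ^ 2 + 2 * t ^ 3) (6 * t ^ 2 - 6 * t) t := by
      have := (((hasDerivAt_pow 2 t).const_mul 3).const_sub 1).add
        ((hasDerivAt_pow 3 t).const_mul 2)
      convert! this using 1
      norm_num; ring
    have := (p1.mul ((hf (x + t)).comp_const_add x t)).sub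
      (p2.mul ((hf' (x + t)).comp_const_add x t))
    convert! this using 1
    ring
  rw [intervalIntegral.integral_eq_sub_of_hasDerivAt (fun t _ => hd t)
    (Continuous.intervalIntegrable (by fun_prop) _ _)]
  norm_num

theorem WBound.of_deriv_two {f'' : ℝ → ℝ} {M' : ℝ} (hb : 0 ≤ b) (hf : ∀ x, HasDerivAt f (f' x) x)
    (hf' : ∀ x, HasDerivAt f' (f'' x) x) (hf'' : Continuous f'') (h0 : WBound b M f)
    (h2 : WBound b M' f'') : WBound b (6 * Real.exp b * M + Real.exp b * M') f' := by
  have hfc : Continuous f := continuous_iff_continuousAt.2 fun x => (hf x).continuousAt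
  have e : f' = fun x => _root_.avg (fun t => 12 * t - 6) f x +
      _root_.avg (fun t => -(1 - 3 * t ^ 2 + 2 * t ^ 3)) f'' x :=
    funext (deriv_eq_avg_add_avg hf hf' hf'')
  rw [e]
  refine (WBound.avg (A := 6) (by fun_prop) hfc ?_ hb h0).add
    ((WBound.avg (A := 1) (by fun_prop) hf'' ?_ hb h2).mono (le_of_eq (by ring)))
  · rintro t ⟨h0, h1⟩
    rw [abs_le]; constructor <;> linarith
  · rintro t ⟨h0, h1⟩
    rw [abs_neg, abs_le]; constructor <;> nlinarith [mul_nonneg h0 (sub_nonneg.2 h1), mul_nonneg (mul_nonneg h0 h0) (sub_nonneg.2 h1)]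

theorem WBound.abs_le_of_deriv {M' : ℝ} (hb : 0 ≤ b) (hf : ∀ x, HasDerivAt f (f' x) x)
    (hf' : Continuous f') (h0 : WBound b M f) (h1 : WBound b M' f') (x : ℝ) :
    |f x| ≤ M + M' := by
  have hfc : Continuous f := continuous_iff_continuousAt.2 fun x => (hf x).continuousAt
  rw [eq_avg_sub_avg hf hf' x]
  have a1 := abs_avg_le (A := 1) (k := fun _ => 1) hfc (by simp)
    (h0.weight_zero hb) x
  have a2 := abs_avg_le (A := 1) (k := fun t => t - 1) hf' (by
    rintro t ⟨h0, h1⟩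
    rw [abs_le]; constructor <;> linarith) (h1.weight_zero hb) x
  refine (abs_add_le _ _).trans ?_
  linarith

end Avg

/-! ### Second weak derivatives -/

section WeakDeriv

theorem iteratedDeriv_two_eq (φ : ℝ → ℝ) : iteratedDeriv 2 φ = deriv (deriv φ) := by
  rw [iteratedDeriv_succ, iteratedDeriv_one]

theorem MeasureTheory.LocallyIntegrable.integrable_mul_continuous {f φ : ℝ → ℝ}
    (hf : LocallyIntegrable f volume) (hφ : Continuous φ) (hc : HasCompactSupport φ) :
    Integrable (fun x => f x * φ x) volume := by
  have := hf.integrable_smul_left_of_hasCompactSupport hφ hc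
  simpa [mul_comm] using this

theorem ContDiff.hasDerivAt_deriv {n : WithTop ℕ∞} {f : ℝ → ℝ} (hf : ContDiff ℝ n f) (hn : n ≠ 0)
    (x : ℝ) : HasDerivAt f (deriv f x) x :=
  (hf.differentiable hn x).hasDerivAt

theorem ContDiff.deriv_infty {f : ℝ → ℝ} (hf : ContDiff ℝ ∞ f) : ContDiff ℝ ∞ (deriv f) :=
  (contDiff_infty_iff_deriv.1 hf).2

theorem contDiff_infty_of_hasDerivAt {f f' : ℝ → ℝ} (h : ∀ x, HasDerivAt f (f' x) x)
    (h' : ContDiff ℝ ∞ f') : ContDiff ℝ ∞ f := by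
  have : deriv f = f' := funext fun x => (h x).deriv
  exact contDiff_infty_iff_deriv.2 ⟨fun x => (h x).differentiableAt, this ▸ h'⟩

theorem integral_mul_deriv_eq_neg {f f' φ : ℝ → ℝ} (h : ∀ x, HasDerivAt f (f' x) x)
    (hf' : Continuous f') (hφ : ContDiff ℝ ∞ φ) (hc : HasCompactSupport φ) :
    ∫ x, f x * deriv φ x = -∫ x, f' x * φ x := by
  have hfc : Continuous f := continuous_iff_continuousAt.2 fun x => (h x).continuousAt
  have hφ' := hφ.deriv_infty.continuous
  exact integral_mul_deriv_eq_deriv_mul_of_integrable (fun x _ => h x)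
    (fun x _ => hφ.hasDerivAt_deriv (by simp) x)
    (hfc.locallyIntegrable.integrable_mul_continuous hφ' hc.deriv)
    (hf'.locallyIntegrable.integrable_mul_continuous hφ.continuous hc)
    (hfc.locallyIntegrable.integrable_mul_continuous hφ.continuous hc)

theorem isWeakDeriv2_of_hasDerivAt {f f' f'' : ℝ → ℝ} (h : ∀ x, HasDerivAt f (f' x) x)
    (h' : ∀ x, HasDerivAt f' (f'' x) x) (hf'' : Continuous f'') : IsWeakDeriv2 f f'' := by
  have hfc : Continuous f := continuous_iff_continuousAt.2 fun x => (h x).continuousAt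
  have hfc' : Continuous f' := continuous_iff_continuousAt.2 fun x => (h' x).continuousAt
  refine ⟨hfc.locallyIntegrable, hf''.locallyIntegrable, fun φ hφ hc => ?_⟩
  rw [iteratedDeriv_two_eq, integral_mul_deriv_eq_neg h hfc' hφ.deriv_infty hc.deriv,
    integral_mul_deriv_eq_neg h' hf'' hφ hc, neg_neg]

theorem IsWeakDeriv2.congr {f f₁ g g₁ : ℝ → ℝ} (h : IsWeakDeriv2 f g) (hf : f =ᵐ[volume] f₁)
    (hg : g =ᵐ[volume] g₁) : IsWeakDeriv2 f₁ g₁ := by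
  obtain ⟨h1, h2, h3⟩ := h
  refine ⟨h1.congr hf, h2.congr hg, fun φ hφ hc => ?_⟩
  have e1 := integral_congr_ae (hf.mul (Filter.EventuallyEq.refl _ (iteratedDeriv 2 φ)))
  have e2 := integral_congr_ae (hg.mul (Filter.EventuallyEq.refl _ φ))
  exact e1.symm.trans ((h3 φ hφ hc).trans e2)

theorem IsWeakDeriv2.add_const_mul {f f₁ g g₁ : ℝ → ℝ} (h : IsWeakDeriv2 f g)
    (h₁ : IsWeakDeriv2 f₁ g₁) (a : ℝ) :
    IsWeakDeriv2 (fun x => f x + a * f₁ x) (fun x => g x + a * g₁ x) := by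
  obtain ⟨h1, h2, h3⟩ := h
  obtain ⟨k1, k2, k3⟩ := h₁
  refine ⟨h1.add (k1.smul a), h2.add (k2.smul a), fun φ hφ hc => ?_⟩
  have hφ2 : Continuous (iteratedDeriv 2 φ) := by
    rw [iteratedDeriv_two_eq]; exact hφ.deriv_infty.deriv_infty.continuous
  have hc2 : HasCompactSupport (iteratedDeriv 2 φ) := by
    rw [iteratedDeriv_two_eq]; exact hc.deriv.deriv
  simp only [add_mul, mul_assoc]
  rw [integral_add (h1.integrable_mul_continuous hφ2 hc2)
    ((k1.integrable_mul_continuous hφ2 hc2).const_mul a),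
    integral_add (h2.integrable_mul_continuous hφ.continuous hc)
    ((k2.integrable_mul_continuous hφ.continuous hc).const_mul a),
    integral_const_mul, integral_const_mul, h3 φ hφ hc, k3 φ hφ hc]

theorem IsWeakDeriv2.unique {f g g₁ : ℝ → ℝ} (h : IsWeakDeriv2 f g) (h₁ : IsWeakDeriv2 f g₁) :
    g =ᵐ[volume] g₁ := by
  refine ae_eq_of_integral_contDiff_smul_eq h.2.1 h₁.2.1 fun φ hφ hc => ?_
  have := (h.2.2 φ hφ hc).symm.trans (h₁.2.2 φ hφ hc)
  simpa [mul_comm] using this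

theorem exists_primitive_of_integral_eq_zero {ψ : ℝ → ℝ} (hψ : ContDiff ℝ ∞ ψ)
    (hc : HasCompactSupport ψ) (h0 : ∫ x, ψ x = 0) :
    ∃ Φ : ℝ → ℝ, ContDiff ℝ ∞ Φ ∧ HasCompactSupport Φ ∧ ∀ x, HasDerivAt Φ (ψ x) x := by
  obtain ⟨R, hR⟩ := hc.isCompact.isBounded.subset_closedBall 0
  have hz : ∀ x, R < |x| → ψ x = 0 := by
    intro x hx
    by_contra hne
    have := hR (subset_tsupport ψ hne)
    rw [Metric.mem_closedBall, dist_zero_right, Real.norm_eq_abs] at this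
    linarith
  set S := |R| + 1
  have hS : 0 < S := by positivity
  have hz' : ∀ x, S ≤ |x| → ψ x = 0 := fun x hx => hz x (by linarith [le_abs_self R])
  have hd : ∀ x, HasDerivAt (fun x => ∫ t in (-S)..x, ψ t) (ψ x) x := fun x =>
    intervalIntegral.integral_hasDerivAt_right (hψ.continuous.intervalIntegrable _ _)
      (hψ.continuous.stronglyMeasurableAtFilter _ _) hψ.continuous.continuousAt
  refine ⟨_, contDiff_infty_of_hasDerivAt hd hψ, ?_, hd⟩
  refine HasCompactSupport.of_support_subset_isCompact (isCompact_Icc (a := -S) (b := S)) ?_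
  intro x hx
  by_contra hout
  apply hx
  simp only [Set.mem_Icc, not_and_or, not_le] at hout
  show ∫ t in (-S)..x, ψ t = 0
  rcases hout with h | h
  · refine (intervalIntegral.integral_congr (g := fun _ => 0) fun t ht => ?_).trans (by simp)
    rw [Set.uIcc_of_ge h.le] at ht
    exact hz' t (by rw [abs_of_neg (by linarith [ht.2])]; linarith [ht.2])
  · rw [intervalIntegral.integral_of_le (by linarith), setIntegral_eq_integral_of_forall_compl_eq_zero, h0]
    intro t ht
    simp only [Set.mem_Ioc, not_and_or, not_lt, not_le] at ht
    apply hz'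
    rcases ht with ht | ht
    · rw [abs_of_neg (by linarith)]; linarith
    · rw [abs_of_pos (by linarith)]; linarith

/-- A function whose second weak derivative vanishes is affine (du Bois-Reymond). -/
theorem IsWeakDeriv2.ae_eq_affine {h : ℝ → ℝ} (hh : IsWeakDeriv2 h fun _ => 0) :
    ∃ A B : ℝ, h =ᵐ[volume] fun x => A + B * x := by
  obtain ⟨hloc, -, hweak⟩ := hh
  obtain ⟨η, hη, hηc, hη1⟩ : ∃ η : ℝ → ℝ, ContDiff ℝ ∞ η ∧ HasCompactSupport η ∧ ∫ x, η x = 1 := by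
    let b : ContDiffBump (0 : ℝ) := ⟨1, 2, zero_lt_one, one_lt_two⟩
    exact ⟨b.normed volume, b.contDiff_normed, b.hasCompactSupport_normed, b.integral_normed⟩
  set m := ∫ x, x * η x
  set H0 := ∫ x, h x * η x
  set H1 := ∫ x, h x * deriv η x
  refine ⟨H0 + H1 * m, -H1, ae_eq_of_integral_contDiff_smul_eq hloc
    (Continuous.locallyIntegrable (by fun_prop)) fun ψ hψ hψc => ?_⟩
  set a := ∫ x, ψ x
  have iψ : Integrable ψ := hψ.continuous.integrable_of_hasCompactSupport hψc
  have iη : Integrable η := hη.continuous.integrable_of_hasCompactSupport hηc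
  have id_loc : LocallyIntegrable (fun x : ℝ => x) volume := continuous_id.locallyIntegrable
  have ixψ := LocallyIntegrable.integrable_mul_continuous id_loc hψ.continuous hψc
  have ixη := LocallyIntegrable.integrable_mul_continuous id_loc hη.continuous hηc
  have c1 : HasCompactSupport fun x => ψ x - a * η x := hψc.sub (hηc.mul_left (f := fun _ => a))
  obtain ⟨Φ, hΦ, hΦc, dΦ⟩ := exists_primitive_of_integral_eq_zero (ψ := fun x => ψ x - a * η x)
    (by fun_prop) c1
    (by rw [integral_sub iψ (iη.const_mul a), integral_const_mul, hη1, mul_one, sub_self])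
  set b := ∫ x, Φ x
  have iΦ : Integrable Φ := hΦ.continuous.integrable_of_hasCompactSupport hΦc
  have c2 : HasCompactSupport fun x => Φ x - b * η x := hΦc.sub (hηc.mul_left (f := fun _ => b))
  obtain ⟨φ, hφ, hφc, dφ⟩ := exists_primitive_of_integral_eq_zero (ψ := fun x => Φ x - b * η x)
    (by fun_prop) c2
    (by rw [integral_sub iΦ (iη.const_mul b), integral_const_mul, hη1, mul_one, sub_self])
  have hb : b = -(∫ x, x * ψ x) + a * m := by
    have h1 := integral_mul_deriv_eq_neg (f := fun x => x) (f' := fun _ => 1)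
      (fun x => hasDerivAt_id x) continuous_const hΦ hΦc
    have h2 : deriv Φ = fun x => ψ x - a * η x := funext fun x => (dΦ x).deriv
    rw [h2] at h1
    simp only [one_mul, mul_sub] at h1
    have h3 : ∫ x, (x * ψ x - x * (a * η x)) = (∫ x, x * ψ x) - a * m := by
      rw [integral_sub ixψ (by simpa only [mul_left_comm] using ixη.const_mul a)]
      simp only [mul_left_comm _ a]
      rw [integral_const_mul]
    rw [h3] at h1
    linarith
  have hw := hweak φ hφ hφc
  have h2 : iteratedDeriv 2 φ = fun x => ψ x - a * η x - b * deriv η x := by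
    rw [iteratedDeriv_two_eq, show deriv φ = fun x => Φ x - b * η x from
      funext fun x => (dφ x).deriv]
    funext x
    exact ((dΦ x).sub ((hη.hasDerivAt_deriv (by simp) x).const_mul b)).deriv
  have i1 := hloc.integrable_mul_continuous hψ.continuous hψc
  have i2 := hloc.integrable_mul_continuous hη.continuous hηc
  have i3 := hloc.integrable_mul_continuous hη.deriv_infty.continuous hηc.deriv
  have h3 : ∫ x, h x * iteratedDeriv 2 φ x = (∫ x, h x * ψ x) - a * H0 - b * H1 := by
    have : ∀ x, h x * iteratedDeriv 2 φ x =
        h x * ψ x - a * (h x * η x) - b * (h x * deriv η x) := fun x => by rw [h2]; ring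
    simp only [this]
    have i12 : Integrable fun x => h x * ψ x - a * (h x * η x) := i1.sub (i2.const_mul a)
    rw [integral_sub i12 (i3.const_mul b),
      integral_sub i1 (i2.const_mul a), integral_const_mul, integral_const_mul]
  rw [h3] at hw
  simp only [zero_mul, integral_zero] at hw
  have h4 : ∫ x, ψ x • (H0 + H1 * m + -H1 * x) = (H0 + H1 * m) * a - H1 * ∫ x, x * ψ x := by
    have : ∀ x, ψ x • (H0 + H1 * m + -H1 * x) = (H0 + H1 * m) * ψ x - H1 * (x * ψ x) :=
      fun x => by rw [smul_eq_mul]; ring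
    simp only [this]
    rw [integral_sub (iψ.const_mul _) (ixψ.const_mul _), integral_const_mul, integral_const_mul]
  rw [h4]
  have h5 : ∫ x, ψ x • h x = ∫ x, h x * ψ x := by simp only [smul_eq_mul, mul_comm]
  rw [h5]
  rw [hb] at hw
  linarith

/-- A function with a continuous second weak derivative is almost everywhere equal to a function
that is twice continuously differentiable in the classical sense. -/
theorem IsWeakDeriv2.exists_hasDerivAt {f g : ℝ → ℝ} (h : IsWeakDeriv2 f g) (hg : Continuous g) :
    ∃ F F' : ℝ → ℝ, f =ᵐ[volume] F ∧ (∀ x, HasDerivAt F (F' x) x) ∧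
      ∀ x, HasDerivAt F' (g x) x := by
  have prim : ∀ u : ℝ → ℝ, Continuous u → ∀ x, HasDerivAt (fun x => ∫ t in (0 : ℝ)..x, u t) (u x) x :=
    fun u hu x => intervalIntegral.integral_hasDerivAt_right (hu.intervalIntegrable _ _)
      (hu.stronglyMeasurableAtFilter _ _) hu.continuousAt
  set G1 : ℝ → ℝ := fun x => ∫ t in (0 : ℝ)..x, g t
  have dG1 : ∀ x, HasDerivAt G1 (g x) x := prim g hg
  have cG1 : Continuous G1 := continuous_iff_continuousAt.2 fun x => (dG1 x).continuousAt
  set G : ℝ → ℝ := fun x => ∫ t in (0 : ℝ)..x, G1 t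
  have dG : ∀ x, HasDerivAt G (G1 x) x := prim G1 cG1
  have hw := (h.add_const_mul (isWeakDeriv2_of_hasDerivAt dG dG1 hg) (-1)).congr
    (Filter.EventuallyEq.refl _ _) (g₁ := fun _ => 0)
    (Filter.Eventually.of_forall fun x => by simp)
  obtain ⟨A, B, hAB⟩ := hw.ae_eq_affine
  refine ⟨fun x => G x + (A + B * x), fun x => G1 x + B, ?_, fun x => ?_, fun x => ?_⟩
  · filter_upwards [hAB] with x hx
    linarith
  · have := (dG x).add (((hasDerivAt_id x).const_mul B).const_add A)
    rw [mul_one] at this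
    exact this
  · exact (dG1 x).add_const B

end WeakDeriv

/-! ### Scales of classical function classes -/

/-- `CBound m M f`: `f` is of class `C^m` and all its derivatives of order at most `m` are bounded
by `M`. -/
def CBound : ℕ → ℝ → (ℝ → ℝ) → Prop
  | 0, M, f => (∀ x, |f x| ≤ M) ∧ Continuous f
  | m + 1, M, f => (∀ x, |f x| ≤ M) ∧ Differentiable ℝ f ∧ CBound m M (deriv f)

/-- `HBound m b M f`: `f` is of class `C^m` and all its derivatives of order at most `m` have norm
at most `M` in the space `L²` with weight `cosh(·)^b`. -/
def HBound : ℕ → ℝ → ℝ → (ℝ → ℝ) → Prop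
  | 0, b, M, f => WBound b M f ∧ Continuous f
  | m + 1, b, M, f => WBound b M f ∧ Differentiable ℝ f ∧ HBound m b M (deriv f)

namespace CBound

variable {m : ℕ} {M N : ℝ} {f g f' : ℝ → ℝ}

theorem abs_le (h : CBound m M f) (x : ℝ) : |f x| ≤ M := by
  cases m <;> exact h.1 x

theorem continuous (h : CBound m M f) : Continuous f := by
  cases m with
  | zero => exact h.2
  | succ m => exact h.2.1.continuous

theorem nonneg (h : CBound m M f) : 0 ≤ M := (abs_nonneg _).trans (h.abs_le 0)

theorem succ (h : ∀ x, HasDerivAt f (f' x) x) (h0 : ∀ x, |f x| ≤ M) (h1 : CBound m M f') :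
    CBound (m + 1) M f := by
  have : deriv f = f' := funext fun x => (h x).deriv
  exact ⟨h0, fun x => (h x).differentiableAt, this ▸ h1⟩

theorem hasDerivAt (h : CBound (m + 1) M f) (x : ℝ) : HasDerivAt f (deriv f x) x :=
  (h.2.1 x).hasDerivAt

theorem mono (h : CBound m M f) (hM : M ≤ N) : CBound m N f := by
  induction m generalizing f with
  | zero => exact ⟨fun x => (h.1 x).trans hM, h.2⟩
  | succ m ih => exact ⟨fun x => (h.1 x).trans hM, h.2.1, ih h.2.2⟩

theorem pred (h : CBound (m + 1) M f) : CBound m M f := by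
  induction m generalizing f with
  | zero => exact ⟨h.1, h.2.1.continuous⟩
  | succ m ih => exact ⟨h.1, h.2.1, ih h.2.2⟩

theorem const (m : ℕ) (a : ℝ) : CBound m |a| fun _ => a := by
  induction m generalizing a with
  | zero => exact ⟨fun _ => le_rfl, continuous_const⟩
  | succ m ih =>
    exact succ (fun x => hasDerivAt_const x a) (fun _ => le_rfl) ((ih 0).mono (by simp))

theorem add (hf : CBound m M f) (hg : CBound m N g) : CBound m (M + N) fun x => f x + g x := by
  induction m generalizing f g with
  | zero => exact ⟨fun x => (abs_add_le _ _).trans (add_le_add (hf.1 x) (hg.1 x)), hf.2.add hg.2⟩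
  | succ m ih =>
    exact succ (fun x => (hf.hasDerivAt x).add (hg.hasDerivAt x))
      (fun x => (abs_add_le _ _).trans (add_le_add (hf.1 x) (hg.1 x))) (ih hf.2.2 hg.2.2)

theorem mul (hf : CBound m M f) (hg : CBound m N g) :
    CBound m (2 ^ m * (M * N)) fun x => f x * g x := by
  have hMN : 0 ≤ M * N := mul_nonneg hf.nonneg hg.nonneg
  have h0 : ∀ x, |f x * g x| ≤ M * N := fun x => by
    rw [abs_mul]
    exact mul_le_mul (hf.abs_le x) (hg.abs_le x) (abs_nonneg _) hf.nonneg
  induction m generalizing f g with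
  | zero => exact ⟨fun x => by simpa using h0 x, hf.2.mul hg.2⟩
  | succ m ih =>
    refine succ (fun x => (hf.hasDerivAt x).mul (hg.hasDerivAt x)) (fun x => (h0 x).trans ?_) ?_
    · exact le_mul_of_one_le_left hMN (one_le_pow₀ one_le_two)
    · refine ((ih hf.2.2 hg.pred fun x => ?_).add (ih hf.pred hg.2.2 fun x => ?_)).mono
        (le_of_eq (by ring))
      · rw [abs_mul]
        exact mul_le_mul (hf.2.2.abs_le x) (hg.abs_le x) (abs_nonneg _) hf.nonneg
      · rw [abs_mul]
        exact mul_le_mul (hf.abs_le x) (hg.2.2.abs_le x) (abs_nonneg _) hf.nonneg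

end CBound

namespace HBound

variable {m : ℕ} {b M N : ℝ} {f g f' : ℝ → ℝ}

theorem wbound (h : HBound m b M f) : WBound b M f := by
  cases m <;> exact h.1

theorem continuous (h : HBound m b M f) : Continuous f := by
  cases m with
  | zero => exact h.2
  | succ m => exact h.2.1.continuous

theorem nonneg (h : HBound m b M f) : 0 ≤ M := h.wbound.nonneg

theorem succ (h : ∀ x, HasDerivAt f (f' x) x) (h0 : WBound b M f) (h1 : HBound m b M f') :
    HBound (m + 1) b M f := by
  have : deriv f = f' := funext fun x => (h x).deriv
  exact ⟨h0, fun x => (h x).differentiableAt, this ▸ h1⟩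

theorem hasDerivAt (h : HBound (m + 1) b M f) (x : ℝ) : HasDerivAt f (deriv f x) x :=
  (h.2.1 x).hasDerivAt

theorem mono (h : HBound m b M f) (hM : M ≤ N) : HBound m b N f := by
  induction m generalizing f with
  | zero => exact ⟨h.1.mono hM, h.2⟩
  | succ m ih => exact ⟨h.1.mono hM, h.2.1, ih h.2.2⟩

theorem pred (h : HBound (m + 1) b M f) : HBound m b M f := by
  induction m generalizing f with
  | zero => exact ⟨h.1, h.2.1.continuous⟩
  | succ m ih => exact ⟨h.1, h.2.1, ih h.2.2⟩

theorem weight_zero (h : HBound m b M f) (hb : 0 ≤ b) : HBound m 0 M f := by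
  induction m generalizing f with
  | zero => exact ⟨h.1.weight_zero hb, h.2⟩
  | succ m ih => exact ⟨h.1.weight_zero hb, h.2.1, ih h.2.2⟩

theorem add (hf : HBound m b M f) (hg : HBound m b N g) :
    HBound m b (M + N) fun x => f x + g x := by
  induction m generalizing f g with
  | zero => exact ⟨hf.1.add hg.1, hf.2.add hg.2⟩
  | succ m ih =>
    exact succ (fun x => (hf.hasDerivAt x).add (hg.hasDerivAt x)) (hf.1.add hg.1)
      (ih hf.2.2 hg.2.2)

theorem const_mul (hf : HBound m b M f) (a : ℝ) : HBound m b (|a| * M) fun x => a * f x := by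
  induction m generalizing f with
  | zero => exact ⟨hf.1.const_mul a, hf.2.const_mul a⟩
  | succ m ih =>
    exact succ (fun x => (hf.hasDerivAt x).const_mul a) (hf.1.const_mul a) (ih hf.2.2)

theorem sub (hf : HBound m b M f) (hg : HBound m b N g) :
    HBound m b (M + N) fun x => f x - g x := by
  have := hf.add (hg.const_mul (-1))
  simp only [abs_neg, abs_one, one_mul, neg_one_mul, ← sub_eq_add_neg] at this
  exact this

theorem translate (hf : HBound m b M f) (hb : 0 ≤ b) {t : ℝ} (ht : |t| ≤ 1) :
    HBound m b (Real.exp b * M) fun x => f (x + t) := by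
  induction m generalizing f with
  | zero => exact ⟨hf.1.translate hb ht, hf.2.comp (continuous_add_const t)⟩
  | succ m ih =>
    exact succ (fun x => (hf.hasDerivAt (x + t)).comp_add_const x t) (hf.1.translate hb ht)
      (ih hf.2.2)

theorem delta (hf : HBound m b M f) (hb : 0 ≤ b) : HBound m b (2 * Real.exp b * M) (delta f) := by
  have h1 := hf.translate hb (t := 1 / 2) (by rw [abs_of_pos] <;> norm_num)
  have h2 := hf.translate hb (t := -(1 / 2)) (by rw [abs_neg, abs_of_pos] <;> norm_num)
  have h3 := (h1.sub h2).mono (N := 2 * Real.exp b * M) (by linarith)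
  have e : _root_.delta f = fun x => f (x + 1 / 2) - f (x + -(1 / 2)) := by
    funext x; simp only [_root_.delta, sub_eq_add_neg]
  rw [e]; exact h3

theorem avg {k : ℝ → ℝ} {A : ℝ} (hk : Continuous k) (hA : ∀ t ∈ Set.Icc (0 : ℝ) 1, |k t| ≤ A)
    (hb : 0 ≤ b) (hf : HBound m b M f) : HBound m b (A * Real.exp b * M) (avg k f) := by
  induction m generalizing f with
  | zero => exact ⟨hf.1.avg hk hf.2 hA hb, continuous_avg hk hf.2⟩
  | succ m ih =>
    exact succ (fun x => hasDerivAt_avg hk hf.hasDerivAt hf.2.2.continuous x)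
      (hf.1.avg hk hf.continuous hA hb) (ih hf.2.2)

theorem cbound_mul (hf : CBound m M f) (hg : HBound m b N g) :
    HBound m b (2 ^ m * (M * N)) fun x => f x * g x := by
  have key : ∀ {u v : ℝ → ℝ}, (∀ x, |u x| ≤ M) → Continuous u → WBound b N v →
      WBound b (M * N) fun x => u x * v x := fun {u v} hu hc hv =>
    hv.of_abs_le hf.nonneg (hc.aestronglyMeasurable.mul hv.aesm)
      (Filter.Eventually.of_forall fun x => by
        rw [abs_mul]; exact mul_le_mul_of_nonneg_right (hu x) (abs_nonneg _))
  have h0 := key hf.abs_le hf.continuous hg.wbound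
  induction m generalizing f g with
  | zero => exact ⟨by simpa using h0, hf.2.mul hg.2⟩
  | succ m ih =>
    refine succ (fun x => (hf.hasDerivAt x).mul (hg.hasDerivAt x)) (h0.mono ?_) ?_
    · exact le_mul_of_one_le_left (mul_nonneg hf.nonneg hg.nonneg) (one_le_pow₀ one_le_two)
    · refine ((ih hf.2.2 hg.pred ?_).add (ih hf.pred hg.2.2 ?_)).mono (le_of_eq (by ring))
      · exact key hf.2.2.abs_le hf.2.2.continuous hg.wbound
      · exact key hf.abs_le hf.continuous hg.2.2.wbound

/-- One-dimensional Sobolev embedding. -/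
theorem cbound (hb : 0 ≤ b) (hf : HBound (m + 1) b M f) : CBound m (2 * M) f := by
  induction m generalizing f with
  | zero =>
    refine ⟨fun x => ?_, hf.2.1.continuous⟩
    have := hf.1.abs_le_of_deriv hb hf.hasDerivAt hf.2.2.continuous hf.2.2.wbound x
    linarith
  | succ m ih =>
    refine ⟨fun x => ?_, hf.2.1, ih hf.2.2⟩
    have := hf.1.abs_le_of_deriv hb hf.hasDerivAt hf.2.2.continuous hf.2.2.wbound x
    linarith

theorem contDiff {m : ℕ} {f : ℝ → ℝ} (h : HBound m b M f) : ContDiff ℝ m f := by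
  induction m generalizing f with
  | zero => exact contDiff_zero.2 h.2
  | succ m ih =>
    push_cast
    exact contDiff_succ_iff_deriv.2 ⟨h.2.1, by simp, ih h.2.2⟩

end HBound

/-! ### Superposition operators -/

theorem CBound.comp {m : ℕ} {G : ℝ → ℝ} (hG : ContDiff ℝ m G) (M : ℝ) :
    ∃ C, 0 ≤ C ∧ ∀ u, CBound m M u → CBound m C fun x => G (u x) := by
  have hb : ∃ C, 0 ≤ C ∧ ∀ y, |y| ≤ M → |G y| ≤ C := by
    obtain ⟨C, hC⟩ := (isCompact_Icc (a := -M) (b := M)).exists_bound_of_continuousOn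
      hG.continuous.continuousOn
    exact ⟨max C 0, le_max_right _ _, fun y hy => (hC y (_root_.abs_le.1 hy)).trans (le_max_left _ _)⟩
  induction m generalizing G with
  | zero =>
    obtain ⟨C, hC0, hC⟩ := hb
    exact ⟨C, hC0, fun u hu => ⟨fun x => hC _ (hu.1 x), hG.continuous.comp hu.2⟩⟩
  | succ m ih =>
    push_cast at hG
    have hG' : ContDiff ℝ m (deriv G) := (contDiff_succ_iff_deriv.1 hG).2.2
    have hGd : Differentiable ℝ G := (contDiff_succ_iff_deriv.1 hG).1
    obtain ⟨C₁, hC₁, h₁⟩ := ih hG' (by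
      obtain ⟨C, hC⟩ := (isCompact_Icc (a := -M) (b := M)).exists_bound_of_continuousOn
        hG'.continuous.continuousOn
      exact ⟨max C 0, le_max_right _ _,
        fun y hy => (hC y (_root_.abs_le.1 hy)).trans (le_max_left _ _)⟩)
    obtain ⟨C, hC0, hC⟩ := hb
    refine ⟨C + 2 ^ m * (C₁ * |M|), by positivity, fun u hu => ?_⟩
    have hM : |M| = M := abs_of_nonneg hu.nonneg
    refine CBound.succ (f' := fun x => deriv G (u x) * deriv u x)
      (fun x => (hGd (u x)).hasDerivAt.comp x (hu.hasDerivAt x)) (fun x => ?_) ?_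
    · exact (hC _ (hu.abs_le x)).trans (le_add_of_nonneg_right (by positivity))
    · refine ((h₁ u hu.pred).mul hu.2.2).mono ?_
      rw [hM]
      exact le_add_of_nonneg_left hC0

/-- Local Lipschitz continuity of superposition operators on weighted Sobolev spaces. -/
theorem HBound.comp_sub_comp {m : ℕ} (b : ℝ) {G : ℝ → ℝ} (hG : ContDiff ℝ (m + 1) G) (M : ℝ) :
    ∃ C, 0 ≤ C ∧ ∀ u w D, CBound m M u → CBound m M w → HBound m b D (fun x => u x - w x) →
      HBound m b (C * D) fun x => G (u x) - G (w x) := by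
  induction m generalizing G with
  | zero =>
    norm_num at hG
    obtain ⟨C, hC⟩ := (isCompact_Icc (a := -M) (b := M)).exists_bound_of_continuousOn
      (hG.continuous_deriv le_rfl).continuousOn
    have hlip : ∀ x y, |x| ≤ M → |y| ≤ M → |G x - G y| ≤ max C 0 * |x - y| := by
      intro x y hx hy
      have := (convex_Icc (-M) M).norm_image_sub_le_of_norm_deriv_le (f := G) (C := max C 0)
        (fun z _ => hG.differentiable one_ne_zero z) (fun z hz => (hC z hz).trans (le_max_left _ _))
        (_root_.abs_le.1 hy) (_root_.abs_le.1 hx)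
      simpa using this
    refine ⟨max C 0, le_max_right _ _, fun u w D hu hw h => ⟨?_, ?_⟩⟩
    · refine h.1.of_abs_le (le_max_right _ _) ?_ (Filter.Eventually.of_forall fun x => ?_)
      · exact ((hG.continuous.comp hu.2).sub (hG.continuous.comp hw.2)).aestronglyMeasurable
      · exact hlip _ _ (hu.1 x) (hw.1 x)
    · exact (hG.continuous.comp hu.2).sub (hG.continuous.comp hw.2)
  | succ m ih =>
    have hG0 : ContDiff ℝ (m + 1) G := hG.of_le (by push_cast; exact le_self_add)
    have hG' : ContDiff ℝ (m + 1) (deriv G) := by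
      push_cast at hG
      exact (contDiff_succ_iff_deriv.1 hG).2.2
    have hGd : Differentiable ℝ G := hG0.differentiable (by simp)
    obtain ⟨C₀, hC₀, h₀⟩ := ih hG0
    obtain ⟨C₁, hC₁, h₁⟩ := ih hG'
    obtain ⟨C₂, hC₂, h₂⟩ := CBound.comp (hG'.of_le (by exact le_self_add) : ContDiff ℝ m (deriv G)) M
    refine ⟨C₀ + (2 ^ m * C₂ + 2 ^ m * (|M| * C₁)), by positivity, fun u w D hu hw h => ?_⟩
    have hM : |M| = M := abs_of_nonneg hu.nonneg
    have hD := h.nonneg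
    have hd : deriv (fun x => u x - w x) = fun x => deriv u x - deriv w x :=
      funext fun x => ((hu.hasDerivAt x).sub (hw.hasDerivAt x)).deriv
    have h' := h.2.2
    rw [hd] at h'
    refine HBound.succ (f' := fun x => deriv G (u x) * deriv u x - deriv G (w x) * deriv w x)
      (fun x => ((hGd (u x)).hasDerivAt.comp x (hu.hasDerivAt x)).sub
        ((hGd (w x)).hasDerivAt.comp x (hw.hasDerivAt x))) ?_ ?_
    · refine (h₀ u w D hu.pred hw.pred h.pred).wbound.mono ?_
      rw [add_mul]
      exact le_add_of_nonneg_right (by positivity)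
    · have e : (fun x => deriv G (u x) * deriv u x - deriv G (w x) * deriv w x) = fun x =>
          deriv G (u x) * (deriv u x - deriv w x) +
            deriv w x * (deriv G (u x) - deriv G (w x)) := by
        funext x; ring
      rw [e]
      refine ((HBound.cbound_mul (h₂ u hu.pred) h').add
        (HBound.cbound_mul hw.2.2 (h₁ u w D hu.pred hw.pred h.pred))).mono ?_
      have : 0 ≤ C₀ * D := by positivity
      rw [hM]
      linarith

theorem HBound.comp {m : ℕ} {b : ℝ} {G : ℝ → ℝ} (hG : ContDiff ℝ (m + 1) G) (hG0 : G 0 = 0) (M : ℝ) :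
    ∃ C, 0 ≤ C ∧ ∀ u D, CBound m M u → HBound m b D u → HBound m b (C * D) fun x => G (u x) := by
  obtain ⟨C, hC, h⟩ := HBound.comp_sub_comp b hG M
  refine ⟨C, hC, fun u D hu hD => ?_⟩
  have h0 : CBound m M fun _ => 0 := (CBound.const m 0).mono (by simpa using hu.nonneg)
  simpa [hG0] using h u (fun _ => 0) D hu h0 (by simpa using hD)

/-! ### Classical functions as elements of the weighted Sobolev spaces -/

theorem hasDerivAt_tanh' (x : ℝ) : HasDerivAt Real.tanh (1 + -1 * (Real.tanh x * Real.tanh x)) x := by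
  have h := (Real.hasDerivAt_sinh x).div (Real.hasDerivAt_cosh x) (Real.cosh_pos x).ne'
  have e : Real.tanh = fun x => Real.sinh x / Real.cosh x := funext Real.tanh_eq_sinh_div_cosh
  rw [e]
  refine h.congr_deriv ?_
  have := (Real.cosh_pos x).ne'
  field_simp
  ring

theorem exists_cbound_tanh (m : ℕ) : ∃ C, CBound m C Real.tanh := by
  have h0 : ∀ x, |Real.tanh x| ≤ 1 := by
    intro x
    rw [Real.tanh_eq_sinh_div_cosh, abs_div, abs_of_pos (Real.cosh_pos x),
      div_le_one (Real.cosh_pos x), abs_le]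
    rw [Real.sinh_eq, Real.cosh_eq]
    constructor <;> linarith [Real.exp_pos x, Real.exp_pos (-x)]
  induction m with
  | zero =>
    exact ⟨1, h0, continuous_iff_continuousAt.2 fun x => (hasDerivAt_tanh' x).continuousAt⟩
  | succ m ih =>
    obtain ⟨C, hC⟩ := ih
    have h1 := (CBound.const m 1).add ((CBound.const m (-1)).mul (hC.mul hC))
    refine ⟨max 1 _, CBound.succ hasDerivAt_tanh' (fun x => (h0 x).trans (le_max_left _ _))
      (h1.mono (le_max_right _ _))⟩

/-- Multiplication by the weight is compatible with differentiation, since the logarithmic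
derivative of `cosh(·)^b` is `b tanh`, all of whose derivatives are bounded. -/
theorem HBound.coshMul (m : ℕ) (b : ℝ) :
    ∃ C, 1 ≤ C ∧ ∀ f M, HBound m b M f → HBound m 0 (C * M) (coshMul b f) := by
  have hw : ∀ f M, WBound b M f → WBound 0 M (_root_.coshMul b f) := fun f M h =>
    ⟨h.1, h.memLp.1, by rw [coshMul_zero]; exact h.le⟩
  induction m with
  | zero =>
    exact ⟨1, le_rfl, fun f M h => ⟨by simpa using hw f M h.1, (continuous_cosh_rpow b).mul h.2⟩⟩
  | succ m ih =>
    obtain ⟨C, hC, h⟩ := ih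
    obtain ⟨K, hK⟩ := exists_cbound_tanh m
    have hK0 := hK.nonneg
    have h1 : (1 : ℝ) ≤ |b| * (2 ^ m * K) + 1 := le_add_of_nonneg_left (by positivity)
    refine ⟨C * (|b| * (2 ^ m * K) + 1), one_le_mul_of_one_le_of_one_le hC h1, fun f M hf => ?_⟩
    have hM := hf.nonneg
    refine HBound.succ
      (f' := _root_.coshMul b fun x => b * (Real.tanh x * f x) + deriv f x) (fun x => ?_)
      ((hw f M hf.1).mono ?_) ?_
    · have hc := (Real.hasDerivAt_cosh x).rpow_const (p := b) (Or.inl (Real.cosh_pos x).ne')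
      refine (hc.mul (hf.hasDerivAt x)).congr_deriv ?_
      rw [Real.rpow_sub_one (Real.cosh_pos x).ne', _root_.coshMul, Real.tanh_eq_sinh_div_cosh]
      ring
    · exact le_mul_of_one_le_left hM (one_le_mul_of_one_le_of_one_le hC h1)
    · refine (h _ _ (((cbound_mul hK hf.pred).const_mul b).add hf.2.2)).mono (le_of_eq ?_)
      ring

theorem WBound.exists_isBesselOf_zero {M : ℝ} {f : ℝ → ℝ} (h : WBound 0 M f) :
    ∃ g, IsBesselOf 0 f g ∧ ‖g‖ ≤ M := by
  have hm := h.memLp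
  have hle := h.le
  rw [coshMul_zero] at hm hle
  have hc : MemLp (fun x => (f x : ℂ)) 2 volume := hm.ofReal
  refine ⟨hc.toLp _, isBesselOf_zero_order_iff.2 ⟨hc, rfl⟩, ?_⟩
  rw [Lp.norm_toLp]
  refine ENNReal.toReal_le_of_le_ofReal h.nonneg ?_
  refine (eLpNorm_congr_norm_ae (Filter.Eventually.of_forall fun x => ?_)).trans_le hle
  simp

/-- Induction on `k`, with `⟨D⟩² f = f - (4π²)⁻¹ f''`. -/
theorem HBound.exists_isBesselOf (k : ℕ) {M : ℝ} {f : ℝ → ℝ} (h : HBound (2 * k) 0 M f) :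
    ∃ g, IsBesselOf (2 * k) f g ∧ ‖g‖ ≤ 2 ^ k * M := by
  induction k generalizing f M with
  | zero => simpa using h.wbound.exists_isBesselOf_zero
  | succ k ih =>
    have hM := h.nonneg
    have h2 : HBound (2 * k + 1 + 1) 0 M f := h
    have hπ : (4 * Real.pi ^ 2)⁻¹ ≤ 1 :=
      inv_le_one_of_one_le₀ (by nlinarith [Real.pi_gt_three])
    have hs : HBound (2 * k) 0 (2 * M) fun x => f x - (4 * Real.pi ^ 2)⁻¹ * deriv (deriv f) x := by
      refine (h2.pred.pred.sub (h2.2.2.2.2.const_mul (4 * Real.pi ^ 2)⁻¹)).mono ?_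
      rw [abs_of_pos (by positivity)]
      nlinarith
    obtain ⟨g, hg, hgn⟩ := ih hs
    have ml : ∀ {u : ℝ → ℝ}, WBound 0 M u → MemLp u 2 volume := fun hu => by
      simpa [coshMul_zero] using hu.memLp
    refine ⟨g, ?_, hgn.trans (le_of_eq (by ring))⟩
    have := hg.add_two h2.hasDerivAt h2.2.2.hasDerivAt (ml h2.1) (ml h2.2.2.1)
      (ml h2.2.2.2.2.wbound)
    convert this using 1
    push_cast; ring

/-- A classical function with enough derivatives in weighted `L²` lies in `H^s_b`. -/
theorem HBound.exists_mem_wsob {s : ℝ} {k : ℕ} (hs : s ≤ 2 * k) {b : ℝ} (hb : 0 ≤ b) :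
    ∃ C, 0 ≤ C ∧ ∀ (u : ℝ →ₘ[volume] ℝ) (f : ℝ → ℝ) (M : ℝ), u =ᵐ[volume] f →
      HBound (2 * k) b M f → ∃ h : u ∈ WSob s b, ‖(⟨u, h⟩ : WSob s b)‖ ≤ C * M := by
  obtain ⟨C, hC, hcm⟩ := HBound.coshMul (2 * k) b
  refine ⟨2 ^ k * C, by positivity, fun u f M huf hf => ?_⟩
  obtain ⟨g₀, hg₀, -⟩ := (hf.weight_zero hb).exists_isBesselOf
  obtain ⟨g, hg, hgn⟩ := (hcm f M hf).exists_isBesselOf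
  obtain ⟨g₀', hg₀', -⟩ := hg₀.exists_of_le hs
  obtain ⟨g', hg', hgn'⟩ := hg.exists_of_le hs
  have hcongr : _root_.coshMul b f =ᵐ[volume] _root_.coshMul b u := by
    filter_upwards [huf] with x hx
    simp [_root_.coshMul, hx]
  have hmem : u ∈ WSob s b :=
    ⟨(memHs_iff_exists_isBesselOf _ _).2 ⟨g₀', hg₀'.congr huf.symm⟩,
      (memHs_iff_exists_isBesselOf _ _).2 ⟨g', hg'.congr hcongr⟩⟩
  refine ⟨hmem, ?_⟩
  rw [WSob.norm_def, (WSob.toL2_spec (⟨u, hmem⟩ : WSob s b)).unique (hg'.congr hcongr)]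
  exact hgn'.trans (hgn.trans (le_of_eq (by ring)))

theorem IsBesselOf.wbound {b : ℝ} {f : ℝ → ℝ} {g : Lp ℂ 2 (volume : Measure ℝ)}
    (h : IsBesselOf 0 (coshMul b f) g) (hf : AEStronglyMeasurable f volume) :
    WBound b ‖g‖ f := by
  obtain ⟨hm, rfl⟩ := isBesselOf_zero_order_iff.1 h
  refine ⟨norm_nonneg _, hf, ?_⟩
  rw [Lp.norm_toLp, ENNReal.ofReal_toReal hm.2.ne]
  refine (eLpNorm_congr_norm_ae (Filter.Eventually.of_forall fun x => ?_)).le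
  simp

/-- Elements of `H²_b` have continuous representatives, with control of the supremum and of the
weighted `L²` norm. -/
theorem WSob.exists_continuous :
    ∃ C : ℝ, 0 ≤ C ∧ ∀ (b : ℝ), 0 ≤ b → ∀ (u : WSob 2 b), ∃ f : ℝ → ℝ,
      Continuous f ∧ u =ᵐ[volume] f ∧ (∀ x, |f x| ≤ C * ‖u‖) ∧ WBound b ‖u‖ f := by
  obtain ⟨C, hC, h⟩ := exists_continuous_of_isBesselOf_two
  refine ⟨C, hC, fun b hb u => ?_⟩
  obtain ⟨F, hF, huF, hFb⟩ := h _ _ (WSob.toL2_spec u)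
  obtain ⟨g₀, hg₀, hn⟩ := (WSob.toL2_spec u).exists_of_le (s := 0) (by norm_num)
  have hue : u =ᵐ[volume] fun x => Real.cosh x ^ (-b) * F x := by
    filter_upwards [huF] with x hx
    rw [← hx, coshMul, ← mul_assoc, ← Real.rpow_add (Real.cosh_pos x)]
    simp
  refine ⟨fun x => Real.cosh x ^ (-b) * F x, (continuous_cosh_rpow _).mul hF, hue, fun x => ?_, ?_⟩
  · rw [abs_mul, abs_of_pos (cosh_rpow_pos _ _)]
    refine le_trans (mul_le_of_le_one_left (abs_nonneg _) ?_) (hFb x)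
    exact Real.rpow_le_one_of_one_le_of_nonpos (Real.one_le_cosh x) (by linarith)
  · exact ((hg₀.wbound (AEEqFun.aestronglyMeasurable _)).congr hue).mono hn

/-! ### The antiresonant resonator equation -/

/-- The solution operator `g ↦ r` of `r'' + w² r = -c⁻² δg` at an antiresonant frequency
`w ∈ 2πℕ`. At such a frequency the response to a difference over a unit interval vanishes outside
that interval, so the convolution kernel is a truncated sine. -/
noncomputable def resonator (c w : ℝ) (g : ℝ → ℝ) (x : ℝ) : ℝ :=
  (c ^ 2 * w)⁻¹ * avg (fun t => Real.sin (w * t)) g (x + -(1 / 2))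

theorem eq_zero_of_periodic_of_wbound {z : ℝ → ℝ} {M : ℝ} (hz : Continuous z)
    (hp : Function.Periodic z 1) (h : WBound 0 M z) (x : ℝ) : z x = 0 := by
  by_contra hne
  have hi : Integrable (fun x => z x ^ 2) volume := by
    have := h.memLp
    rw [coshMul_zero] at this
    exact (memLp_two_iff_integrable_sq hz.aestronglyMeasurable).1 this
  have hp2 : Function.Periodic (fun x => z x ^ 2) 1 := fun y => by
    show z (y + 1) ^ 2 = z y ^ 2
    rw [hp y]
  have hpos : 0 < ∫ t in (0 : ℝ)..1, z t ^ 2 := by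
    have e := hp2.intervalIntegral_add_eq 0 x
    rw [zero_add] at e
    rw [e]
    exact intervalIntegral.integral_pos (by linarith) (by fun_prop) (fun _ _ => sq_nonneg _)
      ⟨x, ⟨le_rfl, by linarith⟩, by positivity⟩
  have ht := hp2.tendsto_atTop_intervalIntegral_of_pos hpos zero_lt_one
  obtain ⟨t, ht0, ht1⟩ := ((Filter.eventually_ge_atTop (0 : ℝ)).and
    (ht.eventually_gt_atTop (∫ x, z x ^ 2))).exists
  rw [intervalIntegral.integral_of_le ht0] at ht1
  exact absurd (setIntegral_le_integral hi (Filter.Eventually.of_forall fun _ => sq_nonneg _))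
    (not_le.2 ht1)

section Resonator

variable {c w b M : ℝ} {m : ℕ} {g : ℝ → ℝ}

theorem continuous_resonator (hg : Continuous g) : Continuous (resonator c w g) := by
  unfold resonator
  exact continuous_const.mul ((continuous_avg (by fun_prop) hg).comp (by fun_prop))

theorem HBound.resonator (hc : c ≠ 0) (hw : 0 < w) (hb : 0 ≤ b) (h : HBound m b M g) :
    HBound m b ((c ^ 2)⁻¹ * Real.exp b ^ 2 * M / w) (resonator c w g) := by
  have h1 := ((h.avg (k := fun t => Real.sin (w * t)) (A := 1) (by fun_prop)
    (fun t _ => Real.abs_sin_le_one _) hb).translate hb (t := -(1 / 2))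
      (by rw [abs_neg, abs_of_pos] <;> norm_num)).const_mul (c ^ 2 * w)⁻¹
  refine h1.mono (le_of_eq ?_)
  rw [abs_of_pos (by positivity)]
  field_simp

theorem resonator_sub {g₁ g₂ : ℝ → ℝ} (h₁ : Continuous g₁) (h₂ : Continuous g₂) (x : ℝ) :
    resonator c w g₁ x - resonator c w g₂ x = resonator c w (fun y => g₁ y - g₂ y) x := by
  unfold resonator avg
  rw [← mul_sub, ← intervalIntegral.integral_sub]
  · simp only [mul_sub]
  all_goals exact Continuous.intervalIntegrable (by fun_prop) _ _

theorem resonator_neg_of_even (hsin : Real.sin w = 0) (hcos : Real.cos w = 1)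
    (hg : ∀ x, g (-x) = g x) (x : ℝ) : resonator c w g (-x) = -resonator c w g x := by
  unfold resonator avg
  rw [← mul_neg]
  congr 1
  have := intervalIntegral.integral_comp_sub_left (a := 0) (b := 1)
    (fun t => Real.sin (w * t) * g (-x + -(1 / 2) + t)) 1
  rw [sub_self, sub_zero] at this
  rw [← this, ← intervalIntegral.integral_neg]
  refine intervalIntegral.integral_congr fun t _ => ?_
  simp only
  rw [mul_sub, mul_one, Real.sin_sub, hsin, hcos, ← hg]
  rw [show -(-x + -(1 / 2) + (1 - t)) = x + -(1 / 2) + t by ring]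
  ring

/-- Integrating by parts twice against `sin (w t)`, the boundary terms reduce to a difference
at antiresonance. -/
theorem avg_sin_add_avg_sin {f f' f'' : ℝ → ℝ} (hsin : Real.sin w = 0) (hcos : Real.cos w = 1)
    (h : ∀ x, HasDerivAt f (f' x) x) (h' : ∀ x, HasDerivAt f' (f'' x) x) (hf'' : Continuous f'')
    (x : ℝ) :
    avg (fun t => Real.sin (w * t)) f'' x + w ^ 2 * avg (fun t => Real.sin (w * t)) f x =
      -w * (f (x + 1) - f x) := by
  have hfc : Continuous f := continuous_iff_continuousAt.2 fun x => (h x).continuousAt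
  have e : w ^ 2 * avg (fun t => Real.sin (w * t)) f x =
      avg (fun t => w ^ 2 * Real.sin (w * t)) f x := by
    unfold avg
    rw [← intervalIntegral.integral_const_mul]
    simp only [mul_assoc]
  rw [e, ← intervalIntegral_add_eq_avg_add (by fun_prop) (by fun_prop) hf'' hfc x]
  have hd : ∀ t, HasDerivAt (fun t => Real.sin (w * t) * f' (x + t) -
      w * (Real.cos (w * t) * f (x + t)))
      (Real.sin (w * t) * f'' (x + t) + w ^ 2 * Real.sin (w * t) * f (x + t)) t := by
    intro t
    have hl : HasDerivAt (fun t => w * t) w t := by simpa using (hasDerivAt_id t).const_mul w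
    have := (hl.sin.mul ((h' (x + t)).comp_const_add x t)).sub
      ((hl.cos.mul ((h (x + t)).comp_const_add x t)).const_mul w)
    refine this.congr_deriv ?_
    ring
  rw [intervalIntegral.integral_eq_sub_of_hasDerivAt (fun t _ => hd t)
    (Continuous.intervalIntegrable (by fun_prop) _ _)]
  simp [hsin, hcos]
  ring

/-- Integration by parts gains a factor `w⁻¹` at the cost of one derivative. -/
theorem avg_sin_eq {f f' : ℝ → ℝ} (hw : 0 < w) (hcos : Real.cos w = 1)
    (h : ∀ x, HasDerivAt f (f' x) x) (hf' : Continuous f') (x : ℝ) :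
    avg (fun t => Real.sin (w * t)) f x =
      w⁻¹ * (avg (fun t => Real.cos (w * t)) f' x - (f (x + 1) - f x)) := by
  have hfc : Continuous f := continuous_iff_continuousAt.2 fun x => (h x).continuousAt
  have e : avg (fun t => w * Real.sin (w * t)) f x + avg (fun t => -Real.cos (w * t)) f' x =
      -(f (x + 1) - f x) := by
    rw [← intervalIntegral_add_eq_avg_add (by fun_prop) (by fun_prop) hfc hf' x]
    have hd : ∀ t, HasDerivAt (fun t => -Real.cos (w * t) * f (x + t))
        (w * Real.sin (w * t) * f (x + t) + -Real.cos (w * t) * f' (x + t)) t := by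
      intro t
      have hl : HasDerivAt (fun t => w * t) w t := by simpa using (hasDerivAt_id t).const_mul w
      refine (hl.cos.neg.mul ((h (x + t)).comp_const_add x t)).congr_deriv ?_
      simp only [Pi.neg_apply]
      ring
    rw [intervalIntegral.integral_eq_sub_of_hasDerivAt (fun t _ => hd t)
      (Continuous.intervalIntegrable (by fun_prop) _ _)]
    simp [hcos]
    ring
  have e1 : avg (fun t => w * Real.sin (w * t)) f x = w * avg (fun t => Real.sin (w * t)) f x := by
    unfold avg
    rw [← intervalIntegral.integral_const_mul]
    simp only [mul_assoc]
  have e2 : avg (fun t => -Real.cos (w * t)) f' x = -avg (fun t => Real.cos (w * t)) f' x := by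
    unfold avg
    rw [← intervalIntegral.integral_neg]
    simp only [neg_mul]
  rw [e1, e2] at e
  field_simp
  linarith

/-- One derivative of `g` can be traded for a second power of `w⁻¹`. -/
theorem HBound.resonator_sq (hc : c ≠ 0) (hw : 0 < w) (hcos : Real.cos w = 1) (hb : 0 ≤ b)
    (h : HBound (m + 1) b M g) :
    HBound m b (3 * (c ^ 2)⁻¹ * Real.exp b ^ 2 * M / w ^ 2) (_root_.resonator c w g) := by
  have hM := h.nonneg
  have he : 1 ≤ Real.exp b := Real.one_le_exp hb
  have h1 := h.2.2.avg (k := fun t => Real.cos (w * t)) (A := 1) (by fun_prop)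
    (fun t _ => Real.abs_cos_le_one _) hb
  have h2 := (h.pred.translate hb (t := 1) (by simp)).sub h.pred
  have h3 := (((h1.sub h2).translate hb (t := -(1 / 2))
    (by rw [abs_neg, abs_of_pos] <;> norm_num)).const_mul w⁻¹).const_mul (c ^ 2 * w)⁻¹
  have e : _root_.resonator c w g = fun x => (c ^ 2 * w)⁻¹ * (w⁻¹ *
      (_root_.avg (fun t => Real.cos (w * t)) (deriv g) (x + -(1 / 2)) -
        (g (x + -(1 / 2) + 1) - g (x + -(1 / 2))))) := by
    funext x
    rw [_root_.resonator, avg_sin_eq hw hcos h.hasDerivAt h.2.2.continuous]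
  rw [e]
  refine h3.mono ?_
  rw [abs_of_pos (by positivity), abs_of_pos (by positivity)]
  have : Real.exp b * (1 * Real.exp b * M + (Real.exp b * M + M)) ≤ 3 * Real.exp b ^ 2 * M := by
    nlinarith [mul_nonneg (sub_nonneg.2 he) hM, mul_nonneg (mul_nonneg (sub_nonneg.2 he) hM) (Real.exp_pos b).le]
  calc _ ≤ (c ^ 2 * w)⁻¹ * (w⁻¹ * (3 * Real.exp b ^ 2 * M)) := by gcongr
    _ = _ := by field_simp

theorem hasDerivAt_resonator {f f' : ℝ → ℝ} (h : ∀ x, HasDerivAt f (f' x) x)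
    (hf' : Continuous f') (x : ℝ) : HasDerivAt (resonator c w f) (resonator c w f' x) x := by
  have := (hasDerivAt_avg (k := fun t => Real.sin (w * t)) (by fun_prop) h hf'
    (x + -(1 / 2))).comp_add_const x (-(1 / 2))
  exact this.const_mul _

/-- `resonator c w f` solves the resonator equation. -/
theorem resonator_deriv_two (hc : c ≠ 0) (hw : 0 < w) (hsin : Real.sin w = 0)
    (hcos : Real.cos w = 1) {f f' f'' : ℝ → ℝ}
    (h : ∀ x, HasDerivAt f (f' x) x) (h' : ∀ x, HasDerivAt f' (f'' x) x) (hf'' : Continuous f'')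
    (x : ℝ) :
    c ^ 2 * resonator c w f'' x + c ^ 2 * w ^ 2 * resonator c w f x + delta f x = 0 := by
  have := avg_sin_add_avg_sin hsin hcos h h' hf'' (x + -(1 / 2))
  unfold resonator delta
  rw [show x + -(1 / 2) + 1 = x + 1 / 2 by ring] at this
  rw [show x - 1 / 2 = x + -(1 / 2) by ring]
  generalize avg (fun t => Real.sin (w * t)) f'' (x + -(1 / 2)) = a at *
  generalize avg (fun t => Real.sin (w * t)) f (x + -(1 / 2)) = a' at *
  generalize f (x + 1 / 2) = p at *
  generalize f (x + -(1 / 2)) = q at *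
  field_simp
  linarith

/-- Uniqueness for the resonator equation in `L²`: two solutions differ by a continuous function
of period one. -/
theorem eq_resonator (hc : c ≠ 0) (hw : 0 < w) (hsin : Real.sin w = 0)
    (hcos : Real.cos w = 1) (hg : Continuous g) {r r' r'' : ℝ → ℝ}
    (h : ∀ x, HasDerivAt r (r' x) x) (h' : ∀ x, HasDerivAt r' (r'' x) x) (hr'' : Continuous r'')
    (hode : ∀ x, c ^ 2 * r'' x + c ^ 2 * w ^ 2 * r x + delta g x = 0) {M N : ℝ}
    (hr : WBound 0 M r) (hgN : WBound 0 N g) : r = resonator c w g := by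
  have hrc : Continuous r := continuous_iff_continuousAt.2 fun x => (h x).continuousAt
  have hR := (HBound.resonator (m := 0) hc hw le_rfl ⟨hgN, hg⟩)
  set z : ℝ → ℝ := fun x => r x - resonator c w g x
  have hz : Continuous z := hrc.sub hR.2
  have hp : Function.Periodic z 1 := by
    intro x
    have e1 := avg_sin_add_avg_sin hsin hcos h h' hr'' x
    have e2 : avg (fun t => Real.sin (w * t)) r'' x + w ^ 2 * avg (fun t => Real.sin (w * t)) r x
        = -(c ^ 2)⁻¹ * (avg (fun t => Real.sin (w * t)) g (x + 1 + -(1 / 2)) -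
          avg (fun t => Real.sin (w * t)) g (x + -(1 / 2))) := by
      unfold avg
      rw [← intervalIntegral.integral_const_mul, ← intervalIntegral.integral_add,
        ← intervalIntegral.integral_sub, ← intervalIntegral.integral_const_mul]
      · refine intervalIntegral.integral_congr fun t _ => ?_
        have := hode (x + t)
        simp only [delta] at this
        rw [show x + t + 1 / 2 = x + 1 + -(1 / 2) + t by ring,
          show x + t - 1 / 2 = x + -(1 / 2) + t by ring] at this
        simp only
        have hr2 : r'' (x + t) = -(c ^ 2)⁻¹ * (g (x + 1 + -(1 / 2) + t) - g (x + -(1 / 2) + t))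
            - w ^ 2 * r (x + t) := by
          generalize g (x + 1 + -(1 / 2) + t) = p at *
          generalize g (x + -(1 / 2) + t) = q at *
          field_simp
          linarith
        rw [hr2]; ring
      all_goals exact Continuous.intervalIntegrable (by fun_prop) _ _
    have e3 : resonator c w g (x + 1) - resonator c w g x = (c ^ 2 * w)⁻¹ *
        (avg (fun t => Real.sin (w * t)) g (x + 1 + -(1 / 2)) -
          avg (fun t => Real.sin (w * t)) g (x + -(1 / 2))) := by
      unfold resonator; ring
    have e4 : r (x + 1) - r x = resonator c w g (x + 1) - resonator c w g x := by
      rw [e3]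
      rw [e2] at e1
      field_simp at e1 ⊢
      linarith
    simp only [z]
    linarith
  funext x
  have := eq_zero_of_periodic_of_wbound hz hp (hr.sub hR.1) x
  simp only [z] at this
  linarith

end Resonator

/-! ### Inverting the linearization -/

section Linearization

variable {V : ℝ → ℝ} {c β b M : ℝ} {σ f f₁ g g₁ : ℝ → ℝ}

theorem WBound.coshMul (h : WBound b M f) : WBound 0 M (coshMul b f) :=
  ⟨h.1, h.memLp.1, by rw [coshMul_zero]; exact h.le⟩

theorem WBound.mem_wsob (hb : 0 ≤ b) (h : WBound b M f) (u : ℝ →ₘ[volume] ℝ)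
    (hu : u =ᵐ[volume] f) : u ∈ WSob 0 b := by
  obtain ⟨g₀, hg₀, -⟩ := (h.weight_zero hb).exists_isBesselOf_zero
  obtain ⟨g, hg, -⟩ := h.coshMul.exists_isBesselOf_zero
  refine ⟨(memHs_iff_exists_isBesselOf _ _).2 ⟨g₀, hg₀.congr hu.symm⟩,
    (memHs_iff_exists_isBesselOf _ _).2 ⟨g, hg.congr ?_⟩⟩
  filter_upwards [hu] with x hx
  simp [_root_.coshMul, hx]

theorem WSob.norm_le_of_wbound {u : WSob 0 b} (h : WBound b M u) : ‖u‖ ≤ M := by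
  obtain ⟨g, hg, hn⟩ := h.coshMul.exists_isBesselOf_zero
  rw [WSob.norm_def, (WSob.toL2_spec u).unique hg]
  exact hn

theorem WSob.ext_ae {s : ℝ} {u v : WSob s b} (h : u =ᵐ[volume] v) : u = v :=
  Subtype.ext (AEEqFun.ext h)

theorem WSob.coeFn_add {s : ℝ} (u v : WSob s b) :
    (u + v : WSob s b) =ᵐ[volume] fun x => u x + v x :=
  AEEqFun.coeFn_add (u : ℝ →ₘ[volume] ℝ) (v : ℝ →ₘ[volume] ℝ)

theorem WSob.coeFn_sub {s : ℝ} (u v : WSob s b) :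
    (u - v : WSob s b) =ᵐ[volume] fun x => u x - v x :=
  AEEqFun.coeFn_sub (u : ℝ →ₘ[volume] ℝ) (v : ℝ →ₘ[volume] ℝ)

theorem WSob.coeFn_smul {s : ℝ} (a : ℝ) (u : WSob s b) :
    (a • u : WSob s b) =ᵐ[volume] fun x => a * u x :=
  AEEqFun.coeFn_smul a (u : ℝ →ₘ[volume] ℝ)

theorem WSob.coeFn_zero {s : ℝ} : (0 : WSob s b) =ᵐ[volume] fun _ => (0 : ℝ) :=
  AEEqFun.coeFn_zero

theorem EvenSob.zero_mem {s : ℝ} : (0 : WSob s b) ∈ EvenSob s b := by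
  have h := WSob.coeFn_zero (s := s) (b := b)
  have h' := (Measure.measurePreserving_neg (volume : Measure ℝ)).quasiMeasurePreserving.ae_eq h
  show ∀ᵐ x : ℝ, _
  filter_upwards [h, h'] with x hx hx'
  simp only [Function.comp] at hx'
  rw [hx, hx']

theorem EvenSob.sub_mem {s : ℝ} {u v : WSob s b} (hu : u ∈ EvenSob s b) (hv : v ∈ EvenSob s b) :
    u - v ∈ EvenSob s b := by
  have h := WSob.coeFn_sub u v
  have h' := (Measure.measurePreserving_neg (volume : Measure ℝ)).quasiMeasurePreserving.ae_eq h
  change ∀ᵐ x : ℝ, _ at hu hv ⊢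
  filter_upwards [h, h', hu, hv] with x hx hx' hux hvx
  simp only [Function.comp] at hx'
  rw [hx, hx', hux, hvx]

theorem EvenSob.add_mem {s : ℝ} {u v : WSob s b} (hu : u ∈ EvenSob s b) (hv : v ∈ EvenSob s b) :
    u + v ∈ EvenSob s b := by
  have h := WSob.coeFn_add u v
  have h' := (Measure.measurePreserving_neg (volume : Measure ℝ)).quasiMeasurePreserving.ae_eq h
  change ∀ᵐ x : ℝ, _ at hu hv ⊢
  filter_upwards [h, h', hu, hv] with x hx hx' hux hvx
  simp only [Function.comp] at hx'
  rw [hx, hx', hux, hvx]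

theorem EvenSob.smul_mem {s : ℝ} {u : WSob s b} (a : ℝ) (hu : u ∈ EvenSob s b) :
    a • u ∈ EvenSob s b := by
  have h := WSob.coeFn_smul a u
  have h' := (Measure.measurePreserving_neg (volume : Measure ℝ)).quasiMeasurePreserving.ae_eq h
  change ∀ᵐ x : ℝ, _ at hu ⊢
  filter_upwards [h, h', hu] with x hx hx' hux
  simp only [Function.comp] at hx'
  rw [hx, hx', hux]

theorem delta_add_const_mul (f g : ℝ → ℝ) (a : ℝ) :
    delta (fun x => f x + a * g x) = fun x => delta f x + a * delta g x := by
  funext x; simp only [delta]; ring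

theorem IsLinearization.add_const_mul (h : IsLinearization V c σ f g)
    (h₁ : IsLinearization V c σ f₁ g₁) (a : ℝ) :
    IsLinearization V c σ (fun x => f x + a * f₁ x) (fun x => g x + a * g₁ x) := by
  obtain ⟨d, hd, he⟩ := h
  obtain ⟨d₁, hd₁, he₁⟩ := h₁
  refine ⟨_, hd.add_const_mul hd₁ a, ?_⟩
  filter_upwards [he, he₁] with x hx hx₁
  have e : (fun y => deriv (deriv V) (σ y) * (f y + a * f₁ y)) = fun y =>
      deriv (deriv V) (σ y) * f y + a * (deriv (deriv V) (σ y) * f₁ y) := by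
    funext y; ring
  rw [hx, hx₁, e, delta_add_const_mul, delta_add_const_mul]
  ring

theorem IsLinearization.congr (h : IsLinearization V c σ f g) (hf : f =ᵐ[volume] f₁)
    (hg : g =ᵐ[volume] g₁) : IsLinearization V c σ f₁ g₁ := by
  obtain ⟨d, hd, he⟩ := h
  refine ⟨d, hd.congr hf (Filter.EventuallyEq.refl _ _), ?_⟩
  have h1 : delta (delta fun y => deriv (deriv V) (σ y) * f y) =ᵐ[volume]
      delta (delta fun y => deriv (deriv V) (σ y) * f₁ y) := by
    refine delta_congr_ae (delta_congr_ae ?_)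
    filter_upwards [hf] with y hy
    rw [hy]
  filter_upwards [he, hg, h1] with x hx hgx h1x
  rw [← hgx, hx, h1x]

theorem IsLinearization.unique (h : IsLinearization V c σ f g)
    (h₁ : IsLinearization V c σ f g₁) : g =ᵐ[volume] g₁ := by
  obtain ⟨d, hd, he⟩ := h
  obtain ⟨d₁, hd₁, he₁⟩ := h₁
  filter_upwards [he, he₁, hd.unique hd₁] with x hx hx₁ hdx
  rw [hx, hx₁, hdx]

theorem isLinearization_zero : IsLinearization V c σ (fun _ => 0) fun _ => 0 := by
  refine ⟨fun _ => 0, isWeakDeriv2_of_hasDerivAt (fun x => hasDerivAt_const x 0)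
    (fun x => hasDerivAt_const x 0) continuous_const, Filter.Eventually.of_forall fun x => ?_⟩
  simp [delta]

theorem IsLinearization.const_mul (h : IsLinearization V c σ f g) (a : ℝ) :
    IsLinearization V c σ (fun x => a * f x) fun x => a * g x := by
  have := isLinearization_zero.add_const_mul h a
  simpa using this

theorem IsLinearization.sub (h : IsLinearization V c σ f g) (h₁ : IsLinearization V c σ f₁ g₁) :
    IsLinearization V c σ (fun x => f x - f₁ x) fun x => g x - g₁ x := by
  have := h.add_const_mul h₁ (-1)
  simpa [← sub_eq_add_neg] using this

/-- The inverse of the linearization is bounded: it is homogeneous, and continuous at zero. -/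
theorem IsAdmissible.exists_inverse_bound {σ : WSob 2 β} (hσ : IsAdmissible V c β σ) :
    ∃ K, 0 < K ∧
      (∀ f ∈ EvenSob 2 β, ∀ g M, WBound β M g → IsLinearization V c σ f g → ‖f‖ ≤ K * M) ∧
      ∀ g M, WBound β M g → (∀ᵐ x, g (-x) = g x) → ∫ x, g x = 0 →
        ∃ f ∈ EvenSob 2 β, IsLinearization V c σ f g ∧ ‖f‖ ≤ K * M := by
  have hβ := hσ.rate_pos
  obtain ⟨T, hT⟩ := hσ.homeo
  have hTeq : ∀ (f : EvenSob 2 β) (g : ℝ → ℝ), IsLinearization V c σ (f : WSob 2 β) g →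
      (T f : WSob 0 β) =ᵐ[volume] g := fun f g hg => (hT f).unique hg
  set z : EvenSob 2 β := ⟨0, EvenSob.zero_mem⟩
  have hTz : ((T z : EvenSobZero 0 β) : WSob 0 β) = 0 := by
    refine WSob.ext_ae ((hTeq z _ ?_).trans WSob.coeFn_zero.symm)
    exact isLinearization_zero.congr WSob.coeFn_zero.symm (Filter.EventuallyEq.refl _ _)
  obtain ⟨ε, hε, hcont⟩ := Metric.continuousAt_iff.1 (T.symm.continuous.continuousAt (x := T z)) 1
    one_pos
  have hb : ∀ f ∈ EvenSob 2 β, ∀ g M, WBound β M g → IsLinearization V c σ f g →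
      ‖f‖ ≤ ε⁻¹ * M := by
    intro f hf g M hg hfg
    have hM := hg.nonneg
    refine le_of_forall_gt_imp_ge_of_dense fun R hR => ?_
    have hR' : M < ε * R := by
      rw [inv_mul_eq_div, div_lt_iff₀ hε] at hR; linarith
    have hRpos : 0 < R := pos_of_mul_pos_right (hM.trans_lt hR') hε.le
    set a := R⁻¹
    have ha : 0 < a := inv_pos.2 hRpos
    set f' : EvenSob 2 β := ⟨a • f, EvenSob.smul_mem a hf⟩
    have hl : IsLinearization V c σ (f' : WSob 2 β) fun x => a * g x :=
      (hfg.const_mul a).congr (WSob.coeFn_smul a f).symm (Filter.EventuallyEq.refl _ _)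
    have hn : ‖(T f' : WSob 0 β)‖ ≤ a * M := by
      refine WSob.norm_le_of_wbound (((hg.const_mul a).mono (M' := a * M) ?_).congr (hTeq f' _ hl).symm)
      rw [abs_of_pos ha]
    have hd : dist (T f') (T z) < ε := by
      rw [Subtype.dist_eq, hTz, dist_zero_right]
      refine hn.trans_lt ?_
      rw [inv_mul_eq_div, div_lt_iff₀ hRpos]
      exact hR'
    have := hcont hd
    rw [T.symm_apply_apply, T.symm_apply_apply, Subtype.dist_eq] at this
    change dist (a • f) 0 < 1 at this
    rw [dist_zero_right, norm_smul, Real.norm_eq_abs, abs_of_pos ha, inv_mul_eq_div,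
      div_lt_one hRpos] at this
    exact this.le
  refine ⟨ε⁻¹, inv_pos.2 hε, hb, fun g M hg heven hint => ?_⟩
  have hmk := AEEqFun.coeFn_mk g hg.aesm
  set u : WSob 0 β := ⟨AEEqFun.mk g hg.aesm, hg.mem_wsob hβ.le _ hmk⟩
  have hug : u =ᵐ[volume] g := hmk
  have hu : u ∈ EvenSobZero 0 β := by
    refine ⟨?_, (hg.integrable hβ).congr hug.symm, (integral_congr_ae hug).trans hint⟩
    have h' := (Measure.measurePreserving_neg (volume : Measure ℝ)).quasiMeasurePreserving.ae_eq hug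
    show ∀ᵐ x : ℝ, _
    filter_upwards [hug, h', heven] with x hx hx' hxe
    simp only [Function.comp] at hx'
    rw [hx, hx', hxe]
  have hlin : IsLinearization V c σ (T.symm ⟨u, hu⟩ : WSob 2 β) g := by
    have := hT (T.symm ⟨u, hu⟩)
    rw [T.apply_symm_apply] at this
    exact this.congr (Filter.EventuallyEq.refl _ _) hug
  exact ⟨_, (T.symm ⟨u, hu⟩).2, hlin, hb _ (T.symm ⟨u, hu⟩).2 g M hg hlin⟩

/-- Solving `H f = N(f)` by contraction. The iteration takes place on `H f`, in a closed subset
of `L²`, so that only the completeness of `L²` is needed. -/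
theorem exists_isLinearization_eq (hβ : 0 < β) {K : ℝ} (hK : 0 < K)
    (hinv : ∀ f ∈ EvenSob 2 β, ∀ g M, WBound β M g → IsLinearization V c σ f g → ‖f‖ ≤ K * M)
    (hsolve : ∀ g M, WBound β M g → (∀ᵐ x, g (-x) = g x) → ∫ x, g x = 0 →
        ∃ f ∈ EvenSob 2 β, IsLinearization V c σ f g ∧ ‖f‖ ≤ K * M)
    {r q : ℝ} (hr : 0 ≤ r) (hq : 0 ≤ q) (hqK : q * K ≤ 1 / 2) (N : WSob 2 β → ℝ → ℝ)
    (hN : ∀ f ∈ EvenSob 2 β, ‖f‖ ≤ K * r →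
      WBound β r (N f) ∧ (∀ᵐ x, N f (-x) = N f x) ∧ ∫ x, N f x = 0)
    (hlip : ∀ f ∈ EvenSob 2 β, ∀ f' ∈ EvenSob 2 β, ‖f‖ ≤ K * r → ‖f'‖ ≤ K * r →
      WBound β (q * ‖f - f'‖) fun x => N f x - N f' x) :
    ∃ f ∈ EvenSob 2 β, ‖f‖ ≤ K * r ∧ IsLinearization V c σ f (N f) := by
  have hw := memLp_cosh_rpow_neg hβ
  set w : Lp ℝ 2 (volume : Measure ℝ) := hw.toLp _
  have mpn := Measure.measurePreserving_neg (volume : Measure ℝ)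
  set S : Set (Lp ℝ 2 (volume : Measure ℝ)) :=
    {v | ‖v‖ ≤ r ∧ Lp.compMeasurePreserving Neg.neg mpn v = v ∧ inner ℝ w v = 0}
  have hS : IsClosed S := by
    refine (isClosed_le continuous_norm continuous_const).inter
      ((isClosed_eq ?_ continuous_id).inter (isClosed_eq (by fun_prop) continuous_const))
    exact (Lp.isometry_compMeasurePreserving mpn).continuous
  have : CompleteSpace S := hS.completeSpace_coe
  have hneg0 : Lp.compMeasurePreserving Neg.neg mpn (0 : Lp ℝ 2 (volume : Measure ℝ)) = 0 :=
    map_zero _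
  have : Nonempty S := ⟨⟨0, by simpa using hr, hneg0, by simp⟩⟩
  -- the function `cosh(·)^(-β) v`, of which `v` is the weighted version
  have hcancel : ∀ v : Lp ℝ 2 (volume : Measure ℝ),
      coshMul β (fun x => Real.cosh x ^ (-β) * v x) = v := by
    intro v
    funext x
    rw [coshMul, ← mul_assoc, ← Real.rpow_add (Real.cosh_pos x)]
    simp
  have hmeas : ∀ v : Lp ℝ 2 (volume : Measure ℝ),
      AEStronglyMeasurable (fun x => Real.cosh x ^ (-β) * v x) volume := fun v =>
    (continuous_cosh_rpow _).aestronglyMeasurable.mul (Lp.aestronglyMeasurable v)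
  have hwb : ∀ v : Lp ℝ 2 (volume : Measure ℝ),
      WBound β ‖v‖ fun x => Real.cosh x ^ (-β) * v x := by
    intro v
    refine ⟨norm_nonneg _, hmeas v, ?_⟩
    rw [hcancel, Lp.norm_def, ENNReal.ofReal_toReal (Lp.eLpNorm_ne_top v)]
  have hchoice : ∀ v : S, ∃ f ∈ EvenSob 2 β,
      IsLinearization V c σ f (fun x => Real.cosh x ^ (-β) * v.1 x) ∧ ‖f‖ ≤ K * ‖v.1‖ := by
    rintro ⟨v, hv, hve, hvi⟩
    refine hsolve _ _ (hwb v) ?_ ?_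
    · have h1 := Lp.coeFn_compMeasurePreserving v mpn
      rw [hve] at h1
      filter_upwards [h1] with x hx
      simp only [Function.comp] at hx
      rw [hx, Real.cosh_neg]
    · rw [L2.inner_def] at hvi
      refine Eq.trans (integral_congr_ae ?_) hvi
      filter_upwards [hw.coeFn_toLp] with x hx
      simp only [w, hx]
      simp [mul_comm]
  choose sol hsolE hsolL hsolN using hchoice
  have hsolr : ∀ v : S, ‖sol v‖ ≤ K * r := fun v =>
    (hsolN v).trans (by have := v.2.1; gcongr)
  have hNl : ∀ v : S, WBound β r (N (sol v)) := fun v => (hN _ (hsolE v) (hsolr v)).1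
  have hmem : ∀ v : S, (hNl v).memLp.toLp _ ∈ S := by
    intro v
    obtain ⟨-, h2, h3⟩ := hN _ (hsolE v) (hsolr v)
    refine ⟨?_, ?_, ?_⟩
    · rw [Lp.norm_toLp]
      exact ENNReal.toReal_le_of_le_ofReal hr (hNl v).le
    · apply Lp.ext
      have h4 := (hNl v).memLp.coeFn_toLp
      have h5 := mpn.quasiMeasurePreserving.ae_eq h4
      filter_upwards [Lp.coeFn_compMeasurePreserving ((hNl v).memLp.toLp _) mpn, h4, h5, h2]
        with x e1 e2 e3 e4
      rw [e1, e3, e2]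
      simp only [Function.comp, coshMul, e4, Real.cosh_neg]
    · rw [L2.inner_def, ← h3]
      refine integral_congr_ae ?_
      filter_upwards [hw.coeFn_toLp, (hNl v).memLp.coeFn_toLp] with x e1 e2
      simp only [w, e1, e2]
      simp only [coshMul, RCLike.inner_apply, conj_trivial]
      rw [mul_right_comm, ← Real.rpow_add (Real.cosh_pos x)]
      simp
  set Ψ : S → S := fun v => ⟨(hNl v).memLp.toLp _, hmem v⟩
  have hΨ : ContractingWith (1 / 2) Ψ := by
    refine ⟨by norm_num, LipschitzWith.of_dist_le_mul fun v v' => ?_⟩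
    rw [Subtype.dist_eq, Subtype.dist_eq, dist_eq_norm, dist_eq_norm]
    have h1 : ‖sol v - sol v'‖ ≤ K * ‖v.1 - v'.1‖ := by
      refine hinv _ (EvenSob.sub_mem (hsolE v) (hsolE v')) _ _ (hwb (v.1 - v'.1)) ?_
      refine ((hsolL v).sub (hsolL v')).congr (WSob.coeFn_sub _ _).symm ?_
      filter_upwards [Lp.coeFn_sub v.1 v'.1] with x hx
      rw [hx, Pi.sub_apply]; ring
    have h2 := hlip _ (hsolE v) _ (hsolE v') (hsolr v) (hsolr v')
    have h3 : ‖(Ψ v).1 - (Ψ v').1‖ ≤ q * ‖sol v - sol v'‖ := by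
      show ‖(hNl v).memLp.toLp _ - (hNl v').memLp.toLp _‖ ≤ _
      rw [← MemLp.toLp_sub, Lp.norm_toLp]
      refine ENNReal.toReal_le_of_le_ofReal h2.nonneg (le_of_eq_of_le ?_ h2.le)
      congr 1
      funext x
      simp only [coshMul, Pi.sub_apply]; ring
    calc _ ≤ q * ‖sol v - sol v'‖ := h3
      _ ≤ q * (K * ‖v.1 - v'.1‖) := by gcongr
      _ = (q * K) * ‖v.1 - v'.1‖ := by ring
      _ ≤ _ := by
        refine mul_le_mul_of_nonneg_right ?_ (norm_nonneg _)
        simpa using hqK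
  set v := ContractingWith.fixedPoint Ψ hΨ
  have hfix : Ψ v = v := hΨ.fixedPoint_isFixedPt
  refine ⟨sol v, hsolE v, hsolr v, (hsolL v).congr (Filter.EventuallyEq.refl _ _) ?_⟩
  have h1 := (hNl v).memLp.coeFn_toLp
  have h2 : (hNl v).memLp.toLp _ = v.1 := congrArg Subtype.val hfix
  rw [h2] at h1
  filter_upwards [h1] with x hx
  rw [hx, coshMul, ← mul_assoc, ← Real.rpow_add (Real.cosh_pos x)]
  simp

end Linearization

/-! ### Profiles: regularity of solutions of the reduced equation -/

/-- The operator `δ² + κ δ R` applied to the force `g`, where `R` is the resonator operator. -/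
noncomputable def coupling (κ c w : ℝ) (g : ℝ → ℝ) (x : ℝ) : ℝ :=
  delta (delta g) x + κ * delta (resonator c w g) x

/-- `r` is a classical solution of `c² r'' = (δ² + κ δ R) G(r)`, the equation that results from
eliminating the second component of a traveling wave; `κ = 0` is the monatomic equation. -/
def IsProfile (κ c w : ℝ) (G r : ℝ → ℝ) : Prop :=
  ∀ x, HasDerivAt r (deriv r x) x ∧
    HasDerivAt (deriv r) ((c ^ 2)⁻¹ * coupling κ c w (fun y => G (r y)) x) x

section Profile

variable {c b : ℝ} {G : ℝ → ℝ}

theorem continuous_coupling {κ w : ℝ} {g : ℝ → ℝ} (hg : Continuous g) :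
    Continuous (coupling κ c w g) :=
  hg.delta.delta.add (continuous_const.mul (continuous_resonator hg).delta)

theorem HBound.coupling (hc : c ≠ 0) (hb : 0 ≤ b) (κ : ℝ) :
    ∃ C, 0 ≤ C ∧ ∀ (m : ℕ) (w D : ℝ) (g : ℝ → ℝ), 1 ≤ w → HBound m b D g →
      HBound m b (C * D) (coupling κ c w g) := by
  refine ⟨2 * Real.exp b * (2 * Real.exp b) + |κ| * (2 * Real.exp b * ((c ^ 2)⁻¹ * Real.exp b ^ 2)),
    by positivity, fun m w D g hw hg => ?_⟩
  have hD := hg.nonneg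
  have hw0 : 0 < w := by linarith
  refine ((hg.delta hb).delta hb |>.add (((hg.resonator hc hw0 hb).delta hb).const_mul κ)).mono ?_
  have : (c ^ 2)⁻¹ * Real.exp b ^ 2 * D / w ≤ (c ^ 2)⁻¹ * Real.exp b ^ 2 * D :=
    div_le_self (by positivity) hw
  calc _ ≤ 2 * Real.exp b * (2 * Real.exp b * D) +
        |κ| * (2 * Real.exp b * ((c ^ 2)⁻¹ * Real.exp b ^ 2 * D)) := by gcongr
    _ = _ := by ring

/-- A bounded weak solution of the profile equation is classical, and its derivatives up to order
two are controlled; the first derivative is estimated by interpolation. -/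
theorem exists_hbound_two (hc : c ≠ 0) (hb : 0 ≤ b) (hG : ContDiff ℝ 1 G) (hG0 : G 0 = 0)
    (κ A : ℝ) :
    ∃ C, 0 ≤ C ∧ ∀ (w : ℝ) (r : ℝ → ℝ), 1 ≤ w → Continuous r → (∀ x, |r x| ≤ A) →
      WBound b A r → IsWeakDeriv2 r (fun x => (c ^ 2)⁻¹ * coupling κ c w (fun y => G (r y)) x) →
      IsProfile κ c w G r ∧ HBound 2 b C r := by
  obtain ⟨C₁, hC₁, h₁⟩ := HBound.coupling hc hb κ
  obtain ⟨C₀, hC₀, h₀⟩ := HBound.comp (m := 0) (b := b) (by simpa using hG) hG0 A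
  set B := (c ^ 2)⁻¹ * (C₁ * (C₀ * |A|))
  have hB : 0 ≤ B := by positivity
  refine ⟨|A| + B + (6 * Real.exp b * |A| + Real.exp b * B), by positivity,
    fun w r hw hr hrA hrW hweak => ?_⟩
  have hA : |A| = A := abs_of_nonneg hrW.nonneg
  have hg := h₀ r A ⟨hrA, hr⟩ ⟨hrW, hr⟩
  have hcpl := (h₁ 0 w _ _ hw hg).const_mul (c ^ 2)⁻¹
  obtain ⟨F, F', hF, hd, hd'⟩ := hweak.exists_hasDerivAt hcpl.continuous
  have hFc : Continuous F := continuous_iff_continuousAt.2 fun x => (hd x).continuousAt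
  obtain rfl : r = F := (hr.ae_eq_iff_eq volume hFc).1 hF
  have hder : deriv r = F' := funext fun x => (hd x).deriv
  have hcpl' : WBound b B fun x => (c ^ 2)⁻¹ * _root_.coupling κ c w (fun y => G (r y)) x :=
    hcpl.wbound.mono (by rw [abs_of_pos (by positivity)]; simp only [B]; rw [hA])
  refine ⟨fun x => by rw [hder]; exact ⟨hd x, hd' x⟩, ?_⟩
  have hF' := hrW.of_deriv_two hb hd hd' hcpl.continuous hcpl'
  rw [hA] at *
  have he := Real.exp_pos b
  have hA0 := hrW.nonneg
  refine HBound.succ hd (hrW.mono ?_) (HBound.succ hd' (hF'.mono ?_) ⟨hcpl'.mono ?_, hcpl.continuous⟩)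
  · have : 0 ≤ 6 * Real.exp b * A + Real.exp b * B := by positivity
    linarith
  · linarith
  · have : 0 ≤ 6 * Real.exp b * A + Real.exp b * B := by positivity
    linarith

theorem IsProfile.hbound_add_two (hc : c ≠ 0) (hb : 0 ≤ b) (hG0 : G 0 = 0) (κ : ℝ) {m : ℕ}
    (hG : ContDiff ℝ (m + 1) G) (A : ℝ) :
    ∃ C, 0 ≤ C ∧ ∀ (w : ℝ) (r : ℝ → ℝ), 1 ≤ w → IsProfile κ c w G r → HBound (m + 1) b A r →
      HBound (m + 2) b C r := by
  obtain ⟨C₁, hC₁, h₁⟩ := HBound.coupling hc hb κ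
  obtain ⟨C₀, hC₀, h₀⟩ := HBound.comp (b := b) hG hG0 (2 * A)
  refine ⟨|A| + (c ^ 2)⁻¹ * (C₁ * (C₀ * |A|)), by positivity, fun w r hw hp hr => ?_⟩
  have hA : |A| = A := abs_of_nonneg hr.nonneg
  have hA0 := hr.nonneg
  have hcpl := (h₁ m w _ _ hw (h₀ r A (hr.cbound hb) hr.pred)).const_mul (c ^ 2)⁻¹
  rw [abs_of_pos (by positivity)] at hcpl
  rw [hA]
  have hle : A ≤ A + (c ^ 2)⁻¹ * (C₁ * (C₀ * A)) := le_add_of_nonneg_right (by positivity)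
  exact HBound.succ (fun x => (hp x).1) (hr.wbound.mono hle)
    (HBound.succ (fun x => (hp x).2) (hr.2.2.wbound.mono hle)
      (hcpl.mono (le_add_of_nonneg_left hA0)))

/-- Bootstrapping: two derivatives in weighted `L²` control as many derivatives as the
nonlinearity permits. -/
theorem IsProfile.exists_hbound (hc : c ≠ 0) (hb : 0 ≤ b) (hG0 : G 0 = 0) (κ : ℝ) (m : ℕ)
    (hG : ContDiff ℝ (m + 1) G) (A : ℝ) :
    ∃ C, 0 ≤ C ∧ ∀ (w : ℝ) (r : ℝ → ℝ), 1 ≤ w → IsProfile κ c w G r → HBound 2 b A r →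
      HBound (m + 2) b C r := by
  induction m with
  | zero => exact ⟨|A|, abs_nonneg A, fun w r _ _ hr => hr.mono (le_abs_self A)⟩
  | succ m ih =>
    obtain ⟨C, hC, h⟩ := ih (hG.of_le (by push_cast; exact le_self_add))
    obtain ⟨C', hC', h'⟩ := IsProfile.hbound_add_two hc hb hG0 κ (m := m + 1) hG C
    exact ⟨C', hC', fun w r hw hp hr => h' w r hw hp (h w r hw hp hr)⟩

/-- The second derivative of the difference of a profile and a monatomic profile is controlled by
the difference itself, up to an error of order `w⁻²` from the resonator. -/
theorem HBound.coupling_sub (hc : c ≠ 0) (hb : 0 ≤ b) (hG0 : G 0 = 0) (κ : ℝ) (m : ℕ)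
    (hG : ContDiff ℝ (m + 2) G) (A : ℝ) :
    ∃ C, 0 ≤ C ∧ ∀ (w : ℝ) (r s : ℝ → ℝ) (D : ℝ), 1 ≤ w → Real.cos w = 1 → HBound (m + 2) b A r →
      HBound (m + 2) b A s → HBound m b D (fun x => r x - s x) →
      HBound m b (C * (D + (w ^ 2)⁻¹)) fun x => (c ^ 2)⁻¹ * _root_.coupling κ c w (fun y => G (r y)) x -
        (c ^ 2)⁻¹ * _root_.coupling 0 c w (fun y => G (s y)) x := by
  have hG1 : ContDiff ℝ (m + 1) G := hG.of_le (by gcongr; norm_num)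
  obtain ⟨C₀, hC₀, h₀⟩ := HBound.comp_sub_comp b hG1 (2 * A)
  obtain ⟨C₁, hC₁, h₁⟩ := HBound.comp (m := m + 1) (b := b) (by
    refine hG.of_le (le_of_eq ?_)
    push_cast
    rw [add_assoc]; norm_num) hG0 (2 * A)
  set E := Real.exp b
  have hE : 0 < E := Real.exp_pos b
  refine ⟨(c ^ 2)⁻¹ * (2 * E * (2 * E * C₀)) +
    (c ^ 2)⁻¹ * (|κ| * (2 * E * (3 * (c ^ 2)⁻¹ * E ^ 2 * (C₁ * |A|)))), by positivity,
    fun w r s D hw hcos hr hs hd => ?_⟩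
  have hA : |A| = A := abs_of_nonneg hr.nonneg
  have hw0 : 0 < w := by linarith
  have hD := hd.nonneg
  have e1 := ((h₀ r s D (hr.pred.cbound hb) (hs.pred.cbound hb) hd).delta hb).delta hb
  have e2 := (((h₁ r A (hr.cbound hb) hr.pred).resonator_sq hc hw0 hcos hb).delta hb).const_mul κ
  have e3 := (e1.add e2).const_mul (c ^ 2)⁻¹
  rw [abs_of_pos (by positivity)] at e3
  have ee : (fun x => (c ^ 2)⁻¹ * _root_.coupling κ c w (fun y => G (r y)) x -
      (c ^ 2)⁻¹ * _root_.coupling 0 c w (fun y => G (s y)) x) = fun x => (c ^ 2)⁻¹ *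
        (_root_.delta (_root_.delta fun y => G (r y) - G (s y)) x +
          κ * _root_.delta (_root_.resonator c w fun y => G (r y)) x) := by
    funext x
    simp only [_root_.coupling, _root_.delta]
    ring
  rw [ee]
  refine e3.mono ?_
  have hA0 := hr.nonneg
  rw [hA]
  have p1 : 0 ≤ (c ^ 2)⁻¹ * (2 * E * (2 * E * C₀)) * (w ^ 2)⁻¹ := by positivity
  have p2 : 0 ≤ (c ^ 2)⁻¹ * (|κ| * (2 * E * (3 * (c ^ 2)⁻¹ * E ^ 2 * (C₁ * A)))) * D := by
    positivity
  calc _ = (c ^ 2)⁻¹ * (2 * E * (2 * E * C₀)) * D +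
      (c ^ 2)⁻¹ * (|κ| * (2 * E * (3 * (c ^ 2)⁻¹ * E ^ 2 * (C₁ * A)))) * (w ^ 2)⁻¹ := by ring
    _ ≤ _ := by linarith

/-- The distance between a profile and a monatomic profile in weighted `L²`, with an error of order
`w⁻²`, controls the distance of as many derivatives as the nonlinearity permits. -/
theorem IsProfile.hbound_sub (hc : c ≠ 0) (hb : 0 ≤ b) (hG0 : G 0 = 0) (κ : ℝ) (m : ℕ)
    (hG : ContDiff ℝ (m + 2) G) (A : ℝ) :
    ∃ C, 0 ≤ C ∧ ∀ (w : ℝ) (r s : ℝ → ℝ) (D : ℝ), 1 ≤ w → Real.cos w = 1 → IsProfile κ c w G r →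
      IsProfile 0 c w G s → HBound (m + 2) b A r → HBound (m + 2) b A s →
      WBound b D (fun x => r x - s x) →
      HBound (m + 2) b (C * (D + (w ^ 2)⁻¹)) fun x => r x - s x := by
  induction m with
  | zero =>
    obtain ⟨C, hC, h⟩ := HBound.coupling_sub hc hb hG0 κ 0 hG A
    set E := Real.exp b
    have hE : 0 < E := Real.exp_pos b
    refine ⟨1 + (6 * E + E * C) + C, by positivity, fun w r s D hw hcos hr hs hrA hsA hd => ?_⟩
    have hD := hd.nonneg
    have hw0 : 0 < w := by linarith
    have hw2 : 0 < (w ^ 2)⁻¹ := by positivity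
    have h2 := h w r s D hw hcos hrA hsA ⟨hd, hrA.continuous.sub hsA.continuous⟩
    have d1 : ∀ x, HasDerivAt (fun x => r x - s x) (deriv r x - deriv s x) x :=
      fun x => (hr x).1.sub (hs x).1
    have d2 : ∀ x, HasDerivAt (fun x => deriv r x - deriv s x) _ x :=
      fun x => (hr x).2.sub (hs x).2
    have h1 := hd.of_deriv_two hb d1 d2 h2.continuous h2.wbound
    refine HBound.succ d1 (hd.mono ?_) (HBound.succ d2 (h1.mono ?_) (h2.mono ?_))
    · nlinarith [mul_nonneg (by positivity : 0 ≤ (6 * E + E * C) + C)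
        (by positivity : 0 ≤ D + (w ^ 2)⁻¹)]
    · nlinarith [mul_nonneg (by positivity : 0 ≤ 1 + C) (by positivity : 0 ≤ D + (w ^ 2)⁻¹),
        mul_nonneg hE.le hw2.le]
    · nlinarith [mul_nonneg (by positivity : 0 ≤ 1 + (6 * E + E * C))
        (by positivity : 0 ≤ D + (w ^ 2)⁻¹)]
  | succ m ih =>
    obtain ⟨C₀, hC₀, h₀⟩ := ih (hG.of_le (by push_cast; gcongr; exact le_self_add))
    obtain ⟨C, hC, h⟩ := HBound.coupling_sub hc hb hG0 κ (m + 1) hG A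
    refine ⟨C₀ + C * (C₀ + 1), by positivity, fun w r s D hw hcos hr hs hrA hsA hd => ?_⟩
    have hD := hd.nonneg
    have hw0 : 0 < w := by linarith
    have hw2 : 0 < (w ^ 2)⁻¹ := by positivity
    have hi := h₀ w r s D hw hcos hr hs hrA.pred hsA.pred hd
    have h2 := h w r s _ hw hcos hrA hsA hi.pred
    have d1 : ∀ x, HasDerivAt (fun x => r x - s x) (deriv r x - deriv s x) x :=
      fun x => (hr x).1.sub (hs x).1
    have d2 : ∀ x, HasDerivAt (fun x => deriv r x - deriv s x) _ x :=
      fun x => (hr x).2.sub (hs x).2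
    have hi' := hi.2.2
    rw [funext fun x => (d1 x).deriv] at hi'
    have hle : C₀ * (D + (w ^ 2)⁻¹) ≤ (C₀ + C * (C₀ + 1)) * (D + (w ^ 2)⁻¹) := by
      gcongr; exact le_add_of_nonneg_right (by positivity)
    refine HBound.succ d1 (hi.wbound.mono hle) (HBound.succ d2 (hi'.wbound.mono hle) (h2.mono ?_))
    have : 0 ≤ C * D := by positivity
    have : 0 ≤ C₀ * (D + (w ^ 2)⁻¹) := by positivity
    nlinarith

end Profile

/-! ### The fixed point formulation -/

section Remainder

variable {V : ℝ → ℝ} {κ c b w M : ℝ} {G s f f' g : ℝ → ℝ}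

/-- With `μ = μ_n`, the frequency in the resonator equation is `2πn`. -/
theorem resonatorMass_spec (hc : c ≠ 0) (hκ : 0 < κ) {n : ℕ}
    (hn : κ < 4 * Real.pi ^ 2 * c ^ 2 * (n : ℝ) ^ 2) :
    0 < resonatorMass c κ n ∧
      κ * (1 + resonatorMass c κ n) = c ^ 2 * resonatorMass c κ n * (2 * n * Real.pi) ^ 2 ∧
      naturalFrequency c (resonatorMass c κ n) κ = 2 * (n : ℝ) * Real.pi := by
  have hD : 0 < 4 * Real.pi ^ 2 * c ^ 2 * (n : ℝ) ^ 2 - κ := sub_pos.2 hn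
  have hμ : 0 < resonatorMass c κ n := div_pos hκ hD
  have hm : resonatorMass c κ n * (4 * Real.pi ^ 2 * c ^ 2 * (n : ℝ) ^ 2 - κ) = κ :=
    div_mul_cancel₀ κ hD.ne'
  have he : κ * (1 + resonatorMass c κ n) =
      c ^ 2 * resonatorMass c κ n * (2 * n * Real.pi) ^ 2 := by linear_combination -hm
  refine ⟨hμ, he, ?_⟩
  have hpi := Real.pi_pos
  rw [naturalFrequency, he, mul_div_cancel_left₀ _ (by positivity), Real.sqrt_sq (by positivity)]

/-- The force left over when the equation for the first component is linearized at the solitary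
wave `s`: with `f = r - s`, the profile equation for `r` reads `H f = remainder f`. -/
noncomputable def remainder (κ c w : ℝ) (G s f : ℝ → ℝ) (x : ℝ) : ℝ :=
  delta (delta fun y => G (s y + f y) - G (s y) - deriv G (s y) * f y) x +
    κ * delta (resonator c w fun y => G (s y + f y)) x

/-- Local Lipschitz bound for the second order Taylor remainder, with a constant proportional to the
size `a` of the increments. -/
theorem exists_abs_taylor_le (hG : ContDiff ℝ 2 G) (S : ℝ) :
    ∃ L, 0 ≤ L ∧ ∀ a p t t' : ℝ, a ≤ 1 → |p| ≤ S → |t| ≤ a → |t'| ≤ a →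
      |G (p + t) - G (p + t') - deriv G p * (t - t')| ≤ L * a * |t - t'| := by
  have hG1 : ContDiff ℝ (1 + 1) G := by simpa [one_add_one_eq_two] using hG
  rw [contDiff_succ_iff_deriv] at hG1
  obtain ⟨hGd, -, hG'⟩ := hG1
  have hG'd : Differentiable ℝ (deriv G) := hG'.differentiable (by norm_num)
  obtain ⟨L, hL⟩ := (isCompact_Icc (a := -(S + 1)) (b := S + 1)).exists_bound_of_continuousOn
    (hG'.continuous_deriv le_rfl).continuousOn
  refine ⟨|L|, abs_nonneg L, fun a p t t' ha hp ht ht' => ?_⟩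
  have ha0 : 0 ≤ a := (abs_nonneg t).trans ht
  rw [abs_le] at hp ht ht'
  have hlip : ∀ y ∈ Set.Icc (p - a) (p + a), |deriv G y - deriv G p| ≤ |L| * a := by
    intro y hy
    have h := (convex_Icc (-(S + 1)) (S + 1)).norm_image_sub_le_of_norm_deriv_le
      (fun z _ => hG'd z) (fun z hz => (hL z hz).trans (le_abs_self L))
      (x := p) (y := y) ⟨by linarith, by linarith⟩ ⟨by linarith [hy.1], by linarith [hy.2]⟩
    refine h.trans ?_
    gcongr
    rw [Real.norm_eq_abs, abs_le]
    exact ⟨by linarith [hy.1], by linarith [hy.2]⟩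
  have h := (convex_Icc (p - a) (p + a)).norm_image_sub_le_of_norm_hasDerivWithin_le
    (f := fun y => G y - deriv G p * y) (f' := fun y => deriv G y - deriv G p)
    (fun y _ => (((hGd y).hasDerivAt).sub
      (by simpa using (hasDerivAt_id y).const_mul (deriv G p))).hasDerivWithinAt)
    hlip (x := p + t') (y := p + t) ⟨by linarith, by linarith⟩ ⟨by linarith, by linarith⟩
  rw [Real.norm_eq_abs, Real.norm_eq_abs] at h
  convert h using 2 <;> ring_nf

/-- The remainder is a contraction near zero: its quadratic part because `f` is small, and the
resonator part because the frequency is high. -/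
theorem WBound.remainder_sub (hc : c ≠ 0) (hb : 0 ≤ b) (hG : ContDiff ℝ 2 G) (κ S : ℝ) :
    ∃ C, 0 ≤ C ∧ ∀ (w a D : ℝ) (s f f' : ℝ → ℝ), 1 ≤ w → a ≤ 1 → Continuous s → Continuous f →
      Continuous f' → (∀ x, |s x| ≤ S) → (∀ x, |f x| ≤ a) → (∀ x, |f' x| ≤ a) →
      WBound b D (fun x => f x - f' x) →
      WBound b (C * (a + w⁻¹) * D) fun x => remainder κ c w G s f x - remainder κ c w G s f' x := by
  obtain ⟨L, hL, hT⟩ := exists_abs_taylor_le hG S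
  obtain ⟨C₀, hC₀, h₀⟩ := HBound.comp_sub_comp (m := 0) b
    (hG.of_le (by norm_num : ((0 : ℕ) : WithTop ℕ∞) + 1 ≤ 2)) (S + 1)
  set E := Real.exp b
  have hE : 0 < E := Real.exp_pos b
  refine ⟨2 * E * (2 * E * L) + |κ| * (2 * E * ((c ^ 2)⁻¹ * E ^ 2 * C₀)), by positivity,
    fun w a D s f f' hw ha hs hf hf' hsS hfa hfa' hD => ?_⟩
  have ha0 : 0 ≤ a := (abs_nonneg _).trans (hfa 0)
  have hw0 : 0 < w := by linarith
  have hGc := hG.continuous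
  have hGc' := hG.continuous_deriv (by norm_num : (1 : WithTop ℕ∞) ≤ 2)
  have hD0 := hD.nonneg
  have hq : WBound b (L * a * D) fun y =>
      G (s y + f y) - G (s y + f' y) - deriv G (s y) * (f y - f' y) := by
    refine hD.of_abs_le (by positivity) (Continuous.aestronglyMeasurable (by fun_prop)) ?_
    exact Filter.Eventually.of_forall fun y => hT a _ _ _ ha (hsS y) (hfa y) (hfa' y)
  have hcb : ∀ h : ℝ → ℝ, Continuous h → (∀ x, |h x| ≤ a) → CBound 0 (S + 1) fun y => s y + h y :=
    fun h hh hha => ⟨fun x => (abs_add_le _ _).trans (add_le_add (hsS x) ((hha x).trans ha)),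
      hs.add hh⟩
  have hg := h₀ _ _ D (hcb f hf hfa) (hcb f' hf' hfa')
    ⟨hD.congr (Filter.Eventually.of_forall fun x => by simp), by fun_prop⟩
  have hr := ((hg.resonator hc hw0 hb).delta hb).wbound.const_mul κ
  have hsum := ((hq.delta hb).delta hb).add hr
  have e : (fun x => remainder κ c w G s f x - remainder κ c w G s f' x) = fun x =>
      _root_.delta (_root_.delta fun y =>
        G (s y + f y) - G (s y + f' y) - deriv G (s y) * (f y - f' y)) x +
      κ * _root_.delta (_root_.resonator c w fun y => G (s y + f y) - G (s y + f' y)) x := by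
    have hres : ∀ x, _root_.resonator c w (fun y => G (s y + f y) - G (s y + f' y)) x =
        _root_.resonator c w (fun y => G (s y + f y)) x -
          _root_.resonator c w (fun y => G (s y + f' y)) x := fun x =>
      (resonator_sub (hGc.comp (hs.add hf)) (hGc.comp (hs.add hf')) x).symm
    funext x
    simp only [remainder, _root_.delta, hres]
    ring
  rw [e]
  refine hsum.mono ?_
  have p1 : 0 ≤ 2 * E * (2 * E * L) * w⁻¹ * D := by positivity
  have p2 : 0 ≤ |κ| * (2 * E * ((c ^ 2)⁻¹ * E ^ 2 * C₀)) * a * D := by positivity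
  rw [div_eq_mul_inv]
  linarith

/-- The residual of the solitary wave in the profile equation is of order `w⁻²`: averaging against
a sine of frequency `w` gains a factor `w⁻¹`, in addition to the one in the resonator operator. -/
theorem WBound.remainder_zero (hc : c ≠ 0) (hb : 0 ≤ b) (κ : ℝ) :
    ∃ C, 0 ≤ C ∧ ∀ (w M : ℝ) (s : ℝ → ℝ), 1 ≤ w → Real.cos w = 1 →
      HBound 1 b M (fun y => G (s y)) →
      WBound b (C * M / w ^ 2) (remainder κ c w G s fun _ => 0) := by
  refine ⟨|κ| * (2 * Real.exp b * (3 * (c ^ 2)⁻¹ * Real.exp b ^ 2)), by positivity,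
    fun w M s hw hcos h => ?_⟩
  have hr := ((HBound.resonator_sq (m := 0) hc (by linarith) hcos hb h).delta hb).wbound.const_mul κ
  refine (hr.mono (le_of_eq ?_)).congr (Filter.Eventually.of_forall fun x => ?_)
  · ring
  · simp [remainder, _root_.delta]

theorem delta_even (hodd : ∀ x, g (-x) = -g x) (x : ℝ) : delta g (-x) = delta g x := by
  have h1 : g (-x + 1 / 2) = -g (x - 1 / 2) := by rw [← hodd]; congr 1; ring
  have h2 : g (-x - 1 / 2) = -g (x + 1 / 2) := by rw [← hodd]; congr 1; ring
  rw [delta, delta, h1, h2]; ring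

theorem delta_odd (heven : ∀ x, g (-x) = g x) (x : ℝ) : delta g (-x) = -delta g x := by
  have h1 : g (-x + 1 / 2) = g (x - 1 / 2) := by rw [← heven]; congr 1; ring
  have h2 : g (-x - 1 / 2) = g (x + 1 / 2) := by rw [← heven]; congr 1; ring
  rw [delta, delta, h1, h2]; ring

theorem remainder_neg (hsin : Real.sin w = 0) (hcos : Real.cos w = 1) (hs : ∀ x, s (-x) = s x)
    (hf : ∀ x, f (-x) = f x) (x : ℝ) :
    remainder κ c w G s f (-x) = remainder κ c w G s f x := by
  rw [remainder, remainder, delta_even (delta_odd fun y => by rw [hs, hf]),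
    delta_even (resonator_neg_of_even hsin hcos fun y => by rw [hs, hf])]

/-- The remainder is a difference `δ F` of an integrable function. -/
theorem integral_remainder (hb : 0 < b) (hc : c ≠ 0) (hw : 1 ≤ w) (hG : ContDiff ℝ 2 G)
    (hG0 : G 0 = 0) {A : ℝ} (hs : HBound 0 b A s) (hsA : ∀ x, |s x| ≤ A) (hf : HBound 0 b A f)
    (hfA : ∀ x, |f x| ≤ A) : ∫ x, remainder κ c w G s f x = 0 := by
  have hG1 : ContDiff ℝ ((0 : ℕ) + 1) G := hG.of_le (by norm_num)
  have hw0 : 0 < w := by linarith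
  obtain ⟨C₁, -, h₁⟩ := HBound.comp (b := b) hG1 hG0 (A + A)
  have hg := h₁ (fun y => s y + f y) (A + A)
    ⟨fun x => (abs_add_le _ _).trans (add_le_add (hsA x) (hfA x)), hs.continuous.add hf.continuous⟩
    (hs.add hf)
  have hg' := h₁ s A ⟨fun x => (hsA x).trans
    (by linarith [(abs_nonneg _).trans (hsA 0)]), hs.continuous⟩ hs
  have hGc' := hG.continuous_deriv (by norm_num : (1 : WithTop ℕ∞) ≤ 2)
  obtain ⟨B, hB⟩ := (isCompact_Icc (a := -A) (b := A)).exists_bound_of_continuousOn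
    hGc'.continuousOn
  have hlin : WBound b (|B| * A) fun y => deriv G (s y) * f y := by
    refine hf.wbound.of_abs_le (abs_nonneg B)
      ((hGc'.comp hs.continuous).mul hf.continuous).aestronglyMeasurable
      (Filter.Eventually.of_forall fun y => ?_)
    rw [abs_mul]
    exact mul_le_mul_of_nonneg_right ((hB _ (abs_le.1 (hsA y))).trans (le_abs_self B))
      (abs_nonneg _)
  have hq := (((hg.sub hg').wbound.sub hlin).delta hb.le).integrable hb
  have hr := ((hg.resonator hc hw0 hb.le).wbound.integrable hb).const_mul κ
  rw [← integral_delta (hq.add hr)]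
  refine integral_congr_ae (Filter.Eventually.of_forall fun x => ?_)
  simp only [remainder, delta, Pi.add_apply]
  ring

/-- `H f = remainder f` is the profile equation for `s + f`, in the weak form. -/
theorem isLinearization_remainder_iff (hc : c ≠ 0) (hG : ContDiff ℝ 2 (deriv V))
    (hs : IsProfile 0 c w (deriv V) s) :
    IsLinearization V c s f (remainder κ c w (deriv V) s f) ↔
      IsWeakDeriv2 (fun x => s x + f x)
        fun x => (c ^ 2)⁻¹ * coupling κ c w (fun y => deriv V (s y + f y)) x := by
  have hsc : Continuous s := continuous_iff_continuousAt.2 fun x => (hs x).1.continuousAt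
  have hGc := hG.continuous
  have hs2 := isWeakDeriv2_of_hasDerivAt (fun x => (hs x).1) (fun x => (hs x).2)
    (continuous_const.mul (continuous_coupling (hGc.comp hsc)))
  have hc2 : c ^ 2 ≠ 0 := pow_ne_zero 2 hc
  have key : ∀ x, remainder κ c w (deriv V) s f x =
      coupling κ c w (fun y => deriv V (s y + f y)) x - coupling 0 c w (fun y => deriv V (s y)) x -
        delta (delta fun y => deriv (deriv V) (s y) * f y) x := by
    intro x
    simp only [remainder, coupling, delta]
    ring
  constructor
  · rintro ⟨f₂, hf₂, he⟩
    refine (hs2.add_const_mul hf₂ 1).congr (Filter.Eventually.of_forall fun x => by ring) ?_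
    filter_upwards [he] with x hx
    rw [key] at hx
    field_simp
    linarith
  · intro h
    refine ⟨_, (h.add_const_mul hs2 (-1)).congr (Filter.Eventually.of_forall fun x => by ring)
      (Filter.EventuallyEq.refl _ _), Filter.Eventually.of_forall fun x => ?_⟩
    rw [key]
    field_simp
    ring

end Remainder

/-! ### Traveling waves and profiles -/

section Waves

variable {V : ℝ → ℝ} {κ c β μ w : ℝ} {r r₂ s : ℝ → ℝ}

theorem EvenSob.even_of_ae_eq {k b : ℝ} {u : WSob k b} (hu : u ∈ EvenSob k b) (hr : Continuous r)
    (h : u =ᵐ[volume] r) (x : ℝ) : r (-x) = r x := by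
  have h' := (Measure.measurePreserving_neg (volume : Measure ℝ)).quasiMeasurePreserving.ae_eq h
  have : (fun x => r (-x)) =ᵐ[volume] r := by
    filter_upwards [h, h', show ∀ᵐ x : ℝ, u (-x) = u x from hu] with x hx hx' hux
    simp only [Function.comp] at hx'
    rw [← hx, ← hux, hx']
  exact congrFun (((hr.comp continuous_neg).ae_eq_iff_eq volume hr).1 this) x

theorem OddSob.mem_of_ae_eq {k b : ℝ} {u : WSob k b} (h : u =ᵐ[volume] r)
    (hr : ∀ x, r (-x) = -r x) : u ∈ OddSob k b := by
  have h' := (Measure.measurePreserving_neg (volume : Measure ℝ)).quasiMeasurePreserving.ae_eq h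
  show ∀ᵐ x : ℝ, _
  filter_upwards [h, h'] with x hx hx'
  simp only [Function.comp] at hx'
  rw [hx, hx', hr]

theorem IsLinearization.congr_left {σ f g : ℝ → ℝ} (h : IsLinearization V c σ f g)
    (hs : σ =ᵐ[volume] s) : IsLinearization V c s f g := by
  obtain ⟨d, hd, he⟩ := h
  refine ⟨d, hd, ?_⟩
  have h1 : delta (delta fun y => deriv (deriv V) (σ y) * f y) =ᵐ[volume]
      delta (delta fun y => deriv (deriv V) (s y) * f y) := by
    refine delta_congr_ae (delta_congr_ae ?_)
    filter_upwards [hs] with y hy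
    rw [hy]
  filter_upwards [he, h1] with x hx h1x
  rw [hx, h1x]

/-- The solitary wave has an even classical representative. -/
theorem IsAdmissible.exists_profile (hc : c ≠ 0) (hG : ContDiff ℝ 1 (deriv V))
    (hV0 : deriv V 0 = 0) {σ : WSob 2 β} (hσ : IsAdmissible V c β σ) :
    ∃ s A, σ =ᵐ[volume] s ∧ (∀ x, s (-x) = s x) ∧ (∀ w, IsProfile 0 c w (deriv V) s) ∧
      (∀ x, |s x| ≤ A) ∧ HBound 2 β A s := by
  have hβ := hσ.rate_pos.le
  obtain ⟨C, hC, h⟩ := WSob.exists_continuous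
  obtain ⟨s, hs, hσs, hsC, hsW⟩ := h β hβ σ
  set A₀ := C * ‖σ‖ + ‖σ‖
  have hn := norm_nonneg σ
  have hCn : 0 ≤ C * ‖σ‖ := by positivity
  have hsA : ∀ x, |s x| ≤ A₀ := fun x => (hsC x).trans (le_add_of_nonneg_right hn)
  obtain ⟨A, hA, hA'⟩ := exists_hbound_two (b := β) hc hβ hG hV0 0 A₀
  obtain ⟨σ₂, hσ₂, he⟩ := hσ.wave
  have hce : ∀ w, coupling 0 c w (fun y => deriv V (s y)) =
      delta (delta fun y => deriv V (s y)) := fun w => by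
    funext x; simp [coupling]
  have hd : delta (delta fun y => deriv V (σ y)) =ᵐ[volume]
      delta (delta fun y => deriv V (s y)) := by
    refine delta_congr_ae (delta_congr_ae ?_)
    filter_upwards [hσs] with y hy
    rw [hy]
  have hweak : IsWeakDeriv2 s fun x => (c ^ 2)⁻¹ * delta (delta fun y => deriv V (s y)) x := by
    refine hσ₂.congr hσs ?_
    filter_upwards [he, hd] with x hx hdx
    rw [← hdx, eq_inv_mul_iff_mul_eq₀ (pow_ne_zero 2 hc)]
    linarith
  have key := hA' 1 s le_rfl hs hsA (hsW.mono (le_add_of_nonneg_left hCn)) (by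
    rw [hce]; exact hweak)
  refine ⟨s, max A A₀, hσs, EvenSob.even_of_ae_eq hσ.even hs hσs, fun w x => ?_,
    fun x => (hsA x).trans (le_max_right _ _), key.2.mono (le_max_left _ _)⟩
  have := key.1 x
  rwa [hce, ← hce w] at this

/-- The second component of a traveling wave at an antiresonance is the resonator response to the
first: the two differ by a solution of the homogeneous equation, which is periodic, and hence
vanishes if it lies in `L²`. -/
theorem IsTravelingWave.eq_resonator (hc : c ≠ 0) (hμ : 0 < μ)
    (hm : κ * (1 + μ) = c ^ 2 * μ * w ^ 2) (hw : 0 < w) (hsin : Real.sin w = 0)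
    (hcos : Real.cos w = 1) (hG : Continuous (deriv V)) {ρ₁ ρ₂ : ℝ → ℝ}
    (h : IsTravelingWave V c μ κ ρ₁ ρ₂) (h₁ : ρ₁ =ᵐ[volume] r) (hr : Continuous r) {M N : ℝ}
    (hrN : WBound 0 N fun y => deriv V (r y)) (h₂ : ρ₂ =ᵐ[volume] r₂) (hr₂ : Continuous r₂)
    (hr₂M : WBound 0 M r₂) :
    r₂ = resonator c w (fun y => deriv V (r y)) ∧
      IsWeakDeriv2 r fun x => (c ^ 2)⁻¹ * coupling κ c w (fun y => deriv V (r y)) x := by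
  obtain ⟨d₁, d₂, hd₁, hd₂, he₁, he₂⟩ := h
  have hc2 : c ^ 2 ≠ 0 := pow_ne_zero 2 hc
  have hg : Continuous fun y => deriv V (r y) := hG.comp hr
  have hV : (fun y => deriv V (ρ₁ y)) =ᵐ[volume] fun y => deriv V (r y) := by
    filter_upwards [h₁] with y hy
    rw [hy]
  have hres : r₂ = resonator c w fun y => deriv V (r y) := by
    have hec : Continuous fun x => -(w ^ 2 * r₂ x) - (c ^ 2)⁻¹ * delta (fun y => deriv V (r y)) x :=
      (continuous_const.mul hr₂).neg.sub (continuous_const.mul hg.delta)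
    have hweak : IsWeakDeriv2 r₂ fun x =>
        -(w ^ 2 * r₂ x) - (c ^ 2)⁻¹ * delta (fun y => deriv V (r y)) x := by
      refine hd₂.congr h₂ ?_
      filter_upwards [he₂, h₂, delta_congr_ae hV] with x hx h2x hVx
      rw [h2x, hVx, hm] at hx
      have : c ^ 2 * d₂ x + c ^ 2 * w ^ 2 * r₂ x + delta (fun y => deriv V (r y)) x = 0 := by
        refine (mul_eq_zero.1 (Eq.trans ?_ hx)).resolve_left hμ.ne'
        ring
      field_simp
      linarith
    obtain ⟨F, F', hF, hd, hd'⟩ := hweak.exists_hasDerivAt hec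
    have hFc : Continuous F := continuous_iff_continuousAt.2 fun x => (hd x).continuousAt
    obtain rfl : r₂ = F := (hr₂.ae_eq_iff_eq volume hFc).1 hF
    refine _root_.eq_resonator hc hw hsin hcos hg hd hd' hec (fun x => ?_) hr₂M hrN
    field_simp
    ring
  refine ⟨hres, hd₁.congr h₁ ?_⟩
  filter_upwards [he₁, delta_congr_ae (delta_congr_ae hV), delta_congr_ae h₂] with x hx hVx h2x
  rw [hVx, h2x, hres] at hx
  rw [eq_inv_mul_iff_mul_eq₀ hc2, coupling]
  linarith

/-- A profile together with the resonator response is a traveling wave. -/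
theorem IsProfile.isTravelingWave (hc : c ≠ 0)
    (hm : κ * (1 + μ) = c ^ 2 * μ * w ^ 2) (hw : 0 < w) (hsin : Real.sin w = 0)
    (hcos : Real.cos w = 1) {ρ₁ ρ₂ : ℝ → ℝ} (hr : IsProfile κ c w (deriv V) r) {b M : ℝ}
    (hg : HBound 2 b M fun y => deriv V (r y)) (h₁ : ρ₁ =ᵐ[volume] r)
    (h₂ : ρ₂ =ᵐ[volume] resonator c w fun y => deriv V (r y)) :
    IsTravelingWave V c μ κ ρ₁ ρ₂ := by
  have hc2 : c ^ 2 ≠ 0 := pow_ne_zero 2 hc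
  have hV : (fun y => deriv V (ρ₁ y)) =ᵐ[volume] fun y => deriv V (r y) := by
    filter_upwards [h₁] with y hy
    rw [hy]
  have hg' := hg.2.2
  have hg'' := hg'.2.2
  have dr := hasDerivAt_resonator (c := c) (w := w) (fun x => hg.hasDerivAt x) hg'.continuous
  have dr' := hasDerivAt_resonator (c := c) (w := w) (fun x => hg'.hasDerivAt x) hg''.continuous
  refine ⟨_, _, (isWeakDeriv2_of_hasDerivAt (fun x => (hr x).1) (fun x => (hr x).2)
    (continuous_const.mul (continuous_coupling hg.continuous))).congr h₁.symm
      (Filter.EventuallyEq.refl _ _),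
    (isWeakDeriv2_of_hasDerivAt dr dr' (continuous_resonator hg''.continuous)).congr h₂.symm
      (Filter.EventuallyEq.refl _ _), ?_, ?_⟩
  · filter_upwards [delta_congr_ae (delta_congr_ae hV), delta_congr_ae h₂] with x hVx h2x
    rw [hVx, h2x, mul_inv_cancel_left₀ hc2, coupling]
    ring
  · filter_upwards [h₂, delta_congr_ae hV] with x h2x hVx
    have := resonator_deriv_two hc hw hsin hcos (fun x => hg.hasDerivAt x)
      (fun x => hg'.hasDerivAt x) hg''.continuous x
    rw [hVx, h2x, hm]
    linear_combination μ * this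

end Waves

/-! ### Existence, uniqueness and regularity near the solitary wave -/

section Main

variable {V : ℝ → ℝ} {κ c β : ℝ} {s : ℝ → ℝ}

/-- The equation `H f = remainder f` has a solution of size `O(w⁻²)` at every large
antiresonant frequency `w`. -/
theorem exists_isLinearization_remainder (hc : c ≠ 0) (hβ : 0 < β) (hG : ContDiff ℝ 2 (deriv V))
    (hV0 : deriv V 0 = 0) {K : ℝ} (hK : 0 < K)
    (hinv : ∀ f ∈ EvenSob 2 β, ∀ g M, WBound β M g → IsLinearization V c s f g → ‖f‖ ≤ K * M)
    (hsolve : ∀ g M, WBound β M g → (∀ᵐ x, g (-x) = g x) → ∫ x, g x = 0 →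
        ∃ f ∈ EvenSob 2 β, IsLinearization V c s f g ∧ ‖f‖ ≤ K * M)
    {A : ℝ} (hse : ∀ x, s (-x) = s x) (hsA : ∀ x, |s x| ≤ A) (hsH : HBound 2 β A s) (κ : ℝ) :
    ∃ C W, 0 < C ∧ 1 ≤ W ∧ ∀ w, W ≤ w → Real.sin w = 0 → Real.cos w = 1 →
      ∃ f ∈ EvenSob 2 β, ‖f‖ ≤ C / w ^ 2 ∧ ∃ fc, Continuous fc ∧ f =ᵐ[volume] fc ∧
        (∀ x, |fc x| ≤ 1) ∧ WBound β ‖f‖ fc ∧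
        IsLinearization V c s fc (remainder κ c w (deriv V) s fc) := by
  obtain ⟨CE, hCE, hE⟩ := WSob.exists_continuous
  choose rep hrc hrep hrb hrW using hE β hβ.le
  obtain ⟨C₂, hC₂, h₂⟩ := WBound.remainder_sub (c := c) hc hβ.le hG κ A
  obtain ⟨C₃, hC₃, h₃⟩ := WBound.remainder_zero (G := deriv V) (c := c) hc hβ.le κ
  obtain ⟨C₄, hC₄, h₄⟩ := HBound.comp (m := 1) (b := β) (hG.of_le (by norm_num)) hV0 (2 * A)
  have hGs := h₄ s A (hsH.cbound hβ.le) hsH.pred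
  have hM := hGs.nonneg
  set P := C₃ * (C₄ * A) + 1
  have hP : 0 < P := by positivity
  set B := CE * (K * (2 * P))
  have hB : 0 ≤ B := by positivity
  refine ⟨K * (2 * P), 1 + B + 2 * K * (C₂ * (B + 1)), by positivity, ?_,
    fun w hw hsin hcos => ?_⟩
  · have : 0 ≤ 2 * K * (C₂ * (B + 1)) := by positivity
    linarith
  have hX : 0 ≤ 2 * K * (C₂ * (B + 1)) := by positivity
  have hw1 : 1 ≤ w := by linarith
  have hw0 : 0 < w := by linarith
  have hww : w ≤ w ^ 2 := by nlinarith
  -- `P / w ^ 2` bounds the residual; the contraction factor `1 / 2` permits twice this radius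
  set r := 2 * P / w ^ 2
  have hr : 0 ≤ r := by positivity
  set a := CE * (K * r)
  have hab : a ≤ B * w⁻¹ := by
    have : a = B * (w ^ 2)⁻¹ := by simp only [a, r, B]; ring
    rw [this]
    gcongr
  have ha1 : a ≤ 1 := by
    refine hab.trans ?_
    rw [← div_eq_mul_inv, div_le_one hw0]; linarith
  set q := C₂ * (a + w⁻¹)
  have ha0 : 0 ≤ a := by positivity
  have hq : 0 ≤ q := by positivity
  have hqK : q * K ≤ 1 / 2 := by
    have h1 : q ≤ C₂ * ((B + 1) * w⁻¹) := by
      simp only [q]; gcongr; linarith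
    calc q * K ≤ C₂ * ((B + 1) * w⁻¹) * K := by gcongr
      _ = (K * (C₂ * (B + 1))) / w := by ring
      _ ≤ 1 / 2 := by rw [div_le_iff₀ hw0]; linarith
  have hfa : ∀ f : WSob 2 β, ‖f‖ ≤ K * r → ∀ x, |rep f x| ≤ a := fun f hf x =>
    (hrb f x).trans (by simp only [a]; gcongr)
  have hsub : ∀ f f' : WSob 2 β, WBound β ‖f - f'‖ fun x => rep f x - rep f' x := by
    intro f f'
    refine (hrW (f - f')).congr ?_
    filter_upwards [hrep f, hrep f', hrep (f - f'), WSob.coeFn_sub f f'] with x e1 e2 e3 e4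
    rw [← e3, e4, e1, e2]
  have hsc := hsH.continuous
  have h0 : WBound β (P / w ^ 2) (remainder κ c w (deriv V) s fun _ => 0) := by
    refine (h₃ w _ s hw1 hcos hGs).mono ?_
    gcongr
    simp only [P]; linarith
  have hN : ∀ f ∈ EvenSob 2 β, ‖f‖ ≤ K * r →
      WBound β r (remainder κ c w (deriv V) s (rep f)) ∧
      (∀ᵐ x, remainder κ c w (deriv V) s (rep f) (-x) = remainder κ c w (deriv V) s (rep f) x) ∧
      ∫ x, remainder κ c w (deriv V) s (rep f) x = 0 := by
    intro f hf hfr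
    refine ⟨?_, ?_, ?_⟩
    · have h1 := (h₂ w a ‖f‖ s (rep f) (fun _ => 0) hw1 ha1 hsc (hrc f) continuous_const hsA
        (hfa f hfr) (fun x => by simpa using ha0)
        ((hrW f).congr (Filter.Eventually.of_forall fun x => by simp))).add h0
      refine (h1.mono ?_).congr (Filter.Eventually.of_forall fun x => by simp)
      have h2 : q * ‖f‖ ≤ q * (K * r) := by gcongr
      have h3 : q * (K * r) ≤ 1 / 2 * r := by rw [← mul_assoc]; gcongr
      have h4 : P / w ^ 2 = 1 / 2 * r := by simp only [r]; ring
      linarith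
    · exact Filter.Eventually.of_forall
        (remainder_neg hsin hcos hse (EvenSob.even_of_ae_eq hf (hrc f) (hrep f)))
    · have hA0 : 0 ≤ A := hsH.nonneg
      have hn := norm_nonneg f
      refine integral_remainder (A := A + 1 + ‖f‖) hβ hc hw1 hG hV0
        (hsH.pred.pred.mono (by linarith)) (fun x => (hsA x).trans (by linarith))
        ⟨(hrW f).mono (by linarith), hrc f⟩ (fun x => (hfa f hfr x).trans (by linarith))
  have hlip : ∀ f ∈ EvenSob 2 β, ∀ f' ∈ EvenSob 2 β, ‖f‖ ≤ K * r → ‖f'‖ ≤ K * r →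
      WBound β (q * ‖f - f'‖) fun x => remainder κ c w (deriv V) s (rep f) x -
        remainder κ c w (deriv V) s (rep f') x := by
    intro f _ f' _ hfr hfr'
    exact h₂ w a _ s (rep f) (rep f') hw1 ha1 hsc (hrc f) (hrc f') hsA (hfa f hfr) (hfa f' hfr')
      (hsub f f')
  obtain ⟨f, hf, hfr, hfl⟩ := exists_isLinearization_eq hβ hK hinv hsolve hr hq hqK
    (fun f => remainder κ c w (deriv V) s (rep f)) hN hlip
  refine ⟨f, hf, hfr.trans (le_of_eq ?_), rep f, hrc f, hrep f,
    fun x => (hfa f hfr x).trans ha1, hrW f, hfl.congr (hrep f) (Filter.EventuallyEq.refl _ _)⟩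
  simp only [r]; ring

/-- Solutions of `H f = remainder f` of size `O(w⁻²)` are unique for large `w`. -/
theorem eq_of_isLinearization_remainder (hc : c ≠ 0) (hβ : 0 < β) (hG : ContDiff ℝ 2 (deriv V))
    {K : ℝ} (hK : 0 < K)
    (hinv : ∀ f ∈ EvenSob 2 β, ∀ g M, WBound β M g → IsLinearization V c s f g → ‖f‖ ≤ K * M)
    {A : ℝ} (hsc : Continuous s) (hsA : ∀ x, |s x| ≤ A) (κ R : ℝ) (hR : 0 ≤ R) :
    ∃ W, 1 ≤ W ∧ ∀ w, W ≤ w → ∀ f ∈ EvenSob 2 β, ∀ f' ∈ EvenSob 2 β, ∀ fc fc' : ℝ → ℝ,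
      Continuous fc → Continuous fc' → f =ᵐ[volume] fc → f' =ᵐ[volume] fc' →
      (∀ x, |fc x| ≤ R / w ^ 2) → (∀ x, |fc' x| ≤ R / w ^ 2) →
      IsLinearization V c s fc (remainder κ c w (deriv V) s fc) →
      IsLinearization V c s fc' (remainder κ c w (deriv V) s fc') → f = f' := by
  obtain ⟨C₂, hC₂, h₂⟩ := WBound.remainder_sub (c := c) hc hβ.le hG κ A
  obtain ⟨CE, -, hE⟩ := WSob.exists_continuous
  have hX : 0 ≤ 2 * (K * (C₂ * (R + 1))) := by positivity
  refine ⟨1 + R + 2 * (K * (C₂ * (R + 1))), by linarith,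
    fun w hw f hf f' hf' fc fc' hfc hfc' hff hff' hb hb' hl hl' => ?_⟩
  have hw1 : 1 ≤ w := by linarith
  have hw0 : 0 < w := by linarith
  have hRw : R / w ^ 2 ≤ R * w⁻¹ := by
    rw [div_eq_mul_inv]
    gcongr
    nlinarith
  have hR1 : R * w⁻¹ ≤ 1 := by rw [← div_eq_mul_inv, div_le_one hw0]; linarith
  obtain ⟨d, -, hd, -, hdW⟩ := hE β hβ.le (f - f')
  have hdW' : WBound β ‖f - f'‖ fun x => fc x - fc' x := by
    refine hdW.congr ?_
    filter_upwards [hff, hff', hd, WSob.coeFn_sub f f'] with x e1 e2 e3 e4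
    rw [← e3, e4, e1, e2]
  have h1 := h₂ w (R * w⁻¹) _ s fc fc' hw1 hR1 hsc hfc hfc' hsA (fun x => (hb x).trans hRw)
    (fun x => (hb' x).trans hRw) hdW'
  have h3 := hinv (f - f') (EvenSob.sub_mem hf hf') _ _ h1 ((hl.sub hl').congr (by
    filter_upwards [hff, hff', WSob.coeFn_sub f f'] with x e1 e2 e4
    rw [e4, e1, e2]) (Filter.EventuallyEq.refl _ _))
  have h4 : K * (C₂ * (R * w⁻¹ + w⁻¹) * ‖f - f'‖) ≤ 1 / 2 * ‖f - f'‖ := by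
    rw [← mul_assoc]
    refine mul_le_mul_of_nonneg_right ?_ (norm_nonneg _)
    rw [show K * (C₂ * (R * w⁻¹ + w⁻¹)) = K * (C₂ * (R + 1)) / w by ring, div_le_iff₀ hw0]
    linarith
  have h5 : ‖f - f'‖ = 0 := by linarith [norm_nonneg (f - f')]
  exact sub_eq_zero.1 (norm_eq_zero.1 h5)

/-- The response of the resonator to a profile is of order `w⁻¹` in `H²`. -/
theorem IsProfile.exists_hbound_resonator (hc : c ≠ 0) (hβ : 0 ≤ β) {G : ℝ → ℝ}
    (hG : ContDiff ℝ 3 G) (hG0 : G 0 = 0) (κ A : ℝ) :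
    ∃ C, 0 ≤ C ∧ ∀ w r, 1 ≤ w → IsProfile κ c w G r → HBound 2 β A r →
      (∃ M, HBound 2 β M fun y => G (r y)) ∧
        HBound 2 β (C / w) (resonator c w fun y => G (r y)) := by
  obtain ⟨C₃, hC₃, h₃⟩ := IsProfile.exists_hbound hc hβ hG0 κ 1 (hG.of_le (by norm_num)) A
  obtain ⟨C₄, hC₄, h₄⟩ := HBound.comp (m := 2) (b := β) (hG.of_le (by norm_num)) hG0 (2 * C₃)
  refine ⟨(c ^ 2)⁻¹ * Real.exp β ^ 2 * (C₄ * C₃), by positivity, fun w r hw hp hr => ?_⟩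
  have h := h₃ w r hw hp hr
  have hg := h₄ r C₃ (h.cbound hβ) h.pred
  exact ⟨⟨_, hg⟩, hg.resonator hc (by linarith) hβ⟩

/-- For smooth forces, a profile near the solitary wave has uniform bounds in every Sobolev space,
and its distance to the solitary wave and the response of the resonator are of order `w⁻²`. -/
theorem IsProfile.exists_hbound_of_contDiff (hc : c ≠ 0) (hβ : 0 ≤ β) {G : ℝ → ℝ}
    (hG : ContDiff ℝ ∞ G) (hG0 : G 0 = 0) (κ A : ℝ) (m : ℕ) :
    ∃ C, 0 ≤ C ∧ ∀ w r s D, 1 ≤ w → Real.cos w = 1 → IsProfile κ c w G r → IsProfile 0 c w G s →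
      HBound 2 β A r → HBound 2 β A s → WBound β D (fun x => r x - s x) →
      HBound (m + 2) β C r ∧ HBound (m + 2) β C s ∧
        HBound (m + 2) β (C * (D + (w ^ 2)⁻¹)) (fun x => r x - s x) ∧
        HBound (m + 2) β (C * (w ^ 2)⁻¹) (resonator c w fun y => G (r y)) := by
  have hGn : ∀ n : ℕ, ContDiff ℝ n G := fun n => hG.of_le (mod_cast le_top)
  obtain ⟨C₁, hC₁, h₁⟩ := IsProfile.exists_hbound hc hβ hG0 κ (m + 2) (mod_cast hGn (m + 3)) A
  obtain ⟨C₂, hC₂, h₂⟩ := IsProfile.exists_hbound hc hβ hG0 0 (m + 2) (mod_cast hGn (m + 3)) A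
  obtain ⟨C₃, hC₃, h₃⟩ := IsProfile.hbound_sub hc hβ hG0 κ m (mod_cast hGn (m + 2)) (C₁ + C₂)
  obtain ⟨C₄, hC₄, h₄⟩ := HBound.comp (m := m + 3) (b := β) (mod_cast hGn (m + 4)) hG0 (2 * C₁)
  set C₅ := 3 * (c ^ 2)⁻¹ * Real.exp β ^ 2 * (C₄ * C₁)
  have hC₅ : 0 ≤ C₅ := by positivity
  refine ⟨C₁ + C₂ + C₃ + C₅, by positivity, fun w r s D hw hcos hr hs hrA hsA hD => ?_⟩
  have hr4 := h₁ w r hw hr hrA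
  have hs4 := h₂ w s hw hs hsA
  have hr2 := hr4.pred.pred
  have hs2 := hs4.pred.pred
  have hw2 : 0 ≤ (w ^ 2)⁻¹ := by positivity
  have hD0 := hD.nonneg
  refine ⟨hr2.mono (by linarith), hs2.mono (by linarith),
    (h₃ w r s D hw hcos hr hs (hr2.mono (by linarith)) (hs2.mono (by linarith)) hD).mono ?_,
    ((h₄ r C₁ (hr4.cbound hβ) hr4.pred).resonator_sq hc (by linarith) hcos hβ).mono ?_⟩
  · gcongr
    linarith
  · rw [div_eq_mul_inv]
    gcongr
    simp only [C₅] at *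
    linarith

end Main

/-! ### Antiresonant traveling waves -/

section Solution

variable {V : ℝ → ℝ} {κ c β : ℝ} {s : ℝ → ℝ}

theorem sin_two_mul_nat_mul_pi (n : ℕ) : Real.sin (2 * n * Real.pi) = 0 := by
  rw [show 2 * (n : ℝ) * Real.pi = ((2 * n : ℕ) : ℝ) * Real.pi by push_cast; ring]
  exact Real.sin_nat_mul_pi _

theorem cos_two_mul_nat_mul_pi (n : ℕ) : Real.cos (2 * n * Real.pi) = 1 := by
  rw [show 2 * (n : ℝ) * Real.pi = n * (2 * Real.pi) by ring]
  exact Real.cos_nat_mul_two_pi n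

theorem natCast_le_two_mul_nat_mul_pi (n : ℕ) : (n : ℝ) ≤ 2 * n * Real.pi := by
  have := mul_le_mul_of_nonneg_left Real.pi_gt_three.le (Nat.cast_nonneg n : (0 : ℝ) ≤ n)
  linarith [(Nat.cast_nonneg n : (0 : ℝ) ≤ n)]

/-- The traveling waves in question are classical, with bounds independent of `n`, and their second
component is determined by the first. -/
theorem IsMassSolution.exists_profile (hc : c ≠ 0) (hκ : 0 < κ) (hβ : 0 ≤ β)
    (hG : ContDiff ℝ 1 (deriv V)) (hV0 : deriv V 0 = 0) {σ : WSob 2 β} (hσs : σ =ᵐ[volume] s)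
    (hsc : Continuous s) {A₀ : ℝ} (hsA : ∀ x, |s x| ≤ A₀) (hsW : WBound β A₀ s) {E : ℝ}
    (hE0 : 0 ≤ E) (hE : ∀ u : WSob 2 β, ∃ f : ℝ → ℝ, Continuous f ∧ u =ᵐ[volume] f ∧
      (∀ x, |f x| ≤ E * ‖u‖) ∧ WBound β ‖u‖ f) :
    ∃ A, ∀ (C : ℝ) (n : ℕ) (ρ : WSob 2 β × WSob 2 β), 1 ≤ n →
      κ < 4 * Real.pi ^ 2 * c ^ 2 * (n : ℝ) ^ 2 → E * (C / (n : ℝ) ^ 2) ≤ 1 →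
      C / (n : ℝ) ^ 2 ≤ 1 → IsMassSolution V c κ β σ C n ρ →
      ∃ r, ρ.1 =ᵐ[volume] r ∧
        ρ.2 =ᵐ[volume] resonator c (2 * n * Real.pi) (fun y => deriv V (r y)) ∧
        IsProfile κ c (2 * n * Real.pi) (deriv V) r ∧ HBound 2 β A r ∧
        WBound β (C / (n : ℝ) ^ 2) (fun x => r x - s x) ∧
        ∀ x, |r x - s x| ≤ E * (C / (n : ℝ) ^ 2) := by
  obtain ⟨A, -, hA⟩ := exists_hbound_two (b := β) hc hβ hG hV0 κ (A₀ + 1)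
  obtain ⟨C₁, -, h₁⟩ := HBound.comp (m := 0) (b := β) (by simpa using hG) hV0 (A₀ + 1)
  refine ⟨A, fun C n ρ hn hnκ hE1 hC1 hρ => ?_⟩
  have hw1 : 1 ≤ 2 * (n : ℝ) * Real.pi :=
    (Nat.one_le_cast.2 hn).trans (natCast_le_two_mul_nat_mul_pi n)
  obtain ⟨hμ, hm, -⟩ := resonatorMass_spec hc hκ hnκ
  obtain ⟨d, hd, hud, hdb, hdW⟩ := hE (ρ.1 - σ)
  obtain ⟨r₂, hr₂, hρ₂, -, hr₂W⟩ := hE ρ.2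
  have hnorm : ‖ρ.1 - σ‖ ≤ C / (n : ℝ) ^ 2 := by rw [norm_sub_rev]; exact hρ.close
  have hdb' : ∀ x, |d x| ≤ E * (C / (n : ℝ) ^ 2) := fun x => (hdb x).trans (by gcongr)
  have hr : Continuous fun x => s x + d x := hsc.add hd
  have hρ₁ : ρ.1 =ᵐ[volume] fun x => s x + d x := by
    filter_upwards [hud, hσs, WSob.coeFn_sub ρ.1 σ] with x e1 e2 e3
    rw [← e1, e3, e2]; ring
  have hrA : ∀ x, |s x + d x| ≤ A₀ + 1 := fun x =>
    (abs_add_le _ _).trans (add_le_add (hsA x) ((hdb' x).trans hE1))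
  have hrW : WBound β (A₀ + 1) fun x => s x + d x := hsW.add (hdW.mono (hnorm.trans hC1))
  have hgW := (h₁ _ _ ⟨hrA, hr⟩ ⟨hrW, hr⟩).wbound.weight_zero hβ
  obtain ⟨hres, hweak⟩ := hρ.solves.eq_resonator hc hμ hm (by linarith) (sin_two_mul_nat_mul_pi n)
    (cos_two_mul_nat_mul_pi n) hG.continuous hρ₁ hr hgW hρ₂ hr₂ (hr₂W.weight_zero hβ)
  obtain ⟨hp, hH⟩ := hA _ _ hw1 hr hrA hrW hweak
  refine ⟨_, hρ₁, hres ▸ hρ₂, hp, hH, ?_, fun x => ?_⟩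
  · exact (hdW.mono hnorm).congr (Filter.Eventually.of_forall fun x => by simp)
  · simpa using hdb' x

end Solution

theorem theorem1 (V : ℝ → ℝ) (hV : ContDiff ℝ 5 V) (hV0 : deriv V 0 = 0)
    (c : ℝ) (hc : c ≠ 0) (β : ℝ) (σ : WSob 2 β) (hσ : IsAdmissible V c β σ)
    (κ : ℝ) (hκ : 0 < κ) :
    ∃ C : ℝ, 0 < C ∧ ∃ N : ℕ,
      (∀ n : ℕ, N ≤ n →
        0 < resonatorMass c κ n ∧
        naturalFrequency c (resonatorMass c κ n) κ = 2 * (n : ℝ) * Real.pi ∧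
        ∃! ρ : WSob 2 β × WSob 2 β, IsMassSolution V c κ β σ C n ρ) ∧
      (ContDiff ℝ ∞ V →
        (∀ n : ℕ, N ≤ n → ∀ ρ : WSob 2 β × WSob 2 β, IsMassSolution V c κ β σ C n ρ →
          IsSmoothClass ρ.1 ∧ IsSmoothClass ρ.2) ∧
        ∀ s : ℝ, 0 ≤ s → ∃ Cs : ℝ, 0 < Cs ∧
          ∀ n : ℕ, N ≤ n → ∀ ρ : WSob 2 β × WSob 2 β, IsMassSolution V c κ β σ C n ρ →
            ∃ (hσs : (σ : ℝ →ₘ[volume] ℝ) ∈ WSob s β)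
              (h₁ : (ρ.1 : ℝ →ₘ[volume] ℝ) ∈ WSob s β)
              (h₂ : (ρ.2 : ℝ →ₘ[volume] ℝ) ∈ WSob s β),
              ‖(⟨σ, hσs⟩ - ⟨ρ.1, h₁⟩ : WSob s β)‖ + ‖(⟨ρ.2, h₂⟩ : WSob s β)‖
                ≤ Cs / (n : ℝ) ^ 2) := by
  have hβ := hσ.rate_pos
  have hG4 : ContDiff ℝ 4 (deriv V) := (contDiff_succ_iff_deriv.1 (show ContDiff ℝ (4 + 1) V by
    convert hV using 1; norm_num)).2.2
  have hG3 : ContDiff ℝ 3 (deriv V) := hG4.of_le (by norm_num)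
  have hG2 : ContDiff ℝ 2 (deriv V) := hG4.of_le (by norm_num)
  have hG1 : ContDiff ℝ 1 (deriv V) := hG4.of_le (by norm_num)
  obtain ⟨s, A₀, hσs, hse, hsp, hsA, hsH⟩ := hσ.exists_profile hc hG1 hV0
  have hsc := hsH.continuous
  obtain ⟨K, hK, hinv, hsolve⟩ := hσ.exists_inverse_bound
  have hinv' : ∀ f ∈ EvenSob 2 β, ∀ g M, WBound β M g → IsLinearization V c s f g →
      ‖f‖ ≤ K * M := fun f hf g M hg h => hinv f hf g M hg (h.congr_left hσs.symm)
  have hsolve' : ∀ g M, WBound β M g → (∀ᵐ x, g (-x) = g x) → ∫ x, g x = 0 →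
      ∃ f ∈ EvenSob 2 β, IsLinearization V c s f g ∧ ‖f‖ ≤ K * M := fun g M h1 h2 h3 => by
    obtain ⟨f, hf, hl, hn⟩ := hsolve g M h1 h2 h3
    exact ⟨f, hf, hl.congr_left hσs, hn⟩
  obtain ⟨E, hE0, hE'⟩ := WSob.exists_continuous
  have hE := hE' β hβ.le
  obtain ⟨C₁, W₁, hC₁, hW₁, hex⟩ := exists_isLinearization_remainder hc hβ hG2 hV0 hK hinv'
    hsolve' hse hsA hsH κ
  obtain ⟨A₂, hA₂, h₂⟩ := exists_hbound_two (b := β) hc hβ.le hG1 hV0 κ (A₀ + 1)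
  obtain ⟨C₃, hC₃, h₃⟩ := IsProfile.exists_hbound_resonator hc hβ.le hG3 hV0 κ A₂
  obtain ⟨C₄, hC₄, h₄⟩ := HBound.exists_mem_wsob (s := 2) (k := 1) (by norm_num) hβ.le
  obtain ⟨A, hA⟩ := IsMassSolution.exists_profile hc hκ hβ.le hG1 hV0 hσs hsc hsA hsH.wbound hE0 hE
  -- the two summands account for `‖σ - ρ₁‖` and for `‖ρ₂‖`
  set C := C₁ + C₄ * C₃
  have hC : 0 < C := by positivity
  have hpi := Real.pi_gt_three
  obtain ⟨W₂, hW₂, huniq⟩ := eq_of_isLinearization_remainder hc hβ hG2 hK hinv' hsc hsA κ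
    (E * C * (4 * Real.pi ^ 2)) (by positivity)
  obtain ⟨N, hN⟩ := exists_nat_gt (W₁ + W₂ + κ / c ^ 2 + E * C + C)
  have hκc : 0 < κ / c ^ 2 := by positivity
  have hEC : 0 ≤ E * C := by positivity
  -- all the largeness conditions on `n`
  have hn : ∀ n : ℕ, N ≤ n → 1 ≤ n ∧ W₁ ≤ 2 * n * Real.pi ∧ W₂ ≤ 2 * n * Real.pi ∧
      κ < 4 * Real.pi ^ 2 * c ^ 2 * (n : ℝ) ^ 2 ∧ E * (C / (n : ℝ) ^ 2) ≤ 1 ∧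
      C / (n : ℝ) ^ 2 ≤ 1 := by
    intro n hNn
    have hNn' : (N : ℝ) ≤ n := by exact_mod_cast hNn
    have h1 : (1 : ℝ) ≤ n := by linarith
    have hw := natCast_le_two_mul_nat_mul_pi n
    have hsq : (n : ℝ) ≤ (n : ℝ) ^ 2 := by nlinarith
    have hn2 : (0 : ℝ) < (n : ℝ) ^ 2 := by positivity
    refine ⟨by exact_mod_cast h1, by linarith, by linarith, ?_, ?_, ?_⟩
    · have h2 : κ < c ^ 2 * (n : ℝ) ^ 2 := by
        rw [mul_comm, ← div_lt_iff₀ (by positivity)]; linarith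
      have h3 : 1 * (c ^ 2 * (n : ℝ) ^ 2) ≤ 4 * Real.pi ^ 2 * (c ^ 2 * (n : ℝ) ^ 2) := by
        gcongr
        nlinarith
      linarith
    · rw [← mul_div_assoc, div_le_one hn2]; linarith
    · rw [div_le_one hn2]; linarith
  have hsin := sin_two_mul_nat_mul_pi
  have hcos := cos_two_mul_nat_mul_pi
  refine ⟨C, hC, N, fun n hNn => ?_, fun hVs => ?_⟩
  · obtain ⟨hn1, hnW₁, hnW₂, hnκ, hnE, hnC⟩ := hn n hNn
    obtain ⟨hμ, hm, hfreq⟩ := resonatorMass_spec hc hκ hnκ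
    have hn0 : (0 : ℝ) < n := by exact_mod_cast hn1
    refine ⟨hμ, hfreq, ?_⟩
    have hw1 : 1 ≤ 2 * (n : ℝ) * Real.pi := hW₁.trans hnW₁
    have hnw := natCast_le_two_mul_nat_mul_pi n
    refine existsUnique_of_exists_of_unique ?_ ?_
    · obtain ⟨f, hf, hfn, fc, hfc, hffc, hfc1, hfW, hfl⟩ := hex _ hnW₁ (hsin n) (hcos n)
      have hfC : ‖f‖ ≤ C₁ / (n : ℝ) ^ 2 := hfn.trans (by gcongr)
      have hCC : C₁ / (n : ℝ) ^ 2 ≤ C / (n : ℝ) ^ 2 := by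
        gcongr; simp only [C]; linarith [mul_nonneg hC₄ hC₃]
      have hrA : ∀ x, |s x + fc x| ≤ A₀ + 1 := fun x =>
        (abs_add_le _ _).trans (add_le_add (hsA x) (hfc1 x))
      have hrc : Continuous fun x => s x + fc x := hsc.add hfc
      obtain ⟨hp, hH⟩ := h₂ _ _ hw1 hrc hrA
        (hsH.wbound.add (hfW.mono (hfC.trans (hCC.trans hnC))))
        ((isLinearization_remainder_iff hc hG2 (hsp _)).1 hfl)
      obtain ⟨⟨M, hM⟩, hres⟩ := h₃ _ _ hw1 hp hH
      have hmk := AEEqFun.coeFn_mk _ hres.continuous.aestronglyMeasurable (μ := volume)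
      obtain ⟨hmem, hnorm⟩ := h₄ _ _ _ hmk hres
      have hρ₁ : (σ + f : WSob 2 β) =ᵐ[volume] fun x => s x + fc x := by
        filter_upwards [WSob.coeFn_add σ f, hσs, hffc] with x e1 e2 e3
        rw [e1, e2, e3]
      have hfe := EvenSob.even_of_ae_eq hf hfc hffc
      refine ⟨(σ + f, ⟨_, hmem⟩), ?_, EvenSob.add_mem hσ.even hf, ?_, ?_, ?_⟩
      · exact hp.isTravelingWave hc hm (by linarith) (hsin n) (hcos n) hM hρ₁ hmk
      · exact OddSob.mem_of_ae_eq hmk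
          (resonator_neg_of_even (hsin n) (hcos n) fun y => by rw [hse, hfe])
      · simpa using hfC.trans hCC
      · refine hnorm.trans ?_
        rw [← mul_div_assoc]
        have : C₄ * C₃ ≤ C := by simp only [C]; linarith
        gcongr
    · intro ρ ρ' hρ hρ'
      obtain ⟨r, h1, h2, hp, hH, -, hb⟩ := hA C n ρ hn1 hnκ hnE hnC hρ
      obtain ⟨r', h1', h2', hp', hH', -, hb'⟩ := hA C n ρ' hn1 hnκ hnE hnC hρ'
      have hlin : ∀ r, IsProfile κ c (2 * n * Real.pi) (deriv V) r → Continuous r →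
          IsLinearization V c s (fun x => r x - s x)
            (remainder κ c (2 * n * Real.pi) (deriv V) s fun x => r x - s x) := by
        intro r hp hrc
        rw [isLinearization_remainder_iff hc hG2 (hsp _)]
        simp only [add_sub_cancel]
        exact isWeakDeriv2_of_hasDerivAt (fun x => (hp x).1) (fun x => (hp x).2)
          (continuous_const.mul (continuous_coupling (hG1.continuous.comp hrc)))
      have hae : ∀ (u : WSob 2 β) r, u =ᵐ[volume] r →
          (u - σ : WSob 2 β) =ᵐ[volume] fun x => r x - s x := by
        intro u r hu
        filter_upwards [WSob.coeFn_sub u σ, hu, hσs] with x e1 e2 e3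
        rw [e1, e2, e3]
      -- the uniqueness statement is in terms of `w = 2πn`, the closeness condition in terms of `n`
      have hR : E * C * (4 * Real.pi ^ 2) / (2 * n * Real.pi) ^ 2 = E * (C / (n : ℝ) ^ 2) := by
        field_simp
        ring
      have heq : ρ.1 - σ = ρ'.1 - σ := huniq _ hnW₂ _ (EvenSob.sub_mem hρ.even hσ.even) _
        (EvenSob.sub_mem hρ'.even hσ.even) _ _ (hH.continuous.sub hsc) (hH'.continuous.sub hsc)
        (hae _ _ h1) (hae _ _ h1') (by rwa [hR]) (by rwa [hR]) (hlin r hp hH.continuous)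
        (hlin r' hp' hH'.continuous)
      have heq₁ : ρ.1 = ρ'.1 := sub_left_injective heq
      have hrr : r = r' := (hH.continuous.ae_eq_iff_eq volume hH'.continuous).1
        (h1.symm.trans (heq₁ ▸ h1'))
      exact Prod.ext heq₁ (WSob.ext_ae (h2.trans (hrr ▸ h2'.symm)))
  · have hGs : ContDiff ℝ ∞ (deriv V) := (contDiff_infty_iff_deriv.1 hVs).2
    -- uniform bounds of every order for the solutions
    have key : ∀ m : ℕ, ∃ B, 0 ≤ B ∧ ∀ n : ℕ, N ≤ n → ∀ ρ : WSob 2 β × WSob 2 β,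
        IsMassSolution V c κ β σ C n ρ → ∃ r, ρ.1 =ᵐ[volume] r ∧
          ρ.2 =ᵐ[volume] resonator c (2 * n * Real.pi) (fun y => deriv V (r y)) ∧
          HBound (m + 2) β B r ∧ HBound (m + 2) β B s ∧
          HBound (m + 2) β (B / (n : ℝ) ^ 2) (fun x => r x - s x) ∧
          HBound (m + 2) β (B / (n : ℝ) ^ 2)
            (resonator c (2 * n * Real.pi) fun y => deriv V (r y)) := by
      intro m
      obtain ⟨B, hB, h⟩ := IsProfile.exists_hbound_of_contDiff hc hβ.le hGs hV0 κ (max A A₀) m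
      refine ⟨B * (C + 1), by positivity, fun n hNn ρ hρ => ?_⟩
      obtain ⟨hn1, hnW₁, -, hnκ, hnE, hnC⟩ := hn n hNn
      obtain ⟨r, h1, h2, hp, hH, hd, -⟩ := hA C n ρ hn1 hnκ hnE hnC hρ
      have hn0 : (0 : ℝ) < n := by exact_mod_cast hn1
      have hnw := natCast_le_two_mul_nat_mul_pi n
      obtain ⟨e1, e2, e3, e4⟩ := h _ r s _ (hW₁.trans hnW₁) (hcos n) hp (hsp _)
        (hH.mono (le_max_left _ _)) (hsH.mono (le_max_right _ _)) hd
      have hB1 : B ≤ B * (C + 1) := le_mul_of_one_le_right hB (by linarith)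
      have hw2 : ((2 * n * Real.pi) ^ 2)⁻¹ ≤ ((n : ℝ) ^ 2)⁻¹ := by gcongr
      refine ⟨r, h1, h2, e1.mono hB1, e2.mono hB1, e3.mono ?_, e4.mono ?_⟩
      · rw [mul_div_assoc, add_div C 1, one_div]
        gcongr
      · rw [div_eq_mul_inv]
        gcongr
    refine ⟨fun n hNn ρ hρ => ?_, fun k hk => ?_⟩
    · obtain ⟨-, -, -, hnκ, hnE, hnC⟩ := hn n hNn
      obtain ⟨hn1, -⟩ := hn n hNn
      obtain ⟨r, h1, h2, -, hH, -, -⟩ := hA C n ρ hn1 hnκ hnE hnC hρ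
      obtain ⟨B, -, h⟩ := key 0
      -- the representatives are continuous, hence the same for all orders
      have hrep : ∀ m : ℕ, ContDiff ℝ m r ∧
          ContDiff ℝ m (resonator c (2 * n * Real.pi) fun y => deriv V (r y)) := by
        intro m
        obtain ⟨B, -, h⟩ := key m
        obtain ⟨r', h1', -, e1, -, -, e4⟩ := h n hNn ρ hρ
        obtain rfl : r = r' :=
          (hH.continuous.ae_eq_iff_eq volume e1.continuous).1 (h1.symm.trans h1')
        exact ⟨e1.pred.pred.contDiff, e4.pred.pred.contDiff⟩
      exact ⟨⟨r, contDiff_infty.2 fun m => (hrep m).1, h1⟩,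
        ⟨_, contDiff_infty.2 fun m => (hrep m).2, h2⟩⟩
    · obtain ⟨j, hj⟩ := exists_nat_ge k
      obtain ⟨B, hB, h⟩ := key (2 * j)
      obtain ⟨D, hD, hmem⟩ := HBound.exists_mem_wsob (s := k) (k := j + 1)
        (by push_cast; linarith) hβ.le
      refine ⟨2 * (D * B) + 1, by positivity, fun n hNn ρ hρ => ?_⟩
      obtain ⟨hn1, -⟩ := hn n hNn
      have hn0 : (0 : ℝ) < n := by exact_mod_cast hn1
      obtain ⟨r, h1, h2, e1, e2, e3, e4⟩ := h n hNn ρ hρ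
      obtain ⟨hσm, -⟩ := hmem _ _ _ hσs e2
      obtain ⟨hm₁, -⟩ := hmem _ _ _ h1 e1
      obtain ⟨hm₂, hn₂⟩ := hmem _ _ _ h2 e4
      -- the difference may be formed in `H²_β`: its class of functions is the same in `H^k_β`
      have hdiff : ((ρ.1 - σ : WSob 2 β) : ℝ →ₘ[volume] ℝ) =ᵐ[volume] fun x => r x - s x := by
        filter_upwards [WSob.coeFn_sub ρ.1 σ, h1, hσs] with x e1 e2 e3
        rw [e1, e2, e3]
      obtain ⟨hm₃, hn₃⟩ := hmem _ _ _ hdiff e3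
      refine ⟨hσm, hm₁, hm₂, ?_⟩
      have hle : ‖(⟨σ, hσm⟩ - ⟨ρ.1, hm₁⟩ : WSob k β)‖ ≤ D * (B / (n : ℝ) ^ 2) := by
        rw [norm_sub_rev]
        exact hn₃
      calc _ ≤ D * (B / (n : ℝ) ^ 2) + D * (B / (n : ℝ) ^ 2) := add_le_add hle hn₂
        _ = 2 * (D * B) / (n : ℝ) ^ 2 := by ring
        _ ≤ _ := by gcongr; linarith
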